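/- Let $G$ be a finite graph, in which parallel edges are allowed but loops are not, of maximum degree $3$ (the degree of a vertex is the number of edges incident with it). Let $H_1$ be the graph obtained from $K_2^3$ (two vertices joined by three parallel edges) by subdividing one edge, and let $H_2$ be the graph obtained from $K_4$ by subdividing one edge. If $G$ contains neither $H_1$ nor $H_2$ as a (not necessarily induced) subgraph, then $\chi'_c(G)\le \frac{11}{3}$. Here, for positive integers $p\ge q$, a $(p,q)$-coloring of a graph $H$ is a map $f\colon V(H)\to\{0,1,\dots,p-1\}$ such that $q\le |f(x)-f(y)|\le p-q$ for every edge $xy$ of $H$; the circular chromatic number of $H$ is $\chi_c(H)=\inf\{p/q : H \text{ has a } (p,q)\text{-coloring}\}$; the line graph $L(G)$ has the edges of $G$ as its vertices, two distinct edges being adjacent in $L(G)$ if they have an end vertex in common; and the circular chromatic index of $G$ is $\chi'_c(G)=\chi_c(L(G))$. -/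

import Mathlib

open scoped Graph

/-! ### Circular colourings and the circular chromatic number of a graph -/

namespace SimpleGraph

/-- `f` is a `(p, q)`-colouring of `H`: the colours are `0, …, p - 1`, and the colours `a, b` of the
ends of every edge satisfy `q ≤ |a - b| ≤ p - q`, computed in `ℤ`. -/
def IsCircularColoring {V : Type*} (H : SimpleGraph V) (p q : ℕ) (f : V → Fin p) : Prop :=
  ∀ x y : V, H.Adj x y →
    (q : ℤ) ≤ |((f x : ℕ) : ℤ) - ((f y : ℕ) : ℤ)| ∧
      |((f x : ℕ) : ℤ) - ((f y : ℕ) : ℤ)| ≤ (p : ℤ) - (q : ℤ)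

/-- The ratios `p / q`, for positive integers `p ≥ q` such that `H` has a `(p, q)`-colouring. -/
def circularRatios {V : Type*} (H : SimpleGraph V) : Set ℝ :=
  {r | ∃ p q : ℕ, 0 < q ∧ q ≤ p ∧ (∃ f : V → Fin p, H.IsCircularColoring p q f) ∧
    r = (p : ℝ) / (q : ℝ)}

/-- The circular chromatic number: the infimum of the ratios `p / q` for which there is a
`(p, q)`-colouring. For finite graphs it is the infimum of a nonempty set bounded below, see
`circularRatios_nonempty` and `circularRatios_bddBelow`. -/
noncomputable def circularChromaticNumber {V : Type*} (H : SimpleGraph V) : ℝ :=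
  sInf H.circularRatios

theorem circularRatios_bddBelow {V : Type*} (H : SimpleGraph V) : BddBelow H.circularRatios := by
  refine ⟨0, ?_⟩
  rintro r ⟨p, q, -, -, -, rfl⟩
  positivity

theorem circularRatios_nonempty {V : Type*} [Finite V] (H : SimpleGraph V) :
    H.circularRatios.Nonempty := by
  obtain ⟨n, ⟨e⟩⟩ := Finite.exists_equiv_fin V
  refine ⟨_, n + 1, 1, one_pos, by omega, ⟨fun v => (e v).castSucc, ?_⟩, rfl⟩
  intro x y hxy
  have hne : ((e x : ℕ)) ≠ (e y : ℕ) := fun h => hxy.ne (e.injective (Fin.ext h))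
  have hx := (e x).isLt
  have hy := (e y).isLt
  simp only [Fin.val_castSucc]
  refine ⟨?_, ?_⟩
  · rw [le_abs]; omega
  · rw [abs_le]; constructor <;> omega

end SimpleGraph

/-! ### Graphs with parallel edges -/

namespace Graph

/-- The line graph of `G`: its vertices are the edges of `G`, and two distinct edges are adjacent
if they have an end vertex in common (in particular, parallel edges are adjacent). -/
def lineGraph {α β : Type*} (G : Graph α β) : SimpleGraph E(G) where
  Adj e f := e ≠ f ∧ ∃ v : α, G.Inc (e : β) v ∧ G.Inc (f : β) v
  symm := ⟨fun _ _ h => ⟨h.1.symm, h.2.imp fun _ hv => ⟨hv.2, hv.1⟩⟩⟩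

/-- The circular chromatic index of `G`: the circular chromatic number of its line graph. -/
noncomputable def circularChromaticIndex {α β : Type*} (G : Graph α β) : ℝ :=
  G.lineGraph.circularChromaticNumber

/-- The degree of a vertex of a loopless graph: the number of edges incident with it, parallel
edges being counted separately. -/
noncomputable def degree {α β : Type*} (G : Graph α β) (v : α) : ℕ∞ :=
  {e : β | G.Inc e v}.encard

/-- The maximum degree of a loopless graph. -/
noncomputable def maxDegree {α β : Type*} (G : Graph α β) : ℕ∞ :=
  ⨆ v ∈ V(G), G.degree v

/-- `G` contains `H` as a (not necessarily induced) subgraph, up to isomorphism: the vertices and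
the edges of `H` can be mapped injectively to those of `G` so that incidence is preserved. -/
def ContainsSubgraph {α β α' β' : Type*} (G : Graph α β) (H : Graph α' β') : Prop :=
  ∃ (f : α' → α) (g : β' → β), Set.MapsTo f V(H) V(G) ∧ Set.InjOn f V(H) ∧ Set.InjOn g E(H) ∧
    ∀ e x y, H.IsLink e x y → G.IsLink (g e) (f x) (f y)

/-- The graph with vertex set `α` and edge set `β` in which the edge `e` joins the two elements
of the unordered pair `ends e`. -/
def ofEnds {α β : Type*} (ends : β → Sym2 α) : Graph α β where
  vertexSet := Set.univ
  edgeSet := Set.univ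
  IsLink e x y := ends e = s(x, y)
  isLink_symm := fun _ _ => ⟨fun _ _ h => h.trans Sym2.eq_swap⟩
  eq_or_eq_of_isLink_of_isLink := by
    intro e x y v w h h'
    have h2 := h.symm.trans h'
    rw [Sym2.eq_iff] at h2
    tauto
  edge_mem_iff_exists_isLink := by
    intro e
    refine ⟨fun _ => ?_, fun _ => Set.mem_univ _⟩
    induction h : ends e with
    | h x y => exact ⟨x, y, rfl⟩
  left_mem_of_isLink := fun _ _ _ _ => Set.mem_univ _

/-- `K₂³` (vertices `0, 1`, joined by three parallel edges) with one edge subdivided: two parallel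
edges joining `0` and `1` remain, and the third edge is replaced by the path `0, 2, 1`. -/
def H₁ : Graph (Fin 3) (Fin 4) :=
  ofEnds ![s(0, 1), s(0, 1), s(0, 2), s(2, 1)]

/-- `K₄` (on the vertices `0, 1, 2, 3`) with one edge subdivided: the edge joining `0` and `1` is
replaced by the path `0, 4, 1`. -/
def H₂ : Graph (Fin 5) (Fin 7) :=
  ofEnds ![s(0, 2), s(0, 3), s(1, 2), s(1, 3), s(2, 3), s(0, 4), s(4, 1)]

end Graph

/-!
A graph of maximum degree three is made cubic by half-edges (`paddedInc`), and its edges are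
coloured with the elements of `ℤ/11` such that edges with a common vertex are at circular distance
at least three; this is an `(11, 3)`-colouring of the line graph.

A cut with at most one edge is harmless: the two sides are coloured separately, and one colouring
is rotated (`exists_isColoring`). Without such cuts there is a perfect matching `M`, by Tutte's
theorem for two copies of the graph glued along the half-edges (`exists_matching_univ`), and
contracting triangles without parallel edges shows that `M` can be chosen to meet all of them
(`exists_isMatching_hitsTriangles`). Removing `M` leaves paths and cycles. A triangle left over
would have parallel edges, and the third vertex would give `H₁`; so all odd cycles have length at
least five.

The edges of `M` get colours `x e ∈ {0, 1, 2}`, called labels. The colours `5` and `8` are far from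
all labels and from each other, so they take care of paths and even cycles. An odd cycle can be
coloured as soon as four consecutive vertices of it, in one of the two directions, carry the labels
`0`, `0` and two labels other than `0`, or `2`, `2` and two labels other than `2`: the colours `3,
6, 9` or `10, 7, 4` pass this place, and the other edges alternate between `5` and `8`
(`exists_isCycleColoring`). So everything comes down to labels that produce this pattern (`Good`)
on all odd cycles at once. The combinatorial data are the odd cycles with a variable at every
vertex, each variable occurring at most twice (`CycleFamily`); the absence of `H₂` says that a
cycle of length five does not have two crossing chords.

Such labels exist for every family (`CycleFamily.sol_nonempty`), and the proof treats the
components of the family separately. If every component has a boundary variable, one that occurs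
only once, then the cycles are added one at a time, through a slot whose variable is on the
boundary (`Attach`). The induction hypothesis (`Kit`) says that the boundary variables can avoid
prescribed values, that one of them can be given the value `0` or `2` under a mild condition, and
that two connected ones can be given the value `0` at the first or the value `2` at the second. On
cycles of length at least seven the new boundary variable can always take the value `0`
(`Attach.rootZero_of_seven_le`); on cycles of length five there are two obstructions (`FormA`,
`FormB`), and both allow the values `1` and `2`. A component without boundary contains a cycle with
a chord (`Partner.sol_of_same_cycle`) or a loop of cycles (`Partner.exists_loop`). The variables of
a shortest such configuration, and one more next to it, receive the label `0`, and all others on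
its cycles a nonzero label; this settles its cycles, and the cycles that remain have a boundary.
Two cycles of length five linked three times are an exception and need the label `2` as well
(`Partner.sol_of_three_links`).
-/

/-! ### Good labellings, and what an induction over the cycles records -/

namespace CubicLabel

variable {ε : Type*}

/-- The labels of four consecutive slots `a, b, c, d` of a cycle are constant and extreme (`0` or
`2`) on `a, b` and avoid this extreme value on `c, d`. -/
def Pat (x : ε → Fin 3) (a b c d : ε) : Prop :=
  (x a = 0 ∧ x b = 0 ∧ x c ≠ 0 ∧ x d ≠ 0) ∨ (x a = 2 ∧ x b = 2 ∧ x c ≠ 2 ∧ x d ≠ 2)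

/-- Four consecutive slots of the periodic sequence `f`, read in one of the two directions, have the
pattern `Pat`. -/
def Good (f : ℤ → ε) (x : ε → Fin 3) : Prop :=
  ∃ k, Pat x (f k) (f (k + 1)) (f (k + 2)) (f (k + 3)) ∨
    Pat x (f k) (f (k - 1)) (f (k - 2)) (f (k - 3))

theorem rev_eq_one {v : Fin 3} : v.rev = 1 ↔ v = 1 := by revert v; decide
theorem rev_eq_two {v : Fin 3} : v.rev = 2 ↔ v = 0 := by revert v; decide
theorem rev_eq_zero {v : Fin 3} : v.rev = 0 ↔ v = 2 := by revert v; decide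
theorem rev_ne_iff {v w : Fin 3} : v.rev ≠ w ↔ v ≠ w.rev := by revert v w; decide

theorem Pat.flip {x : ε → Fin 3} {a b c d : ε} (h : Pat x a b c d) :
    Pat (fun e => Fin.rev (x e)) a b c d := by
  rcases h with ⟨h1, h2, h3, h4⟩ | ⟨h1, h2, h3, h4⟩
  · exact Or.inr ⟨rev_eq_two.2 h1, rev_eq_two.2 h2, fun h => h3 (rev_eq_two.1 h),
      fun h => h4 (rev_eq_two.1 h)⟩
  · exact Or.inl ⟨rev_eq_zero.2 h1, rev_eq_zero.2 h2, fun h => h3 (rev_eq_zero.1 h),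
      fun h => h4 (rev_eq_zero.1 h)⟩

theorem Good.flip {f : ℤ → ε} {x : ε → Fin 3} (h : Good f x) :
    Good f (fun e => Fin.rev (x e)) := by
  obtain ⟨k, h | h⟩ := h
  exacts [⟨k, Or.inl h.flip⟩, ⟨k, Or.inr h.flip⟩]

theorem Good.reflect {f : ℤ → ε} {x : ε → Fin 3} (h : Good (fun k => f (-k)) x) : Good f x := by
  obtain ⟨k, h | h⟩ := h
  · refine ⟨-k, Or.inr ?_⟩
    convert h using 2 <;> ring
  · refine ⟨-k, Or.inl ?_⟩
    convert h using 2 <;> ring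

/-- The values forbidden by `ψ` at the members other than `s` of the class of `s` do not have both
kinds `0` and `2` unless the value `1` is among them. -/
def Flagged (B : Set ε) (R : ε → ε → Prop) (ψ : ε → Fin 3) (s : ε) : Prop :=
  (∃ t ∈ B, t ≠ s ∧ R t s ∧ ψ t = 1) ∨ (∀ t ∈ B, t ≠ s → R t s → ψ t ≠ 2) ∨
    (∀ t ∈ B, t ≠ s → R t s → ψ t ≠ 0)

/-- What the induction over the cycles records about the set `S` of labellings that are good on all
cycles of a family: `B` is the set of variables that do not occur twice in the family, `R` is the
connectedness of variables through the family. Solutions can be combined from solutions for the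
classes of `R` (`mix`), all variables of `B` can avoid prescribed values (`one`), and the values at
one or two variables of `B` can be influenced further (`two`, `three`). -/
structure Kit (B : Set ε) (R : ε → ε → Prop) (S : Set (ε → Fin 3)) : Prop where
  equiv : Equivalence R
  mix : ∀ y : ε → ε → Fin 3, (∀ s, y s ∈ S) → (∀ s t, R s t → y s = y t) → (fun e => y e e) ∈ S
  one : ∀ ψ : ε → Fin 3, ∃ x ∈ S, ∀ e ∈ B, x e ≠ ψ e
  two : ∀ (ψ : ε → Fin 3) (s t : ε), s ∈ B → t ∈ B → s ≠ t → R s t →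
    (∃ x ∈ S, x s = 0 ∧ x t ≠ 0 ∧ ∀ e ∈ B, e ≠ s → e ≠ t → x e ≠ ψ e) ∨
      (∃ x ∈ S, x s ≠ 2 ∧ x t = 2 ∧ ∀ e ∈ B, e ≠ s → e ≠ t → x e ≠ ψ e)
  three : ∀ (ψ : ε → Fin 3) (s : ε) (v : Fin 3), s ∈ B → v ≠ 1 → Flagged B R ψ s →
    ∃ x ∈ S, x s = v ∧ ∀ e ∈ B, e ≠ s → x e ≠ ψ e

/-- The complementary labellings `2 - x`. -/
def flipSet (S : Set (ε → Fin 3)) : Set (ε → Fin 3) := {x | (fun e => Fin.rev (x e)) ∈ S}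

theorem mem_flipSet {S : Set (ε → Fin 3)} {x : ε → Fin 3} (h : x ∈ S) :
    (fun e => Fin.rev (x e)) ∈ flipSet S := by
  simpa [flipSet] using h

theorem Flagged.flip {B : Set ε} {R : ε → ε → Prop} {ψ : ε → Fin 3} {s : ε}
    (h : Flagged B R ψ s) : Flagged B R (fun e => Fin.rev (ψ e)) s := by
  rcases h with ⟨t, ht, h1, h2, h3⟩ | h | h
  · exact Or.inl ⟨t, ht, h1, h2, rev_eq_one.2 h3⟩
  · exact Or.inr (Or.inr fun t ht h1 h2 h3 => h t ht h1 h2 (rev_eq_zero.1 h3))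
  · exact Or.inr (Or.inl fun t ht h1 h2 h3 => h t ht h1 h2 (rev_eq_two.1 h3))

theorem Kit.flip {B : Set ε} {R : ε → ε → Prop} {S : Set (ε → Fin 3)} (K : Kit B R S) :
    Kit B R (flipSet S) where
  equiv := K.equiv
  mix y hy hR := by
    exact K.mix (fun s e => Fin.rev (y s e)) hy (fun s t h => by rw [hR s t h])
  one ψ := by
    obtain ⟨x, hx, h⟩ := K.one (fun e => Fin.rev (ψ e))
    exact ⟨_, mem_flipSet hx, fun e he => rev_ne_iff.2 (h e he)⟩
  two ψ s t hs ht hst hR := by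
    rcases K.two (fun e => Fin.rev (ψ e)) t s ht hs hst.symm (K.equiv.symm hR) with
      ⟨x, hx, h1, h2, h3⟩ | ⟨x, hx, h1, h2, h3⟩
    · exact Or.inr ⟨_, mem_flipSet hx, fun h => h2 (rev_eq_two.1 h), rev_eq_two.2 h1,
        fun e he h4 h5 => rev_ne_iff.2 (h3 e he h5 h4)⟩
    · exact Or.inl ⟨_, mem_flipSet hx, rev_eq_zero.2 h2, fun h => h1 (rev_eq_zero.1 h),
        fun e he h4 h5 => rev_ne_iff.2 (h3 e he h5 h4)⟩
  three ψ s v hs hv hF := by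
    obtain ⟨x, hx, h1, h2⟩ := K.three (fun e => Fin.rev (ψ e)) s v.rev hs
      (fun h => hv (rev_eq_one.1 h)) hF.flip
    exact ⟨_, mem_flipSet hx, by simp [h1], fun e he h4 => rev_ne_iff.2 (h2 e he h4)⟩

/-- `e` is alone in its class and its label can be changed freely. -/
def Loose (R : ε → ε → Prop) (S : Set (ε → Fin 3)) (e : ε) : Prop :=
  (∀ t, R t e → t = e) ∧ ∀ x ∈ S, ∀ y : ε → Fin 3, (∀ t, t ≠ e → y t = x t) → y ∈ S

theorem Loose.flip {R : ε → ε → Prop} {S : Set (ε → Fin 3)} {e : ε} (h : Loose R S e) :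
    Loose R (flipSet S) e :=
  ⟨h.1, fun x hx y hy => h.2 _ hx _ fun t ht => by simp [hy t ht]⟩

/-- A cycle `f` of length `n`, with a slot `f 0` that remains a boundary variable, is added to a
family with boundary `B'` and solutions `S`; the boundary of the larger family is `B`. -/
structure Attach (B' : Set ε) (R : ε → ε → Prop) (S : Set (ε → Fin 3)) (B : Set ε) (n : ℤ)
    (f : ℤ → ε) : Prop where
  kit : Kit B' R S
  odd : Odd n
  five_le : 5 ≤ n
  per : ∀ k, f (k + n) = f k
  mem' : ∀ k, f k ∈ B'
  sub : B ⊆ B'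
  chord : ∀ k l, f k = f l → ¬ n ∣ k - l → Loose R S (f k)
  two_slots : ∀ j k l, f j = f k → f k = f l → n ∣ j - k ∨ n ∣ k - l ∨ n ∣ j - l
  root : f 0 ∈ B
  boundary : ∀ k, f k ∈ B → Loose R S (f k) ∧ ∀ l, f l = f k → n ∣ l - k
  cross : n = 5 → ∀ j, ¬ (f (j + 1) = f (j + 3) ∧ f (j + 2) = f (j + 4))

namespace Attach

variable {B' B : Set ε} {R : ε → ε → Prop} {S : Set (ε → Fin 3)} {n : ℤ} {f : ℤ → ε}

theorem flip (H : Attach B' R S B n f) : Attach B' R (flipSet S) B n f where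
  kit := H.kit.flip
  odd := H.odd
  five_le := H.five_le
  per := H.per
  mem' := H.mem'
  sub := H.sub
  chord k l h h' := (H.chord k l h h').flip
  two_slots := H.two_slots
  root := H.root
  boundary k h := ⟨(H.boundary k h).1.flip, (H.boundary k h).2⟩
  cross := H.cross

theorem reflect (H : Attach B' R S B n f) : Attach B' R S B n (fun k => f (-k)) where
  kit := H.kit
  odd := H.odd
  five_le := H.five_le
  per k := by rw [← H.per (-(k + n))]; congr 1; ring
  mem' k := H.mem' _
  sub := H.sub
  chord k l h h' := H.chord _ _ h fun hd => h' (by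
    have := (dvd_neg (α := ℤ)).2 hd
    rwa [show -(-k - -l) = k - l by ring] at this)
  two_slots j k l h h' := by
    have := H.two_slots _ _ _ h h'
    rw [← dvd_neg (b := -j - -k), ← dvd_neg (b := -k - -l), ← dvd_neg (b := -j - -l)] at this
    simpa [sub_eq_add_neg, add_comm] using this
  root := by simpa using H.root
  boundary k h := by
    obtain ⟨h1, h2⟩ := H.boundary _ h
    refine ⟨h1, fun l hl => ?_⟩
    have := (dvd_neg (α := ℤ)).2 (h2 _ hl)
    rwa [show -(-l - -k) = l - k by ring] at this
  cross h5 j h := by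
    subst h5
    refine H.cross rfl (-j - 5) ?_
    have e1 : f (-j - 5 + 1) = f (-(j + 4)) := by congr 1; ring
    have e2 : f (-j - 5 + 3) = f (-(j + 2)) := by congr 1; ring
    have e3 : f (-j - 5 + 2) = f (-(j + 3)) := by congr 1; ring
    have e4 : f (-j - 5 + 4) = f (-(j + 1)) := by congr 1; ring
    rw [e1, e2, e3, e4]
    exact ⟨h.2.symm, h.1.symm⟩

variable (H : Attach B' R S B n f)
include H

theorem eq_root {k : ℤ} (h0 : 0 < k) (hn : k < n) : f k ≠ f 0 := fun h => by
  have := Int.le_of_dvd (by omega) ((H.boundary 0 H.root).2 k h); omega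

theorem root_loose : Loose R S (f 0) := (H.boundary 0 H.root).1

theorem not_rel_root {k : ℤ} (h0 : 0 < k) (hn : k < n) {e : ε} (h : R e (f k)) : e ≠ f 0 := by
  rintro rfl
  exact H.eq_root h0 hn (H.root_loose.1 _ (H.kit.equiv.symm h))

omit H in
theorem not_dvd {k l : ℤ} (h0 : 0 < k) (hn : k < n) (h0' : 0 < l) (hn' : l < n) (h : k ≠ l) :
    ¬ n ∣ k - l := by
  rintro ⟨c, hc⟩
  have : c = 0 := by
    by_contra hc0
    rcases lt_or_gt_of_ne hc0 with h1 | h1 <;> nlinarith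
  subst this; omega

/-- A slot whose variable is not loose determines its index. -/
theorem slot_inj {k l : ℤ} (h0 : 0 < k) (hn : k < n) (h0' : 0 < l) (hn' : l < n)
    (hL : ¬ Loose R S (f k)) (h : f k = f l) : k = l := by
  by_contra hkl
  exact hL (H.chord k l h (not_dvd h0 hn h0' hn' hkl))

omit H in
theorem not_loose_of_rel {s t : ε} (hE : Equivalence R) (h : R s t) (hst : s ≠ t) (u : ε)
    (hu : R u t) : ¬ Loose R S u := fun hL =>
  hst ((hL.1 s (hE.trans h (hE.symm hu))).trans (hL.1 t (hE.symm hu)).symm)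

/-- The demands `A` on the slots and `O` on the boundary variables can be met on the class of the
slot `k`. -/
def OK (R : ε → ε → Prop) (S : Set (ε → Fin 3)) (B : Set ε) (n : ℤ) (f : ℤ → ε)
    (O : ε → Set (Fin 3)) (A : ℤ → Set (Fin 3)) (k : ℤ) : Prop :=
  ∃ x ∈ S, (∀ e ∈ B, R e (f k) → x e ∈ O e) ∧
    ∀ l, 0 < l → l < n → R (f l) (f k) → x (f l) ∈ A l

omit H in
/-- A demand that excludes at most one value. -/
def Weak (a : Set (Fin 3)) : Prop := ∃ ρ, ∀ v, v ≠ ρ → v ∈ a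

omit H in
theorem Weak.exists_mem {a b : Set (Fin 3)} (ha : Weak a) (hb : Weak b) : ∃ v, v ∈ a ∧ v ∈ b := by
  obtain ⟨ρ, hρ⟩ := ha
  obtain ⟨σ, hσ⟩ := hb
  have : ∀ ρ σ : Fin 3, ∃ v, v ≠ ρ ∧ v ≠ σ := by decide
  obtain ⟨v, h1, h2⟩ := this ρ σ
  exact ⟨v, hρ v h1, hσ v h2⟩

/-- Demands can be met if they can be met class by class; classes with weak demands only are no
obstacle. -/
theorem assemble {O : ε → Set (Fin 3)} {A : ℤ → Set (Fin 3)} (T : Set ℤ) (v : Fin 3)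
    (hT : ∀ k ∈ T, 0 < k ∧ k < n ∧ OK R S B n f O A k)
    (hA : ∀ k, 0 < k → k < n → k ∉ T → Weak (A k))
    (hO : ∀ e ∈ B, e ≠ f 0 → (∃ k ∈ T, R (f k) e) ∨ Weak (O e)) :
    ∃ x ∈ S, x (f 0) = v ∧ (∀ e ∈ B, e ≠ f 0 → x e ∈ O e) ∧
      ∀ k, 0 < k → k < n → x (f k) ∈ A k := by
  classical
  have hE := H.kit.equiv
  let Q : ε → Fin 3 → Prop := fun e u => (e ∈ B → e ≠ f 0 → u ∈ O e) ∧
    (∀ k, 0 < k → k < n → f k = e → u ∈ A k) ∧ (e = f 0 → u = v)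
  obtain ⟨x0, hx0, -⟩ := H.kit.one fun _ => 0
  have setval : ∀ s u, Loose R S s → ∃ x ∈ S, x s = u := fun s u hs =>
    ⟨Function.update x0 s u, hs.2 x0 hx0 _ (fun t ht => by simp [ht]), by simp⟩
  have key : ∀ s, ∃ x ∈ S, ∀ e, R e s → Q e (x e) := by
    intro s
    by_cases hroot : R s (f 0)
    · have hs := H.root_loose.1 s hroot
      subst hs
      obtain ⟨x, hx, hxv⟩ := setval _ v H.root_loose
      refine ⟨x, hx, fun e he => ?_⟩
      have := H.root_loose.1 e he
      subst this
      exact ⟨fun _ h => absurd rfl h, fun k h0 hn h => absurd h (H.eq_root h0 hn), fun _ => hxv⟩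
    by_cases hTs : ∃ k ∈ T, R (f k) s
    · obtain ⟨k, hk, hks⟩ := hTs
      obtain ⟨h0, hn, x, hx, hx1, hx2⟩ := hT k hk
      refine ⟨x, hx, fun e he => ?_⟩
      have hek : R e (f k) := hE.trans he (hE.symm hks)
      refine ⟨fun heB _ => hx1 e heB hek, ?_, fun h => ?_⟩
      · rintro l hl0 hln rfl
        exact hx2 l hl0 hln hek
      · subst h
        exact absurd (hE.symm he) hroot
    have hne : ∀ e, R e s → e ≠ f 0 := by
      rintro e he rfl
      exact hroot (hE.symm he)
    have hTk : ∀ k, R (f k) s → k ∉ T := fun k h hk => hTs ⟨k, hk, h⟩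
    have hOw : ∀ e ∈ B, R e s → Weak (O e) := fun e he hes =>
      (hO e he (hne e hes)).resolve_left fun ⟨k, hk, hke⟩ => hTs ⟨k, hk, hE.trans hke hes⟩
    by_cases hL : Loose R S s
    · -- a loose variable meets at most two weak demands
      have hu : ∃ u, Q s u := by
        by_cases hsB : s ∈ B
        · by_cases hsl : ∃ k, 0 < k ∧ k < n ∧ f k = s
          · obtain ⟨k, h0, hn, rfl⟩ := hsl
            obtain ⟨u, hu1, hu2⟩ := (hOw _ hsB (hE.refl _)).exists_mem
              (hA k h0 hn (hTk k (hE.refl _)))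
            refine ⟨u, fun _ _ => hu1, fun l hl0 hln hl => ?_,
              fun h => absurd h (hne _ (hE.refl _))⟩
            have : l = k := by
              by_contra hlk
              exact not_dvd hl0 hln h0 hn hlk ((H.boundary k hsB).2 l hl)
            rwa [this]
          · obtain ⟨u, hu, -⟩ := (hOw _ hsB (hE.refl _)).exists_mem (hOw _ hsB (hE.refl _))
            exact ⟨u, fun _ _ => hu, fun k h0 hn h => absurd ⟨k, h0, hn, h⟩ hsl,
              fun h => absurd h (hne _ (hE.refl _))⟩
        · by_cases hsl : ∃ k, 0 < k ∧ k < n ∧ f k = s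
          · obtain ⟨k, h0, hn, rfl⟩ := hsl
            by_cases hsl2 : ∃ l, 0 < l ∧ l < n ∧ f l = f k ∧ l ≠ k
            · obtain ⟨l, hl0, hln, hlk, hne2⟩ := hsl2
              obtain ⟨u, hu1, hu2⟩ := (hA k h0 hn (hTk k (hE.refl _))).exists_mem
                (hA l hl0 hln (hTk l (by rw [hlk]; exact hE.refl _)))
              refine ⟨u, fun h => absurd h hsB, fun j hj0 hjn hj => ?_,
                fun h => absurd h (hne _ (hE.refl _))⟩
              rcases H.two_slots j k l hj hlk.symm with h | h | h
              · have : j = k := by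
                  by_contra h'; exact not_dvd hj0 hjn h0 hn h' h
                rwa [this]
              · exact absurd h (not_dvd h0 hn hl0 hln (Ne.symm hne2))
              · have : j = l := by
                  by_contra h'; exact not_dvd hj0 hjn hl0 hln h' h
                rwa [this]
            · obtain ⟨u, hu1, -⟩ := (hA k h0 hn (hTk k (hE.refl _))).exists_mem
                (hA k h0 hn (hTk k (hE.refl _)))
              refine ⟨u, fun h => absurd h hsB, fun j hj0 hjn hj => ?_,
                fun h => absurd h (hne _ (hE.refl _))⟩
              have : j = k := by
                by_contra h'; exact hsl2 ⟨j, hj0, hjn, hj, h'⟩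
              rwa [this]
          · exact ⟨0, fun h => absurd h hsB, fun k h0 hn h => absurd ⟨k, h0, hn, h⟩ hsl,
              fun h => absurd h (hne _ (hE.refl _))⟩
      obtain ⟨u, hu⟩ := hu
      obtain ⟨x, hx, hxu⟩ := setval s u hL
      refine ⟨x, hx, fun e he => ?_⟩
      have := hL.1 e he
      subst this
      rwa [hxu]
    · -- in a class that is not loose no variable meets two demands
      have hLe : ∀ e, R e s → ¬ Loose R S e := by
        intro e he hLe
        exact hL (by rwa [hLe.1 s (hE.symm he)])
      have : ∀ e, ∃ ρ, e ∈ B' → R e s → ∀ u, u ≠ ρ → Q e u := by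
        intro e
        by_cases hes : R e s
        · by_cases heB : e ∈ B
          · obtain ⟨ρ, hρ⟩ := hOw e heB hes
            refine ⟨ρ, fun _ _ u hu => ⟨fun _ _ => hρ u hu, ?_, fun h => absurd h (hne e hes)⟩⟩
            rintro k h0 hn rfl
            exact absurd (H.boundary k heB).1 (hLe _ hes)
          · by_cases hsl : ∃ k, 0 < k ∧ k < n ∧ f k = e
            · obtain ⟨k, h0, hn, rfl⟩ := hsl
              obtain ⟨ρ, hρ⟩ := hA k h0 hn (hTk k hes)
              refine ⟨ρ, fun _ _ u hu => ⟨fun h => absurd h heB, fun l hl0 hln hl => ?_,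
                fun h => absurd h (hne _ hes)⟩⟩
              rw [H.slot_inj hl0 hln h0 hn (by rw [hl]; exact hLe _ hes) hl]
              exact hρ u hu
            · exact ⟨0, fun _ _ u _ => ⟨fun h => absurd h heB,
                fun k h0 hn h => absurd ⟨k, h0, hn, h⟩ hsl, fun h => absurd h (hne _ hes)⟩⟩
        · exact ⟨0, fun _ h => absurd h hes⟩
      choose ψ hψ using this
      obtain ⟨x, hx, hx1⟩ := H.kit.one ψ
      refine ⟨x, hx, fun e he => ?_⟩
      by_cases heB : e ∈ B'
      · exact hψ e heB he _ (hx1 e heB)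
      · exact ⟨fun h => absurd (H.sub h) heB, fun k _ _ h => absurd (h ▸ H.mem' k) heB,
          fun h => absurd h (hne e he)⟩
  choose y hy hyQ using key
  let st : Setoid ε := ⟨R, hE⟩
  let rep : ε → ε := fun e => (Quotient.mk st e).out
  have hrep : ∀ e, R (rep e) e := fun e => Quotient.exact (Quotient.out_eq (Quotient.mk st e))
  have hx := H.kit.mix (fun s => y (rep s)) (fun s => hy _) (fun s t h => by
    have : Quotient.mk st s = Quotient.mk st t := Quotient.sound h
    simp only [rep, this])
  have hq : ∀ e, Q e (y (rep e) e) := fun e => hyQ (rep e) e (hE.symm (hrep e))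
  exact ⟨_, hx, (hq _).2.2 rfl, fun e he hne => (hq e).1 he hne,
    fun k h0 hn => (hq _).2.1 k h0 hn rfl⟩

end Attach

end CubicLabel

/-! ### Values that a slot of a cycle can take -/

namespace CubicLabel
namespace Attach

variable {ε : Type*} {B' B : Set ε} {R : ε → ε → Prop} {S : Set (ε → Fin 3)} {n : ℤ} {f : ℤ → ε}
  {O : ε → Set (Fin 3)} {A : ℤ → Set (Fin 3)} {ψ : ε → Fin 3} {k l : ℤ} {v : Fin 3}

theorem weak_compl (ρ : Fin 3) : Weak ({ρ}ᶜ : Set (Fin 3)) := ⟨ρ, fun _ h => h⟩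

/-- The demand to avoid the forbidden values `ψ`. -/
def forb (ψ : ε → Fin 3) : ε → Set (Fin 3) := fun e => {ψ e}ᶜ

/-- No other slot of the cycle is in the class of the slot `k`. -/
def Single (R : ε → ε → Prop) (n : ℤ) (f : ℤ → ε) (k : ℤ) : Prop :=
  ∀ l, 0 < l → l < n → R (f l) (f k) → l = k

/-- The slot `k` can take the value `v` while the demands `O` on its class are met. -/
def Cap (R : ε → ε → Prop) (S : Set (ε → Fin 3)) (B : Set ε) (f : ℤ → ε) (O : ε → Set (Fin 3))
    (k : ℤ) (v : Fin 3) : Prop :=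
  ∃ x ∈ S, (∀ e ∈ B, R e (f k) → x e ∈ O e) ∧ x (f k) = v

theorem OK.of_cap (hs : Single R n f k) (hc : Cap R S B f O k v) (hv : v ∈ A k) :
    OK R S B n f O A k := by
  obtain ⟨x, hx, h1, h2⟩ := hc
  refine ⟨x, hx, h1, fun l h0 hn hl => ?_⟩
  rw [hs l h0 hn hl, h2]
  exact hv

theorem Cap.congr {O' : ε → Set (Fin 3)} (h : Cap R S B f O k v)
    (hO : ∀ e ∈ B, R e (f k) → O e = O' e) : Cap R S B f O' k v := by
  obtain ⟨x, hx, h1, h2⟩ := h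
  exact ⟨x, hx, fun e he hR => hO e he hR ▸ h1 e he hR, h2⟩

variable (H : Attach B' R S B n f)
include H

theorem OK.trans (h : OK R S B n f O A k) (hkl : R (f k) (f l)) : OK R S B n f O A l := by
  obtain ⟨x, hx, h1, h2⟩ := h
  have hE := H.kit.equiv
  exact ⟨x, hx, fun e he hR => h1 e he (hE.trans hR (hE.symm hkl)),
    fun j h0 hn hj => h2 j h0 hn (hE.trans hj (hE.symm hkl))⟩

theorem exists_update (s : ε) (u : Fin 3) (hs : Loose R S s) : ∃ x ∈ S, x s = u := by
  classical
  obtain ⟨x0, hx0, -⟩ := H.kit.one fun _ => 0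
  exact ⟨Function.update x0 s u, hs.2 x0 hx0 _ (fun t ht => by simp [ht]), by simp⟩

/-- In a class that is not loose, weak demands on the slots and the boundary variables are given by
one forbidden value for each variable. -/
theorem exists_forbid (hL : ¬ Loose R S (f k)) (A : ℤ → Set (Fin 3)) (O : ε → Set (Fin 3)) :
    ∃ ψ' : ε → Fin 3, (∀ l, 0 < l → l < n → R (f l) (f k) → Weak (A l) →
        ∀ v, v ≠ ψ' (f l) → v ∈ A l) ∧
      (∀ e ∈ B, R e (f k) → Weak (O e) → ∀ v, v ≠ ψ' e → v ∈ O e) := by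
  have hE := H.kit.equiv
  have hLe : ∀ e, R e (f k) → ¬ Loose R S e := fun e he hLe => hL (by
    rwa [hLe.1 _ (hE.symm he)])
  have : ∀ e, ∃ ρ : Fin 3, (∀ l, 0 < l → l < n → f l = e → R (f l) (f k) → Weak (A l) →
        ∀ v, v ≠ ρ → v ∈ A l) ∧ (e ∈ B → R e (f k) → Weak (O e) → ∀ v, v ≠ ρ → v ∈ O e) := by
    intro e
    by_cases hek : R e (f k)
    · by_cases hsl : ∃ l, 0 < l ∧ l < n ∧ f l = e
      · obtain ⟨l, h0, hn, rfl⟩ := hsl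
        have hB : f l ∉ B := fun h => hLe _ hek (H.boundary l h).1
        by_cases hw : Weak (A l)
        · obtain ⟨ρ, hρ⟩ := hw
          refine ⟨ρ, fun j hj0 hjn hj hjk _ => ?_, fun h => absurd h hB⟩
          rwa [H.slot_inj hj0 hjn h0 hn (hLe _ hjk) hj]
        · refine ⟨0, fun j hj0 hjn hj hjk hw' => ?_, fun h => absurd h hB⟩
          rw [H.slot_inj hj0 hjn h0 hn (hLe _ hjk) hj] at hw'
          exact absurd hw' hw
      · by_cases hw : Weak (O e)
        · obtain ⟨ρ, hρ⟩ := hw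
          exact ⟨ρ, fun j hj0 hjn hj => absurd ⟨j, hj0, hjn, hj⟩ hsl, fun _ _ _ => hρ⟩
        · exact ⟨0, fun j hj0 hjn hj => absurd ⟨j, hj0, hjn, hj⟩ hsl, fun _ _ h => absurd h hw⟩
    · exact ⟨0, fun j _ _ hj hjk => absurd (hj ▸ hjk) hek, fun _ h => absurd h hek⟩
  choose ψ' h1 h2 using this
  exact ⟨ψ', fun l h0 hn hl => h1 (f l) l h0 hn rfl hl, fun e he hek => h2 e he hek⟩

/-- A slot of a class that is not loose takes any extreme value if another variable of the class
(a slot or a boundary variable) tolerates both extreme values. -/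
theorem OK.of_flag (h0 : 0 < k) (hn : k < n) (hL : ¬ Loose R S (f k)) (hv1 : v ≠ 1) (hv : v ∈ A k)
    (hF : (∃ l, 0 < l ∧ l < n ∧ l ≠ k ∧ R (f l) (f k) ∧ ∀ u, u ≠ 1 → u ∈ A l) ∨
      ∃ t ∈ B, R t (f k) ∧ ∀ u, u ≠ 1 → u ∈ O t)
    (hA : ∀ l, 0 < l → l < n → l ≠ k → R (f l) (f k) → Weak (A l))
    (hO : ∀ e ∈ B, R e (f k) → Weak (O e)) : OK R S B n f O A k := by
  classical
  have hE := H.kit.equiv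
  have hLe : ∀ e, R e (f k) → ¬ Loose R S e := fun e he hLe => hL (by
    rwa [hLe.1 _ (hE.symm he)])
  obtain ⟨ψ', h1, h2⟩ := H.exists_forbid hL A O
  have hkB : f k ∉ B := fun h => hL (H.boundary k h).1
  -- the forbidden value of the tolerant variable is changed to `1`
  obtain ⟨t, htB', htk, htR, ψ₂, h3, h4, h5⟩ : ∃ t ∈ B', t ≠ f k ∧ R t (f k) ∧
      ∃ ψ₂ : ε → Fin 3, ψ₂ t = 1 ∧
      (∀ l, 0 < l → l < n → l ≠ k → R (f l) (f k) → ∀ v, v ≠ ψ₂ (f l) → v ∈ A l) ∧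
      (∀ e ∈ B, R e (f k) → ∀ v, v ≠ ψ₂ e → v ∈ O e) := by
    rcases hF with ⟨l, hl0, hln, hlk, hR, hl⟩ | ⟨t, htB, hR, ht⟩
    · refine ⟨f l, H.mem' l, fun h => hlk (H.slot_inj hl0 hln h0 hn (hLe _ hR) h), hR,
        Function.update ψ' (f l) 1, by simp, fun j hj0 hjn hjk hjR u hu => ?_,
        fun e he heR u hu => ?_⟩
      · by_cases hjl : j = l
        · subst hjl; simp at hu; exact hl u hu
        · have : f j ≠ f l := fun h => hjl (H.slot_inj hj0 hjn hl0 hln (hLe _ hjR) h)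
          rw [Function.update_of_ne this] at hu
          exact h1 j hj0 hjn hjR (hA j hj0 hjn hjk hjR) u hu
      · have : e ≠ f l := by
          rintro rfl; exact hLe _ heR (H.boundary l he).1
        rw [Function.update_of_ne this] at hu
        exact h2 e he heR (hO e he heR) u hu
    · have htf : ∀ j, R (f j) (f k) → f j ≠ t := by
        rintro j hj rfl; exact hLe _ hj (H.boundary j htB).1
      refine ⟨t, H.sub htB, (htf k (hE.refl _)).symm, hR,
        Function.update ψ' t 1, by simp, fun j hj0 hjn hjk hjR u hu => ?_,
        fun e he heR u hu => ?_⟩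
      · rw [Function.update_of_ne (htf j hjR)] at hu
        exact h1 j hj0 hjn hjR (hA j hj0 hjn hjk hjR) u hu
      · by_cases het : e = t
        · subst het; simp at hu; exact ht u hu
        · rw [Function.update_of_ne het] at hu
          exact h2 e he heR (hO e he heR) u hu
  obtain ⟨x, hx, hxk, hx2⟩ := H.kit.three ψ₂ (f k) v (H.mem' k) hv1
    (Or.inl ⟨t, htB', htk, htR, h3⟩)
  refine ⟨x, hx, fun e he heR => h5 e he heR _ (hx2 e (H.sub he) fun h => hkB (h ▸ he)),
    fun l hl0 hln hlR => ?_⟩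
  by_cases hlk : l = k
  · rw [hlk, hxk]; exact hv
  · exact h4 l hl0 hln hlk hlR _ (hx2 _ (H.mem' l) fun h =>
      hlk (H.slot_inj hl0 hln h0 hn (hLe _ hlR) h))

/-- A slot takes any extreme value if another slot of its class tolerates both extreme values. -/
theorem OK.of_partner (h0 : 0 < k) (hn : k < n) (l : ℤ) (hl0 : 0 < l) (hln : l < n) (hlk : l ≠ k)
    (hR : R (f l) (f k)) (hv1 : v ≠ 1) (hv : v ∈ A k) (hl : ∀ u, u ≠ 1 → u ∈ A l)
    (hA : ∀ l, 0 < l → l < n → l ≠ k → R (f l) (f k) → Weak (A l))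
    (hO : ∀ e ∈ B, R e (f k) → Weak (O e)) : OK R S B n f O A k := by
  by_cases hL : Loose R S (f k)
  · have hlk' := hL.1 _ hR
    obtain ⟨x, hx, hxk⟩ := H.exists_update (f k) v hL
    refine ⟨x, hx, fun e he heR => ?_, fun j hj0 hjn hjR => ?_⟩
    · have := hL.1 e heR
      subst this
      exact absurd ((H.boundary k he).2 l hlk') (not_dvd hl0 hln h0 hn hlk)
    · have hjk := hL.1 _ hjR
      rw [hjk, hxk]
      rcases H.two_slots j k l hjk hlk'.symm with h | h | h
      · by_cases hjk2 : j = k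
        · rwa [hjk2]
        · exact absurd h (not_dvd hj0 hjn h0 hn hjk2)
      · exact absurd h (not_dvd h0 hn hl0 hln hlk.symm)
      · by_cases hjk2 : j = l
        · rw [hjk2]; exact hl v hv1
        · exact absurd h (not_dvd hj0 hjn hl0 hln hjk2)
  · exact OK.of_flag H h0 hn hL hv1 hv (Or.inl ⟨l, hl0, hln, hlk, hR, hl⟩) hA hO

/-- A slot that is single in its class takes an extreme value if a boundary variable of its class
tolerates both extreme values, or if none forbids this value. -/
theorem cap_of_flag (hs : Single R n f k) (h0 : 0 < k) (hn : k < n) (hv1 : v ≠ 1)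
    (hF : (∃ t ∈ B, R t (f k) ∧ ψ t = 1) ∨ ((∀ t ∈ B, R t (f k) → ψ t ≠ 2) ∧ v = 2) ∨
      ((∀ t ∈ B, R t (f k) → ψ t ≠ 0) ∧ v = 0)) : Cap R S B f (forb ψ) k v := by
  classical
  have hE := H.kit.equiv
  by_cases hL : Loose R S (f k)
  · obtain ⟨x, hx, hxk⟩ := H.exists_update (f k) v hL
    refine ⟨x, hx, fun e he heR => ?_, hxk⟩
    have := hL.1 e heR
    subst this
    show x (f k) ≠ ψ (f k)
    rw [hxk]
    rcases hF with ⟨t, htB, htR, ht⟩ | ⟨h, rfl⟩ | ⟨h, rfl⟩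
    · rw [← hL.1 t htR, ht]; exact hv1
    · exact (h _ he heR).symm
    · exact (h _ he heR).symm
  · have hkB : f k ∉ B := fun h => hL (H.boundary k h).1
    rcases hF with ⟨t, htB, htR, ht⟩ | hF
    · have : OK R S B n f (forb ψ) (fun _ => {v}) k := by
        refine OK.of_flag H h0 hn hL hv1 rfl (Or.inr ⟨t, htB, htR, fun u hu => ?_⟩)
          (fun l hl0 hln hlk hlR => absurd (hs l hl0 hln hlR) hlk) (fun e _ _ => weak_compl _)
        show u ≠ ψ t
        rwa [ht]
      obtain ⟨x, hx, h1, h2⟩ := this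
      exact ⟨x, hx, h1, h2 k h0 hn (hE.refl _)⟩
    · -- outside `B` the forbidden value may be chosen
      let ψ₂ : ε → Fin 3 := fun e => if e ∈ B then ψ e else 1
      obtain ⟨x, hx, hxk, hx2⟩ := H.kit.three ψ₂ (f k) v (H.mem' k) hv1 (by
        rcases hF with ⟨h, rfl⟩ | ⟨h, rfl⟩
        · refine Or.inr (Or.inl fun t ht htk htR => ?_)
          simp only [ψ₂]
          split_ifs with htB
          exacts [h t htB htR, by decide]
        · refine Or.inr (Or.inr fun t ht htk htR => ?_)
          simp only [ψ₂]
          split_ifs with htB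
          exacts [h t htB htR, by decide])
      refine ⟨x, hx, fun e he heR => ?_, hxk⟩
      have := hx2 e (H.sub he) (fun h => hkB (h ▸ he))
      simp only [ψ₂, he, if_true] at this
      exact this

/-- A slot that is single in its class can take one of the two extreme values. -/
theorem cap_or (k : ℤ) (hO : ∀ e ∈ B, R e (f k) → Weak (O e)) :
    Cap R S B f O k 0 ∨ Cap R S B f O k 2 := by
  classical
  have hE := H.kit.equiv
  have h3 : ∀ u : Fin 3, u ≠ 1 → u = 0 ∨ u = 2 := by decide
  by_cases hL : Loose R S (f k)
  · by_cases hB : f k ∈ B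
    · obtain ⟨u, hu1, hu2⟩ := (hO _ hB (hE.refl _)).exists_mem (weak_compl 1)
      obtain ⟨x, hx, hxk⟩ := H.exists_update (f k) u hL
      have : ∀ e ∈ B, R e (f k) → x e ∈ O e := fun e _ heR => by
        have := hL.1 e heR
        subst this
        rwa [hxk]
      rcases h3 u hu2 with rfl | rfl
      exacts [Or.inl ⟨x, hx, this, hxk⟩, Or.inr ⟨x, hx, this, hxk⟩]
    · obtain ⟨x, hx, hxk⟩ := H.exists_update (f k) 0 hL
      exact Or.inl ⟨x, hx, fun e he heR => absurd (hL.1 e heR ▸ he) hB, hxk⟩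
  · have hkB : f k ∉ B := fun h => hL (H.boundary k h).1
    obtain ⟨ψ', -, h2⟩ := H.exists_forbid hL (fun _ => Set.univ) O
    obtain ⟨x, hx, hx2⟩ := H.kit.one (Function.update ψ' (f k) 1)
    have hxO : ∀ e ∈ B, R e (f k) → x e ∈ O e := fun e he heR => by
      have hne : e ≠ f k := fun h => hkB (h ▸ he)
      have := hx2 e (H.sub he)
      rw [Function.update_of_ne hne] at this
      exact h2 e he heR (hO e he heR) _ this
    have := hx2 (f k) (H.mem' k)
    rw [Function.update_self] at this
    rcases h3 _ this with h | h
    exacts [Or.inl ⟨x, hx, hxO, h⟩, Or.inr ⟨x, hx, hxO, h⟩]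

/-- A boundary variable takes the value `2` while the single slot in its class takes an extreme
value. -/
theorem cap_of_boundary {e : ε} (he : e ∈ B) (heR : R e (f k)) :
    ∃ u : Fin 3, u ≠ 1 ∧ ∃ x ∈ S, x e = 2 ∧ (∀ t ∈ B, t ≠ e → R t (f k) → x t ≠ ψ t) ∧
      x (f k) = u := by
  classical
  have hE := H.kit.equiv
  by_cases hke : f k = e
  · subst hke
    have hL := (H.boundary k he).1
    obtain ⟨x, hx, hxk⟩ := H.exists_update (f k) 2 hL
    exact ⟨2, by decide, x, hx, hxk, fun t ht hne hR => absurd (hL.1 t hR) hne, hxk⟩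
  · have hL : ¬ Loose R S (f k) := fun hL => hke (hL.1 e heR).symm
    have hkB : f k ∉ B := fun h => hL (H.boundary k h).1
    obtain ⟨x, hx, hxe, hx2⟩ := H.kit.three (Function.update ψ (f k) 1) e 2 (H.sub he) (by decide)
      (Or.inl ⟨f k, H.mem' k, hke, hE.symm heR, by simp⟩)
    refine ⟨x (f k), by simpa using hx2 (f k) (H.mem' k) hke, x, hx, hxe,
      fun t ht hne hR => ?_, rfl⟩
    have htk : t ≠ f k := fun h => hkB (h ▸ ht)
    simpa [htk] using hx2 t (H.sub ht) hne

omit H in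
theorem cyc_eq {H : Attach B' R S B n f} {k l : ℤ} (h : n ∣ k - l) : f k = f l := by
  obtain ⟨c, hc⟩ := h
  have : Function.Periodic f n := H.per
  have h2 := this.int_mul c l
  rw [Int.cast_id, show l + c * n = k by linarith] at h2
  exact h2

omit H in
theorem good_of {x : ε → Fin 3} (H : Attach B' R S B n f) {a b c d : ℤ}
    (h : (n ∣ b - (a + 1) ∧ n ∣ c - (a + 2) ∧ n ∣ d - (a + 3)) ∨
      (n ∣ b - (a - 1) ∧ n ∣ c - (a - 2) ∧ n ∣ d - (a - 3)))
    (hp : Pat x (f a) (f b) (f c) (f d)) : Good f x := by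
  rcases h with ⟨h1, h2, h3⟩ | ⟨h1, h2, h3⟩
  · rw [cyc_eq (H := H) h1, cyc_eq (H := H) h2, cyc_eq (H := H) h3] at hp
    exact ⟨a, Or.inl hp⟩
  · rw [cyc_eq (H := H) h1, cyc_eq (H := H) h2, cyc_eq (H := H) h3] at hp
    exact ⟨a, Or.inr hp⟩

end Attach
end CubicLabel

/-! ### Cycles of length five with the value zero at the root -/

namespace CubicLabel
namespace Attach

variable {ε : Type*} {B' B : Set ε} {R : ε → ε → Prop} {S : Set (ε → Fin 3)} {n : ℤ} {f : ℤ → ε}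
  {O : ε → Set (Fin 3)} {ψ : ε → Fin 3} {k l : ℤ} {v : Fin 3} {a₁ a₂ a₃ a₄ : Set (Fin 3)}

/-- The labelling problem with the value `0` at the root is solvable. -/
def RootZero (S : Set (ε → Fin 3)) (B : Set ε) (f : ℤ → ε) (ψ : ε → Fin 3) : Prop :=
  ∃ x ∈ S, Good f x ∧ x (f 0) = 0 ∧ ∀ e ∈ B, e ≠ f 0 → x e ≠ ψ e

/-- Four demands on the slots `1, 2, 3, 4` of a cycle of length five. -/
def demand (a₁ a₂ a₃ a₄ : Set (Fin 3)) (k : ℤ) : Set (Fin 3) :=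
  if k = 1 then a₁ else if k = 2 then a₂ else if k = 3 then a₃ else a₄

theorem demand_one : demand a₁ a₂ a₃ a₄ 1 = a₁ := by simp [demand]
theorem demand_two : demand a₁ a₂ a₃ a₄ 2 = a₂ := by simp [demand]
theorem demand_three : demand a₁ a₂ a₃ a₄ 3 = a₃ := by simp [demand]
theorem demand_four : demand a₁ a₂ a₃ a₄ 4 = a₄ := by simp [demand]

theorem weak_demand (k : ℤ) (h0 : 0 < k) (h5 : k < 5) (h1 : k = 1 → Weak a₁) (h2 : k = 2 → Weak a₂)
    (h3 : k = 3 → Weak a₃) (h4 : k = 4 → Weak a₄) : Weak (demand a₁ a₂ a₃ a₄ k) := by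
  interval_cases k
  · rw [demand_one]; exact h1 rfl
  · rw [demand_two]; exact h2 rfl
  · rw [demand_three]; exact h3 rfl
  · rw [demand_four]; exact h4 rfl

theorem assemble_five (H : Attach B' R S B 5 f) (T : Set ℤ) (v : Fin 3) (a₁ a₂ a₃ a₄ : Set (Fin 3))
    (hT : ∀ k ∈ T, 0 < k ∧ k < 5 ∧ OK R S B 5 f O (demand a₁ a₂ a₃ a₄) k)
    (h1 : 1 ∈ T ∨ Weak a₁) (h2 : 2 ∈ T ∨ Weak a₂) (h3 : 3 ∈ T ∨ Weak a₃) (h4 : 4 ∈ T ∨ Weak a₄)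
    (hO : ∀ e ∈ B, e ≠ f 0 → (∃ k ∈ T, R (f k) e) ∨ Weak (O e)) :
    ∃ x ∈ S, x (f 0) = v ∧ (∀ e ∈ B, e ≠ f 0 → x e ∈ O e) ∧
      x (f 1) ∈ a₁ ∧ x (f 2) ∈ a₂ ∧ x (f 3) ∈ a₃ ∧ x (f 4) ∈ a₄ := by
  obtain ⟨x, hx, h0, hB, hs⟩ := H.assemble T v hT (fun k hk0 hk5 hkT => by
    refine weak_demand k hk0 hk5 ?_ ?_ ?_ ?_ <;> rintro rfl
    exacts [h1.resolve_left hkT, h2.resolve_left hkT, h3.resolve_left hkT, h4.resolve_left hkT]) hO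
  have e1 := hs 1 (by norm_num) (by norm_num)
  have e2 := hs 2 (by norm_num) (by norm_num)
  have e3 := hs 3 (by norm_num) (by norm_num)
  have e4 := hs 4 (by norm_num) (by norm_num)
  rw [demand_one] at e1
  rw [demand_two] at e2
  rw [demand_three] at e3
  rw [demand_four] at e4
  exact ⟨x, hx, h0, hB, e1, e2, e3, e4⟩

theorem weak_forb (e : ε) : Weak (forb ψ e) := weak_compl _

/-- The demands of a slot `k` of a five-cycle whose partner `l` in its class tolerates both extreme
values. -/
theorem ok_five (H : Attach B' R S B 5 f) (k l : ℤ) (h0 : 0 < k ∧ k < 5) (hl : 0 < l ∧ l < 5)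
    (hlk : l ≠ k) (hR : R (f l) (f k)) (hv : ∃ v, v ≠ 1 ∧ v ∈ demand a₁ a₂ a₃ a₄ k)
    (hF : demand a₁ a₂ a₃ a₄ l = {1}ᶜ)
    (h1 : 1 ≠ k → R (f 1) (f k) → Weak a₁) (h2 : 2 ≠ k → R (f 2) (f k) → Weak a₂)
    (h3 : 3 ≠ k → R (f 3) (f k) → Weak a₃) (h4 : 4 ≠ k → R (f 4) (f k) → Weak a₄) :
    OK R S B 5 f (forb ψ) (demand a₁ a₂ a₃ a₄) k := by
  obtain ⟨v, hv1, hv⟩ := hv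
  refine OK.of_partner H h0.1 h0.2 l hl.1 hl.2 hlk hR hv1 hv (fun u hu => by rw [hF]; exact hu)
    (fun j hj0 hj5 hjk hjR => ?_) (fun e _ _ => weak_forb e)
  refine weak_demand j hj0 hj5 ?_ ?_ ?_ ?_ <;> rintro rfl
  exacts [h1 hjk hjR, h2 hjk hjR, h3 hjk hjR, h4 hjk hjR]

theorem rootZero_of_assemble (H : Attach B' R S B 5 f) (T : Set ℤ) (a₁ a₂ a₃ a₄ : Set (Fin 3))
    (hT : ∀ k ∈ T, 0 < k ∧ k < 5 ∧ OK R S B 5 f (forb ψ) (demand a₁ a₂ a₃ a₄) k)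
    (h1 : 1 ∈ T ∨ Weak a₁) (h2 : 2 ∈ T ∨ Weak a₂) (h3 : 3 ∈ T ∨ Weak a₃) (h4 : 4 ∈ T ∨ Weak a₄)
    (hg : ∀ x : ε → Fin 3, x (f 0) = 0 → x (f 1) ∈ a₁ → x (f 2) ∈ a₂ → x (f 3) ∈ a₃ →
      x (f 4) ∈ a₄ → Good f x) : RootZero S B f ψ := by
  obtain ⟨x, hx, h0, hB, e1, e2, e3, e4⟩ := H.assemble_five T 0 a₁ a₂ a₃ a₄ hT h1 h2 h3 h4
    (fun e _ _ => Or.inr (weak_forb e))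
  exact ⟨x, hx, hg x h0 e1 e2 e3 e4, h0, hB⟩

/-- The first obstruction on a five-cycle: the slots are in four different classes, the outer slots
cannot take the value `0` and the inner slots cannot take the value `2`. -/
structure FormA (R : ε → ε → Prop) (S : Set (ε → Fin 3)) (B : Set ε) (f : ℤ → ε)
    (ψ : ε → Fin 3) : Prop where
  s1 : Single R 5 f 1
  s2 : Single R 5 f 2
  s3 : Single R 5 f 3
  s4 : Single R 5 f 4
  c1 : ¬ Cap R S B f (forb ψ) 1 0
  c2 : ¬ Cap R S B f (forb ψ) 2 2
  c3 : ¬ Cap R S B f (forb ψ) 3 2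
  c4 : ¬ Cap R S B f (forb ψ) 4 0

/-- The second obstruction on a five-cycle: the slots `1` and `3` are in one class, the others are
single, and the slots `2` and `4` cannot take the values `2` and `0`, respectively. -/
structure FormB (R : ε → ε → Prop) (S : Set (ε → Fin 3)) (B : Set ε) (f : ℤ → ε)
    (ψ : ε → Fin 3) : Prop where
  rel : R (f 3) (f 1)
  s2 : Single R 5 f 2
  s4 : Single R 5 f 4
  c2 : ¬ Cap R S B f (forb ψ) 2 2
  c4 : ¬ Cap R S B f (forb ψ) 4 0
  own : ∀ t ∈ B, R t (f 1) → ψ t ≠ 1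

section FiveCycle

variable (H : Attach B' R S B 5 f)
include H

theorem rootZero_of_cap_one (hs : Single R 5 f 1) (hc : Cap R S B f (forb ψ) 1 0) :
    RootZero S B f ψ := by
  refine H.rootZero_of_assemble {1} {0} {0}ᶜ {0}ᶜ {0}ᶜ ?_ (Or.inl rfl) (Or.inr (weak_compl _))
    (Or.inr (weak_compl _)) (Or.inr (weak_compl _)) fun x h0 h1 h2 h3 h4 =>
      H.good_of (a := 0) (b := 1) (c := 2) (d := 3) (by decide) (Or.inl ⟨h0, h1, h2, h3⟩)
  rintro k rfl
  exact ⟨by norm_num, by norm_num, OK.of_cap hs hc (by rw [demand_one]; rfl)⟩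

theorem rootZero_of_rel_two (hR : R (f 2) (f 1)) : RootZero S B f ψ := by
  refine H.rootZero_of_assemble {1} {0} {1}ᶜ {0}ᶜ {0}ᶜ ?_ (Or.inl rfl) (Or.inr (weak_compl _))
    (Or.inr (weak_compl _)) (Or.inr (weak_compl _)) fun x h0 h1 h2 h3 h4 =>
      H.good_of (a := 1) (b := 0) (c := 4) (d := 3) (by decide) (Or.inl ⟨h1, h0, h4, h3⟩)
  rintro k rfl
  exact ⟨by norm_num, by norm_num, H.ok_five 1 2 (by norm_num) (by norm_num) (by norm_num) hR
    ⟨0, by decide, by rw [demand_one]; rfl⟩ demand_two (fun h => absurd rfl h)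
    (fun _ _ => weak_compl _) (fun _ _ => weak_compl _) (fun _ _ => weak_compl _)⟩

theorem rootZero_of_rel_four (hR : R (f 4) (f 1)) : RootZero S B f ψ := by
  refine H.rootZero_of_assemble {1} {0} {0}ᶜ {0}ᶜ {1}ᶜ ?_ (Or.inl rfl) (Or.inr (weak_compl _))
    (Or.inr (weak_compl _)) (Or.inr (weak_compl _)) fun x h0 h1 h2 h3 h4 =>
      H.good_of (a := 0) (b := 1) (c := 2) (d := 3) (by decide) (Or.inl ⟨h0, h1, h2, h3⟩)
  rintro k rfl
  exact ⟨by norm_num, by norm_num, H.ok_five 1 4 (by norm_num) (by norm_num) (by norm_num) hR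
    ⟨0, by decide, by rw [demand_one]; rfl⟩ demand_four (fun h => absurd rfl h)
    (fun _ _ => weak_compl _) (fun _ _ => weak_compl _) (fun _ _ => weak_compl _)⟩

/-- Two interleaved pairs of slots in common classes, the first of which consists of different
variables. -/
theorem rootZero_of_cross (h31 : R (f 3) (f 1)) (h24 : R (f 2) (f 4)) (h21 : ¬ R (f 2) (f 1))
    (hne : f 1 ≠ f 3) : RootZero S B f ψ := by
  have hE := H.kit.equiv
  have hL1 : ∀ e, R e (f 1) → ¬ Loose R S e := fun e he =>
    not_loose_of_rel hE h31 hne.symm e he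
  have hc : ∀ x : ε → Fin 3, (∀ e ∈ B', e ≠ f 1 → e ≠ f 3 → x e ≠ ψ e) → ∀ e ∈ B, R e (f 1) →
      x e ∈ forb ψ e := fun x hx e he heR => hx e (H.sub he)
    (fun h => hL1 e heR (h ▸ (H.boundary 1 (h ▸ he)).1))
    (fun h => hL1 e heR (h ▸ (H.boundary 3 (h ▸ he)).1))
  have h41 : ¬ R (f 4) (f 1) := fun h => h21 (hE.trans h24 h)
  rcases H.kit.two ψ (f 1) (f 3) (H.mem' 1) (H.mem' 3) hne (hE.symm h31) with
    ⟨x, hx, hx1, hx3, hx2⟩ | ⟨x, hx, hx1, hx3, hx2⟩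
  · refine H.rootZero_of_assemble {1} {0} {1}ᶜ {0}ᶜ {0}ᶜ ?_ (Or.inl rfl) (Or.inr (weak_compl _))
      (Or.inr (weak_compl _)) (Or.inr (weak_compl _)) fun x h0 h1 h2 h3 h4 =>
        H.good_of (a := 1) (b := 0) (c := 4) (d := 3) (by decide) (Or.inl ⟨h1, h0, h4, h3⟩)
    rintro k rfl
    refine ⟨by norm_num, by norm_num, x, hx, hc x hx2, fun l hl0 hl5 hlR => ?_⟩
    interval_cases l
    · rw [demand_one]; exact hx1
    · exact absurd hlR h21
    · rw [demand_three]; exact hx3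
    · exact absurd hlR h41
  · refine H.rootZero_of_assemble {3, 4} {2}ᶜ {1}ᶜ {2} {2} ?_ (Or.inr (weak_compl _))
      (Or.inr (weak_compl _)) (Or.inl (by simp)) (Or.inl (by simp)) fun x h0 h1 h2 h3 h4 =>
        H.good_of (a := 3) (b := 4) (c := 0) (d := 1) (by decide)
          (Or.inr ⟨h3, h4, by rw [h0]; decide, h1⟩)
    rintro k (rfl | rfl)
    · refine ⟨by norm_num, by norm_num, OK.trans H (k := 1) ?_ (hE.symm h31)⟩
      refine ⟨x, hx, hc x hx2, fun l hl0 hl5 hlR => ?_⟩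
      interval_cases l
      · rw [demand_one]; exact hx1
      · exact absurd hlR h21
      · rw [demand_three]; exact hx3
      · exact absurd hlR h41
    · exact ⟨by norm_num, by norm_num, H.ok_five 4 2 (by norm_num) (by norm_num) (by norm_num) h24
        ⟨2, by decide, by rw [demand_four]; rfl⟩ demand_two (fun _ _ => weak_compl _)
        (fun _ _ => weak_compl _) (fun _ h => absurd (hE.trans (hE.symm h31) h) (fun h =>
          h41 (hE.symm h))) (fun h => absurd rfl h)⟩

/-- The common class of the slots `1` and `3` contains a boundary variable from which the value `1`
is excluded; this variable tolerates both extreme values, so both slots can be prescribed. -/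
theorem rootZero_of_own (h31 : R (f 3) (f 1)) (hown : ∃ t ∈ B, R t (f 1) ∧ ψ t = 1) :
    RootZero S B f ψ := by
  have hE := H.kit.equiv
  obtain ⟨t, ht, htR, ht1⟩ := hown
  have hL : ¬ Loose R S (f 1) := fun hL => by
    have h1 := hL.1 _ htR
    have h2 := hL.1 _ h31
    exact absurd ((H.boundary 1 (h1 ▸ ht)).2 3 h2) (by decide)
  refine H.rootZero_of_assemble {1} {0} {0}ᶜ {0}ᶜ {0}ᶜ ?_ (Or.inl rfl) (Or.inr (weak_compl _))
    (Or.inr (weak_compl _)) (Or.inr (weak_compl _)) fun x h0 h1 h2 h3 h4 =>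
      H.good_of (a := 0) (b := 1) (c := 2) (d := 3) (by decide) (Or.inl ⟨h0, h1, h2, h3⟩)
  rintro k rfl
  refine ⟨by norm_num, by norm_num, OK.of_flag H (v := 0) (by norm_num) (by norm_num) hL (by decide)
    (by rw [demand_one]; rfl) (Or.inr ⟨t, ht, htR, fun u hu => ?_⟩) (fun l hl0 hl5 hl hlR => ?_)
    (fun e _ _ => weak_forb e)⟩
  · show u ≠ ψ t
    rwa [ht1]
  · exact weak_demand l hl0 hl5 (fun h => absurd h hl) (fun _ => weak_compl _)
      (fun _ => weak_compl _) (fun _ => weak_compl _)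

/-- The slots `1` and `2` take the value `2`, and the slot `4` the value `0` or `1`. -/
theorem rootZero_of_high (h1 : OK R S B 5 f (forb ψ) (demand {2} {2} {1}ᶜ {2}ᶜ) 1)
    (h2 : OK R S B 5 f (forb ψ) (demand {2} {2} {1}ᶜ {2}ᶜ) 2) : RootZero S B f ψ := by
  refine H.rootZero_of_assemble {1, 2} {2} {2} {1}ᶜ {2}ᶜ ?_ (Or.inl (by simp)) (Or.inl (by simp))
    (Or.inr (weak_compl _)) (Or.inr (weak_compl _)) fun x h0 h1 h2 h3 h4 =>
      H.good_of (a := 2) (b := 1) (c := 0) (d := 4) (by decide)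
        (Or.inr ⟨h2, h1, by rw [h0]; decide, h4⟩)
  rintro k (rfl | rfl)
  exacts [⟨by norm_num, by norm_num, h1⟩, ⟨by norm_num, by norm_num, h2⟩]

/-- If the slots `1` and `3` are in one class, separate from the classes of `2` and `4`, the second
obstruction is the only one. -/
theorem rootZero_or_formB (h31 : R (f 3) (f 1)) (h21 : ¬ R (f 2) (f 1)) (h41 : ¬ R (f 4) (f 1))
    (h24 : ¬ R (f 2) (f 4)) (c4 : ¬ Cap R S B f (forb ψ) 4 0) :
    RootZero S B f ψ ∨ FormB R S B f ψ := by
  have hE := H.kit.equiv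
  by_cases hown : ∃ t ∈ B, R t (f 1) ∧ ψ t = 1
  · exact Or.inl (H.rootZero_of_own h31 hown)
  have s2 : Single R 5 f 2 := by
    intro l hl0 hl5 hl
    interval_cases l
    · exact absurd (hE.symm hl) h21
    · rfl
    · exact absurd (hE.trans (hE.symm hl) h31) h21
    · exact absurd (hE.symm hl) h24
  have s4 : Single R 5 f 4 := by
    intro l hl0 hl5 hl
    interval_cases l
    · exact absurd (hE.symm hl) h41
    · exact absurd hl h24
    · exact absurd (hE.trans (hE.symm hl) h31) h41
    · rfl
  by_cases c2 : Cap R S B f (forb ψ) 2 2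
  · refine Or.inl (H.rootZero_of_high ?_ (OK.of_cap s2 c2 (by rw [demand_two]; rfl)))
    exact H.ok_five 1 3 (by norm_num) (by norm_num) (by norm_num) h31
      ⟨2, by decide, by rw [demand_one]; rfl⟩ demand_three (fun h => absurd rfl h)
      (fun _ h => absurd h h21) (fun _ _ => weak_compl _) (fun _ _ => weak_compl _)
  · exact Or.inr ⟨h31, s2, s4, c2, c4, fun t ht htR h => hown ⟨t, ht, htR, h⟩⟩

omit H in
theorem single_reflect (h : Single R n f k) (hper : ∀ k, f (k + n) = f k) :
    Single R n (fun k => f (-k)) (n - k) := by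
  intro l h0 hn hl
  have e1 : f (-l) = f (n - l) := by rw [← hper (-l)]; congr 1; ring
  have e2 : f (-(n - k)) = f k := by rw [← hper (-(n - k))]; congr 1; ring
  have hl' : R (f (-l)) (f (-(n - k))) := hl
  rw [e1, e2] at hl'
  have := h (n - l) (by omega) (by omega) hl'
  omega

theorem neg_eq (k l : ℤ) (h : 5 ∣ -k - l) : f (-k) = f l := cyc_eq (H := H) h

/-- On a cycle of length five the root can take the value `0`, up to two obstructions, the second of
which comes in two mirror images. -/
theorem rootZero_or_form (ψ : ε → Fin 3) : RootZero S B f ψ ∨ FormA R S B f ψ ∨ FormB R S B f ψ ∨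
    FormB R S B (fun k => f (-k)) ψ := by
  have hE := H.kit.equiv
  have H' := H.reflect
  have n1 : f (-1) = f 4 := H.neg_eq _ _ (by decide)
  have n2 : f (-2) = f 3 := H.neg_eq _ _ (by decide)
  have n3 : f (-3) = f 2 := H.neg_eq _ _ (by decide)
  have n4 : f (-4) = f 1 := H.neg_eq _ _ (by decide)
  by_cases hN : RootZero S B f ψ
  · exact Or.inl hN
  have hN' : ¬ RootZero S B (fun k => f (-k)) ψ := fun ⟨x, hx, hg, h0, h⟩ =>
    hN ⟨x, hx, hg.reflect, by simpa using h0, by simpa using h⟩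
  refine Or.inr ?_
  have h21 : ¬ R (f 2) (f 1) := fun h => hN (H.rootZero_of_rel_two h)
  have h41 : ¬ R (f 4) (f 1) := fun h => hN (H.rootZero_of_rel_four h)
  have h34 : ¬ R (f 3) (f 4) := fun h => hN' (H'.rootZero_of_rel_two (by rwa [n1, n2]))
  by_cases h31 : R (f 3) (f 1)
  · have h24 : ¬ R (f 2) (f 4) := by
      intro h24
      by_cases h13 : f 1 = f 3
      · have h24' : f 4 ≠ f 2 := fun h => H.cross rfl 0 ⟨h13, h.symm⟩
        exact hN' (H'.rootZero_of_cross (by simpa only [n1, n3] using h24)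
          (by simpa only [n2, n4] using h31) (by simpa only [n1, n2] using h34)
          (by simpa only [n1, n3] using h24'))
      · exact hN (H.rootZero_of_cross h31 h24 h21 h13)
    have s4 : Single R 5 f 4 := by
      intro l hl0 hl5 hl
      interval_cases l
      · exact absurd (hE.symm hl) h41
      · exact absurd hl h24
      · exact absurd hl h34
      · rfl
    have c4 : ¬ Cap R S B f (forb ψ) 4 0 := fun hc => hN' (H'.rootZero_of_cap_one
      (single_reflect s4 H.per) (by simpa only [Cap, n1] using hc))
    exact Or.inr (Or.inl ((H.rootZero_or_formB h31 h21 h41 h24 c4).resolve_left hN))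
  have s1 : Single R 5 f 1 := by
    intro l hl0 hl5 hl
    interval_cases l
    · rfl
    · exact absurd hl h21
    · exact absurd hl h31
    · exact absurd hl h41
  have c1 : ¬ Cap R S B f (forb ψ) 1 0 := fun hc => hN (H.rootZero_of_cap_one s1 hc)
  by_cases h24 : R (f 2) (f 4)
  · refine Or.inr (Or.inr ((H'.rootZero_or_formB (ψ := ψ) ?_ ?_ ?_ ?_ ?_).resolve_left hN'))
    · simpa only [n1, n3] using h24
    · simpa only [n1, n2] using h34
    · simpa only [n1, n4] using fun h => h41 (hE.symm h)
    · simpa only [n2, n4] using h31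
    · simpa only [Cap, n4] using c1
  have s4 : Single R 5 f 4 := by
    intro l hl0 hl5 hl
    interval_cases l
    · exact absurd (hE.symm hl) h41
    · exact absurd hl h24
    · exact absurd hl h34
    · rfl
  have c4 : ¬ Cap R S B f (forb ψ) 4 0 := fun hc => hN' (H'.rootZero_of_cap_one
    (single_reflect s4 H.per) (by simpa only [Cap, n1] using hc))
  have c1' : Cap R S B f (forb ψ) 1 2 := (H.cap_or 1 fun e _ _ => weak_forb e).resolve_left c1
  have c4' : Cap R S B f (forb ψ) 4 2 := (H.cap_or 4 fun e _ _ => weak_forb e).resolve_left c4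
  have h32 : ¬ R (f 3) (f 2) := fun h32 => hN <| by
    refine H.rootZero_of_high (OK.of_cap s1 c1' (by rw [demand_one]; rfl)) ?_
    exact H.ok_five 2 3 (by norm_num) (by norm_num) (by norm_num) h32
      ⟨2, by decide, by rw [demand_two]; rfl⟩ demand_three (fun _ h => absurd (hE.symm h) h21)
      (fun h => absurd rfl h) (fun _ _ => weak_compl _) (fun _ _ => weak_compl _)
  have s2 : Single R 5 f 2 := by
    intro l hl0 hl5 hl
    interval_cases l
    · exact absurd (hE.symm hl) h21
    · rfl
    · exact absurd hl h32
    · exact absurd (hE.symm hl) h24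
  have s3 : Single R 5 f 3 := by
    intro l hl0 hl5 hl
    interval_cases l
    · exact absurd (hE.symm hl) h31
    · exact absurd (hE.symm hl) h32
    · rfl
    · exact absurd (hE.symm hl) h34
  refine Or.inl ⟨s1, s2, s3, s4, c1, fun hc => hN ?_, fun hc => hN' ?_, c4⟩
  · exact H.rootZero_of_high (OK.of_cap s1 c1' (by rw [demand_one]; rfl))
      (OK.of_cap s2 hc (by rw [demand_two]; rfl))
  · exact H'.rootZero_of_high
      (OK.of_cap (single_reflect s4 H.per) (by simpa only [Cap, n1] using c4')
        (by rw [demand_one]; rfl))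
      (OK.of_cap (single_reflect s3 H.per) (by simpa only [Cap, n2] using hc)
        (by rw [demand_two]; rfl))

end FiveCycle

end Attach
end CubicLabel

/-! ### The two obstructions on a cycle of length five -/

namespace CubicLabel
namespace Attach

variable {ε : Type*} {B' B : Set ε} {R : ε → ε → Prop} {S : Set (ε → Fin 3)} {n : ℤ} {f : ℤ → ε}
  {O : ε → Set (Fin 3)} {ψ : ε → Fin 3} {k l : ℤ} {v : Fin 3}

/-- The labelling problem with the value `v` at the root is solvable. -/
def RootValue (S : Set (ε → Fin 3)) (B : Set ε) (f : ℤ → ε) (ψ : ε → Fin 3) (v : Fin 3) : Prop :=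
  ∃ x ∈ S, Good f x ∧ x (f 0) = v ∧ ∀ e ∈ B, e ≠ f 0 → x e ≠ ψ e

theorem RootValue.reflect (h : RootValue S B (fun k => f (-k)) ψ v) : RootValue S B f ψ v := by
  obtain ⟨x, hx, hg, h0, h⟩ := h
  exact ⟨x, hx, hg.reflect, by simpa using h0, by simpa using h⟩

/-- Under the first obstruction the inner slots can take the value `0`. -/
theorem FormA.root (H : Attach B' R S B 5 f) (hF : FormA R S B f ψ) (hv : v ≠ 0) :
    RootValue S B f ψ v := by
  have c2 := (H.cap_or 2 fun e _ _ => weak_forb e).resolve_right hF.c2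
  have c3 := (H.cap_or 3 fun e _ _ => weak_forb e).resolve_right hF.c3
  obtain ⟨x, hx, h0, hB, -, e2, e3, e4⟩ := H.assemble_five (O := forb ψ) {2, 3} v {1}ᶜ {0} {0} {0}ᶜ
    (by
      rintro k (rfl | rfl)
      · exact ⟨by norm_num, by norm_num, OK.of_cap hF.s2 c2 (by rw [demand_two]; rfl)⟩
      · exact ⟨by norm_num, by norm_num, OK.of_cap hF.s3 c3 (by rw [demand_three]; rfl)⟩)
    (Or.inr (weak_compl _)) (Or.inl (by simp)) (Or.inl (by simp)) (Or.inr (weak_compl _))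
    (fun e _ _ => Or.inr (weak_forb e))
  exact ⟨x, hx, H.good_of (a := 2) (b := 3) (c := 4) (d := 0) (by decide)
    (Or.inl ⟨e2, e3, e4, by rw [h0]; exact hv⟩), h0, hB⟩

theorem FormB.not_rel (H : Attach B' R S B 5 f) (hF : FormB R S B f ψ) :
    ¬ R (f 2) (f 1) ∧ ¬ R (f 4) (f 1) :=
  ⟨fun h => absurd (hF.s2 1 (by norm_num) (by norm_num) (H.kit.equiv.symm h)) (by norm_num),
    fun h => absurd (hF.s4 1 (by norm_num) (by norm_num) (H.kit.equiv.symm h)) (by norm_num)⟩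

/-- Under the second obstruction the slots `1` and `2` can take the value `0`. -/
theorem FormB.root (H : Attach B' R S B 5 f) (hF : FormB R S B f ψ) (hv : v ≠ 0) :
    RootValue S B f ψ v := by
  have c2 := (H.cap_or 2 fun e _ _ => weak_forb e).resolve_right hF.c2
  have hr := hF.not_rel H
  obtain ⟨x, hx, h0, hB, e1, e2, e3, e4⟩ := H.assemble_five (O := forb ψ) {1, 2} v {0} {0} {1}ᶜ {0}ᶜ
    (by
      rintro k (rfl | rfl)
      · exact ⟨by norm_num, by norm_num, H.ok_five 1 3 (by norm_num) (by norm_num) (by norm_num)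
          hF.rel ⟨0, by decide, by rw [demand_one]; rfl⟩ demand_three (fun h => absurd rfl h)
          (fun _ h => absurd h hr.1) (fun _ _ => weak_compl _) (fun _ _ => weak_compl _)⟩
      · exact ⟨by norm_num, by norm_num, OK.of_cap hF.s2 c2 (by rw [demand_two]; rfl)⟩)
    (Or.inl (by simp)) (Or.inl (by simp)) (Or.inr (weak_compl _)) (Or.inr (weak_compl _))
    (fun e _ _ => Or.inr (weak_forb e))
  exact ⟨x, hx, H.good_of (a := 2) (b := 1) (c := 0) (d := 4) (by decide)
    (Or.inl ⟨e2, e1, by rw [h0]; exact hv, e4⟩), h0, hB⟩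

/-- The demands `x e = 2` and `x t ≠ ψ t` for the other `t`. -/
def forbTwo (ψ : ε → Fin 3) (e : ε) : ε → Set (Fin 3) :=
  fun t => {u | (t = e → u = 2) ∧ (t ≠ e → u ≠ ψ t)}

/-- The labelling problem with a value other than `2` at the root and the value `2` at `e`. -/
def TwoValues (S : Set (ε → Fin 3)) (B : Set ε) (f : ℤ → ε) (ψ : ε → Fin 3) (e : ε) : Prop :=
  ∃ x ∈ S, Good f x ∧ x (f 0) ≠ 2 ∧ x e = 2 ∧ ∀ t ∈ B, t ≠ f 0 → t ≠ e → x t ≠ ψ t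

theorem TwoValues.reflect {e : ε} (h : TwoValues S B (fun k => f (-k)) ψ e) :
    TwoValues S B f ψ e := by
  obtain ⟨x, hx, hg, h0, h⟩ := h
  exact ⟨x, hx, hg.reflect, by simpa using h0, by simpa using h⟩

theorem twoValues_of_assemble {e : ε} (H : Attach B' R S B 5 f) (he : e ∈ B) (he0 : e ≠ f 0)
    (T : Set ℤ) (v : Fin 3) (hv : v ≠ 2) (a₁ a₂ a₃ a₄ : Set (Fin 3))
    (hT : ∀ k ∈ T, 0 < k ∧ k < 5 ∧ OK R S B 5 f (forbTwo ψ e) (demand a₁ a₂ a₃ a₄) k)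
    (h1 : 1 ∈ T ∨ Weak a₁) (h2 : 2 ∈ T ∨ Weak a₂) (h3 : 3 ∈ T ∨ Weak a₃) (h4 : 4 ∈ T ∨ Weak a₄)
    (heT : ∃ k ∈ T, R (f k) e)
    (hg : ∀ x : ε → Fin 3, x (f 0) = v → x (f 1) ∈ a₁ → x (f 2) ∈ a₂ → x (f 3) ∈ a₃ →
      x (f 4) ∈ a₄ → Good f x) : TwoValues S B f ψ e := by
  obtain ⟨x, hx, h0, hB, e1, e2, e3, e4⟩ := H.assemble_five T v a₁ a₂ a₃ a₄ hT h1 h2 h3 h4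
    (fun t _ _ => by
      by_cases hte : t = e
      · subst hte; exact Or.inl heT
      · exact Or.inr ⟨ψ t, fun u hu => by simpa [forbTwo, hte] using hu⟩)
  refine ⟨x, hx, hg x h0 e1 e2 e3 e4, by rwa [h0], ?_, fun t ht ht0 hte => ?_⟩
  · simpa [forbTwo] using hB e he he0
  · simpa [forbTwo, hte] using hB t ht ht0

section

open Classical in
theorem Cap.to_forbTwo {e : ε} (h : Cap R S B f (forb (Function.update ψ e 0)) k v)
    (hR : ¬ R e (f k)) : Cap R S B f (forbTwo ψ e) k v := by
  refine h.congr fun t _ htR => ?_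
  have : t ≠ e := by rintro rfl; exact hR htR
  ext u
  simp [forb, forbTwo, this]

theorem cap_forbTwo (H : Attach B' R S B n f) (ψ : ε → Fin 3) {e : ε} (he : e ∈ B)
    (heR : R e (f k)) : Cap R S B f (forbTwo ψ e) k 0 ∨ Cap R S B f (forbTwo ψ e) k 2 := by
  have h3 : ∀ u : Fin 3, u ≠ 1 → u = 0 ∨ u = 2 := by decide
  obtain ⟨u, hu, x, hx, hxe, h1, h2⟩ := H.cap_of_boundary (ψ := ψ) he heR
  have : Cap R S B f (forbTwo ψ e) k u := ⟨x, hx, fun t ht htR => by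
    by_cases hte : t = e
    · subst hte; simpa [forbTwo] using hxe
    · simpa [forbTwo, hte] using h1 t ht hte htR, h2⟩
  rcases h3 u hu with rfl | rfl
  exacts [Or.inl this, Or.inr this]

open Classical in
/-- The extension property for two variables under the first obstruction; the other two slots follow
by reflection. -/
theorem FormA.two {e : ε} (H : Attach B' R S B 5 f)
    (hF : FormA R S B f (Function.update ψ e 0)) (he : e ∈ B) (he0 : e ≠ f 0)
    (heR : R e (f 1) ∨ R e (f 2)) : TwoValues S B f ψ e := by
  have hE := H.kit.equiv
  have c1 := (H.cap_or 1 fun e _ _ => weak_forb e).resolve_left hF.c1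
  have c2 := (H.cap_or 2 fun e _ _ => weak_forb e).resolve_right hF.c2
  have c3 := (H.cap_or 3 fun e _ _ => weak_forb e).resolve_right hF.c3
  rcases heR with heR | heR
  · have h2 : ¬ R e (f 2) := fun h => absurd (hF.s2 1 (by norm_num) (by norm_num)
      (hE.trans (hE.symm heR) h)) (by norm_num)
    have h3 : ¬ R e (f 3) := fun h => absurd (hF.s3 1 (by norm_num) (by norm_num)
      (hE.trans (hE.symm heR) h)) (by norm_num)
    obtain ⟨u, hu⟩ : ∃ u, Cap R S B f (forbTwo ψ e) 1 u := by
      rcases H.cap_forbTwo ψ he heR with h | h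
      exacts [⟨_, h⟩, ⟨_, h⟩]
    refine H.twoValues_of_assemble he he0 {1, 2, 3} 1 (by decide) {u} {0} {0} {0}ᶜ ?_
      (Or.inl (by simp)) (Or.inl (by simp)) (Or.inl (by simp)) (Or.inr (weak_compl _))
      ⟨1, by simp, hE.symm heR⟩ fun x h0 h1 h2 h3 h4 =>
        H.good_of (a := 2) (b := 3) (c := 4) (d := 0) (by decide)
          (Or.inl ⟨h2, h3, h4, by rw [h0]; decide⟩)
    rintro k (rfl | rfl | rfl)
    · exact ⟨by norm_num, by norm_num, OK.of_cap hF.s1 hu (by rw [demand_one]; rfl)⟩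
    · exact ⟨by norm_num, by norm_num, OK.of_cap hF.s2 (c2.to_forbTwo h2) (by rw [demand_two]; rfl)⟩
    · exact ⟨by norm_num, by norm_num,
        OK.of_cap hF.s3 (c3.to_forbTwo h3) (by rw [demand_three]; rfl)⟩
  · have h1 : ¬ R e (f 1) := fun h => absurd (hF.s1 2 (by norm_num) (by norm_num)
      (hE.trans (hE.symm heR) h)) (by norm_num)
    have h3 : ¬ R e (f 3) := fun h => absurd (hF.s3 2 (by norm_num) (by norm_num)
      (hE.trans (hE.symm heR) h)) (by norm_num)
    rcases H.cap_forbTwo ψ he heR with hu | hu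
    · refine H.twoValues_of_assemble he he0 {2, 3} 1 (by decide) {1}ᶜ {0} {0} {0}ᶜ ?_
        (Or.inr (weak_compl _)) (Or.inl (by simp)) (Or.inl (by simp)) (Or.inr (weak_compl _))
        ⟨2, by simp, hE.symm heR⟩ fun x h0 h1 h2 h3 h4 =>
          H.good_of (a := 2) (b := 3) (c := 4) (d := 0) (by decide)
            (Or.inl ⟨h2, h3, h4, by rw [h0]; decide⟩)
      rintro k (rfl | rfl)
      · exact ⟨by norm_num, by norm_num, OK.of_cap hF.s2 hu (by rw [demand_two]; rfl)⟩
      · exact ⟨by norm_num, by norm_num,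
          OK.of_cap hF.s3 (c3.to_forbTwo h3) (by rw [demand_three]; rfl)⟩
    · refine H.twoValues_of_assemble he he0 {1, 2} 0 (by decide) {2} {2} {1}ᶜ {2}ᶜ ?_
        (Or.inl (by simp)) (Or.inl (by simp)) (Or.inr (weak_compl _)) (Or.inr (weak_compl _))
        ⟨2, by simp, hE.symm heR⟩ fun x h0 h1 h2 h3 h4 =>
          H.good_of (a := 2) (b := 1) (c := 0) (d := 4) (by decide)
            (Or.inr ⟨h2, h1, by rw [h0]; decide, h4⟩)
      rintro k (rfl | rfl)
      · exact ⟨by norm_num, by norm_num,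
          OK.of_cap hF.s1 (c1.to_forbTwo h1) (by rw [demand_one]; rfl)⟩
      · exact ⟨by norm_num, by norm_num, OK.of_cap hF.s2 hu (by rw [demand_two]; rfl)⟩

theorem FormA.reflect (H : Attach B' R S B 5 f) (hF : FormA R S B f ψ) :
    FormA R S B (fun k => f (-k)) ψ := by
  have n1 : f (-1) = f 4 := H.neg_eq _ _ (by decide)
  have n2 : f (-2) = f 3 := H.neg_eq _ _ (by decide)
  have n3 : f (-3) = f 2 := H.neg_eq _ _ (by decide)
  have n4 : f (-4) = f 1 := H.neg_eq _ _ (by decide)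
  exact ⟨single_reflect hF.s4 H.per, single_reflect hF.s3 H.per, single_reflect hF.s2 H.per,
    single_reflect hF.s1 H.per, by simpa only [Cap, n1] using hF.c4,
    by simpa only [Cap, n2] using hF.c3, by simpa only [Cap, n3] using hF.c2,
    by simpa only [Cap, n4] using hF.c1⟩

open Classical in
theorem FormB.two_two {e : ε} (H : Attach B' R S B 5 f)
    (hF : FormB R S B f (Function.update ψ e 0)) (he : e ∈ B) (he0 : e ≠ f 0)
    (heR : R e (f 2)) : TwoValues S B f ψ e := by
  have hE := H.kit.equiv
  have hr := hF.not_rel H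
  have h1 : ¬ R e (f 1) := fun h => hr.1 (hE.trans (hE.symm heR) h)
  -- the class of the slots `1` and `3` does not contain `e`
  have ok1 : ∀ v : Fin 3, v ≠ 1 → ∀ b : Set (Fin 3), Weak b →
      OK R S B 5 f (forbTwo ψ e) (demand {v} {v} {1}ᶜ b) 1 := fun v hv b hb =>
    OK.of_partner H (by norm_num) (by norm_num) 3 (by norm_num) (by norm_num) (by norm_num)
      hF.rel hv
      (by rw [demand_one]; rfl) (fun u hu => by rw [demand_three]; exact hu)
      (fun l hl0 hl5 hl hlR => weak_demand l hl0 hl5 (fun h => absurd h hl)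
        (fun h => absurd (h ▸ hlR) hr.1) (fun _ => weak_compl _) (fun _ => hb))
      (fun t _ htR => by
        have hte : t ≠ e := by rintro rfl; exact h1 htR
        exact ⟨ψ t, fun u hu => by simpa [forbTwo, hte] using hu⟩)
  rcases H.cap_forbTwo ψ he heR with hu | hu
  · refine H.twoValues_of_assemble he he0 {1, 2} 1 (by decide) {0} {0} {1}ᶜ {0}ᶜ ?_
      (Or.inl (by simp)) (Or.inl (by simp)) (Or.inr (weak_compl _)) (Or.inr (weak_compl _))
      ⟨2, by simp, hE.symm heR⟩ fun x h0 h1 h2 h3 h4 =>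
        H.good_of (a := 2) (b := 1) (c := 0) (d := 4) (by decide)
          (Or.inl ⟨h2, h1, by rw [h0]; decide, h4⟩)
    rintro k (rfl | rfl)
    · exact ⟨by norm_num, by norm_num, ok1 0 (by decide) _ (weak_compl _)⟩
    · exact ⟨by norm_num, by norm_num, OK.of_cap hF.s2 hu (by rw [demand_two]; rfl)⟩
  · refine H.twoValues_of_assemble he he0 {1, 2} 0 (by decide) {2} {2} {1}ᶜ {2}ᶜ ?_
      (Or.inl (by simp)) (Or.inl (by simp)) (Or.inr (weak_compl _)) (Or.inr (weak_compl _))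
      ⟨2, by simp, hE.symm heR⟩ fun x h0 h1 h2 h3 h4 =>
        H.good_of (a := 2) (b := 1) (c := 0) (d := 4) (by decide)
          (Or.inr ⟨h2, h1, by rw [h0]; decide, h4⟩)
    rintro k (rfl | rfl)
    · exact ⟨by norm_num, by norm_num, ok1 2 (by decide) _ (weak_compl _)⟩
    · exact ⟨by norm_num, by norm_num, OK.of_cap hF.s2 hu (by rw [demand_two]; rfl)⟩

open Classical in
theorem FormB.two_four {e : ε} (H : Attach B' R S B 5 f)
    (hF : FormB R S B f (Function.update ψ e 0)) (he : e ∈ B) (he0 : e ≠ f 0)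
    (heR : R e (f 4)) : TwoValues S B f ψ e := by
  have hE := H.kit.equiv
  have hr := hF.not_rel H
  have h1 : ¬ R e (f 1) := fun h => hr.2 (hE.trans (hE.symm heR) h)
  have h2 : ¬ R e (f 2) := fun h => absurd (hF.s2 4 (by norm_num) (by norm_num)
      (hE.trans (hE.symm heR) h)) (by norm_num)
  have c2 := (H.cap_or 2 fun e _ _ => weak_forb e).resolve_right hF.c2
  rcases H.cap_forbTwo ψ he heR with hu | hu
  · refine H.twoValues_of_assemble he he0 {4} 0 (by decide) {0}ᶜ {0}ᶜ {1}ᶜ {0} ?_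
      (Or.inr (weak_compl _)) (Or.inr (weak_compl _)) (Or.inr (weak_compl _)) (Or.inl (by simp))
      ⟨4, by simp, hE.symm heR⟩ fun x h0 h1 h2 h3 h4 =>
        H.good_of (a := 4) (b := 0) (c := 1) (d := 2) (by decide)
          (Or.inl ⟨h4, h0, h1, h2⟩)
    rintro k rfl
    exact ⟨by norm_num, by norm_num, OK.of_cap hF.s4 hu (by rw [demand_four]; rfl)⟩
  · refine H.twoValues_of_assemble he he0 {1, 2, 4} 1 (by decide) {0} {0} {1}ᶜ {2} ?_
      (Or.inl (by simp)) (Or.inl (by simp)) (Or.inr (weak_compl _)) (Or.inl (by simp))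
      ⟨4, by simp, hE.symm heR⟩ fun x h0 h1 h2 h3 h4 =>
        H.good_of (a := 2) (b := 1) (c := 0) (d := 4) (by decide)
          (Or.inl ⟨h2, h1, by rw [h0]; decide, by rw [Set.mem_singleton_iff.1 h4]; decide⟩)
    rintro k (rfl | rfl | rfl)
    · exact ⟨by norm_num, by norm_num, OK.of_partner H (v := 0) (by norm_num) (by norm_num) 3
        (by norm_num) (by norm_num) (by norm_num) hF.rel (by decide)
        (by rw [demand_one]; rfl) (fun u hu => by rw [demand_three]; exact hu)
        (fun l hl0 hl5 hl hlR => weak_demand l hl0 hl5 (fun h => absurd h hl)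
          (fun h => absurd (h ▸ hlR) hr.1) (fun _ => weak_compl _)
          (fun h => absurd (h ▸ hlR) hr.2))
        (fun t _ htR => by
          have hte : t ≠ e := by rintro rfl; exact h1 htR
          exact ⟨ψ t, fun u hu => by simpa [forbTwo, hte] using hu⟩)⟩
    · exact ⟨by norm_num, by norm_num,
        OK.of_cap hF.s2 (c2.to_forbTwo h2) (by rw [demand_two]; rfl)⟩
    · exact ⟨by norm_num, by norm_num, OK.of_cap hF.s4 hu (by rw [demand_four]; rfl)⟩

open Classical in
theorem FormB.two_one {e : ε} (H : Attach B' R S B 5 f)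
    (hF : FormB R S B f (Function.update ψ e 0)) (he : e ∈ B) (he0 : e ≠ f 0)
    (heR : R e (f 1)) : TwoValues S B f ψ e := by
  have hE := H.kit.equiv
  have hr := hF.not_rel H
  have h2 : ¬ R e (f 2) := fun h => hr.1 (hE.trans (hE.symm h) heR)
  have h4 : ¬ R e (f 4) := fun h => hr.2 (hE.trans (hE.symm h) heR)
  have c2 := ((H.cap_or 2 fun e _ _ => weak_forb e).resolve_right hF.c2).to_forbTwo h2
  have c4 := ((H.cap_or 4 fun e _ _ => weak_forb e).resolve_left hF.c4).to_forbTwo h4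
  have hL : ¬ Loose R S (f 1) := fun hL => by
    have h1 := hL.1 _ heR
    exact absurd ((H.boundary 1 (h1 ▸ he)).2 3 (hL.1 _ hF.rel)) (by decide)
  have hL3 : ¬ Loose R S (f 3) := fun h => hL (by rwa [h.1 _ (hE.symm hF.rel)])
  have h31 : f 3 ≠ f 1 := fun h =>
    absurd (H.slot_inj (by norm_num) (by norm_num) (by norm_num) (by norm_num) hL3 h) (by norm_num)
  have hB1 : f 1 ∉ B := fun h => hL (H.boundary 1 h).1
  have hB3 : f 3 ∉ B := fun h => hL3 (H.boundary 3 h).1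
  have he1 : f 1 ≠ e := fun h => hB1 (h ▸ he)
  have he3 : f 3 ≠ e := fun h => hB3 (h ▸ he)
  obtain ⟨x, hx, hxe, hx2⟩ := H.kit.three (Function.update (Function.update ψ (f 1) 2) (f 3) 1) e 2
    (H.sub he) (by decide)
    (Or.inl ⟨f 3, H.mem' 3, he3, hE.trans hF.rel (hE.symm heR), by simp⟩)
  have hx1 : x (f 1) ≠ 2 := by simpa [h31.symm] using hx2 (f 1) (H.mem' 1) he1
  have hx3 : x (f 3) ≠ 1 := by simpa using hx2 (f 3) (H.mem' 3) he3
  have ok : ∀ a₂ a₄ : Set (Fin 3), ∀ l, (l = 1 ∨ l = 3) →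
      OK R S B 5 f (forbTwo ψ e) (demand {x (f 1)} a₂ {x (f 3)} a₄) l := by
    intro a₂ a₄ l hl
    have h1 : OK R S B 5 f (forbTwo ψ e) (demand {x (f 1)} a₂ {x (f 3)} a₄) 1 := by
      refine ⟨x, hx, fun t ht htR => ?_, fun l hl0 hl5 hlR => ?_⟩
      · by_cases hte : t = e
        · subst hte; simpa [forbTwo] using hxe
        · have ht1 : t ≠ f 1 := fun h => hB1 (h ▸ ht)
          have ht3 : t ≠ f 3 := fun h => hB3 (h ▸ ht)
          simpa [forbTwo, hte, ht1, ht3] using hx2 t (H.sub ht) hte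
      · interval_cases l
        · rw [demand_one]; rfl
        · exact absurd hlR hr.1
        · rw [demand_three]; rfl
        · exact absurd hlR hr.2
    rcases hl with rfl | rfl
    exacts [h1, OK.trans H h1 (hE.symm hF.rel)]
  have h3 : ∀ u v : Fin 3, u ≠ 2 → v ≠ 1 → u = 0 ∨ (u = 1 ∧ v = 0) ∨ (u = 1 ∧ v = 2) := by decide
  rcases h3 _ _ hx1 hx3 with h | ⟨h, h'⟩ | ⟨h, h'⟩
  · refine H.twoValues_of_assemble he he0 {1, 2, 3} 1 (by decide) {x (f 1)} {0} {x (f 3)} {0}ᶜ ?_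
      (Or.inl (by simp)) (Or.inl (by simp)) (Or.inl (by simp)) (Or.inr (weak_compl _))
      ⟨1, by simp, hE.symm heR⟩ fun y h0 h1 h2 h3 h4 =>
        H.good_of (a := 2) (b := 1) (c := 0) (d := 4) (by decide)
          (Or.inl ⟨h2, by rw [Set.mem_singleton_iff.1 h1, h], by rw [h0]; decide, h4⟩)
    rintro k (rfl | rfl | rfl)
    · exact ⟨by norm_num, by norm_num, ok _ _ 1 (Or.inl rfl)⟩
    · exact ⟨by norm_num, by norm_num, OK.of_cap hF.s2 c2 (by rw [demand_two]; rfl)⟩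
    · exact ⟨by norm_num, by norm_num, ok _ _ 3 (Or.inr rfl)⟩
  · refine H.twoValues_of_assemble he he0 {1, 2, 3} 1 (by decide) {x (f 1)} {0} {x (f 3)} {0}ᶜ ?_
      (Or.inl (by simp)) (Or.inl (by simp)) (Or.inl (by simp)) (Or.inr (weak_compl _))
      ⟨1, by simp, hE.symm heR⟩ fun y h0 h1 h2 h3 h4 =>
        H.good_of (a := 2) (b := 3) (c := 4) (d := 0) (by decide)
          (Or.inl ⟨h2, by rw [Set.mem_singleton_iff.1 h3, h'], h4, by rw [h0]; decide⟩)
    rintro k (rfl | rfl | rfl)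
    · exact ⟨by norm_num, by norm_num, ok _ _ 1 (Or.inl rfl)⟩
    · exact ⟨by norm_num, by norm_num, OK.of_cap hF.s2 c2 (by rw [demand_two]; rfl)⟩
    · exact ⟨by norm_num, by norm_num, ok _ _ 3 (Or.inr rfl)⟩
  · refine H.twoValues_of_assemble he he0 {1, 3, 4} 0 (by decide) {x (f 1)} {1}ᶜ {x (f 3)} {2} ?_
      (Or.inl (by simp)) (Or.inr (weak_compl _)) (Or.inl (by simp)) (Or.inl (by simp))
      ⟨1, by simp, hE.symm heR⟩ fun y h0 h1 h2 h3 h4 =>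
        H.good_of (a := 3) (b := 4) (c := 0) (d := 1) (by decide)
          (Or.inr ⟨by rw [Set.mem_singleton_iff.1 h3, h'], h4, by rw [h0]; decide,
            by rw [Set.mem_singleton_iff.1 h1, h]; decide⟩)
    rintro k (rfl | rfl | rfl)
    · exact ⟨by norm_num, by norm_num, ok _ _ 1 (Or.inl rfl)⟩
    · exact ⟨by norm_num, by norm_num, ok _ _ 3 (Or.inr rfl)⟩
    · exact ⟨by norm_num, by norm_num, OK.of_cap hF.s4 c4 (by rw [demand_four]; rfl)⟩

/-- The extension property for two variables under the second obstruction. -/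
theorem FormB.two {e : ε} [DecidableEq ε] (H : Attach B' R S B 5 f)
    (hF : FormB R S B f (Function.update ψ e 0)) (he : e ∈ B) (he0 : e ≠ f 0)
    (heR : ∃ k, 0 < k ∧ k < 5 ∧ R e (f k)) : TwoValues S B f ψ e := by
  have : (Classical.decEq ε) = ‹DecidableEq ε› := Subsingleton.elim _ _
  subst this
  obtain ⟨k, h0, h5, h⟩ := heR
  interval_cases k
  exacts [hF.two_one H he he0 h, hF.two_two H he he0 h,
    hF.two_one H he he0 (H.kit.equiv.trans h hF.rel), hF.two_four H he he0 h]

end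

end Attach
end CubicLabel

/-! ### Cycles of length at least seven -/

namespace CubicLabel
namespace Attach

variable {ε : Type*} {B' B : Set ε} {R : ε → ε → Prop} {S : Set (ε → Fin 3)} {n : ℤ} {f : ℤ → ε}
  {O : ε → Set (Fin 3)} {ψ : ε → Fin 3} {k l : ℤ} {v : Fin 3}

theorem pat_of {x : ε → Fin 3} {a b c d : ε} (hv : v ≠ 1) (ha : x a = v) (hb : x b = v)
    (hc : x c ≠ v) (hd : x d ≠ v) : Pat x a b c d := by
  have h3 : ∀ u : Fin 3, u ≠ 1 → u = 0 ∨ u = 2 := by decide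
  rcases h3 v hv with rfl | rfl
  exacts [Or.inl ⟨ha, hb, hc, hd⟩, Or.inr ⟨ha, hb, hc, hd⟩]

theorem cap_reflect (hper : ∀ k, f (k + n) = f k) :
    Cap R S B (fun k => f (-k)) O (n - k) v ↔ Cap R S B f O k v := by
  have e2 : f (-(n - k)) = f k := by rw [← hper (-(n - k))]; congr 1; ring
  simp only [Cap, e2]

section LongCycle

variable (H : Attach B' R S B n f)
include H

theorem rootZero_of_slots (A : ℤ → Set (Fin 3)) (T : Set ℤ)
    (hT : ∀ k ∈ T, 0 < k ∧ k < n ∧ OK R S B n f (forb ψ) A k)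
    (hA : ∀ k, 0 < k → k < n → k ∉ T → Weak (A k))
    (hg : ∀ x : ε → Fin 3, x (f 0) = 0 → (∀ k, 0 < k → k < n → x (f k) ∈ A k) → Good f x) :
    RootZero S B f ψ := by
  obtain ⟨x, hx, h0, hB, h⟩ := H.assemble T 0 hT hA (fun e _ _ => Or.inr (weak_forb (ψ := ψ) e))
  exact ⟨x, hx, hg x h0 h, h0, hB⟩

/-- The value `v` on the slots in `Z`, a tolerant demand on the slots in `F`, and the demand to
avoid `v` elsewhere. -/
def pairDemand (v : Fin 3) (Z F : Set ℤ) : ℤ → Set (Fin 3) := fun k =>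
  {u | (k ∈ Z → u = v) ∧ (k ∉ Z → k ∈ F → u ≠ 1) ∧ (k ∉ Z → k ∉ F → u ≠ v)}

omit H in
theorem weak_pairDemand {Z F : Set ℤ} (hk : k ∉ Z) : Weak (pairDemand v Z F k) := by
  by_cases hF : k ∈ F
  · exact ⟨1, fun u hu => ⟨fun h => absurd h hk, fun _ _ => hu, fun _ h => absurd hF h⟩⟩
  · exact ⟨v, fun u hu => ⟨fun h => absurd h hk, fun _ h => absurd h hF, fun _ _ => hu⟩⟩

/-- A slot of `Z` meets the demand if it is single and capable of the value `v`, or if a slot of its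
class is in `F`, and no other slot of its class is in `Z`. -/
theorem ok_pairDemand {Z F : Set ℤ} (h0 : 0 < k) (hn : k < n) (hv : v ≠ 1) (hkZ : k ∈ Z)
    (h : (Single R n f k ∧ Cap R S B f (forb ψ) k v) ∨
      (∃ t, 0 < t ∧ t < n ∧ t ≠ k ∧ R (f t) (f k) ∧ t ∈ F) ∧
        ∀ l ∈ Z, 0 < l → l < n → l ≠ k → ¬ R (f l) (f k)) :
    OK R S B n f (forb ψ) (pairDemand v Z F) k := by
  have hv' : v ∈ pairDemand v Z F k :=
    ⟨fun _ => rfl, fun h => absurd hkZ h, fun h => absurd hkZ h⟩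
  rcases h with ⟨hs, hc⟩ | ⟨⟨t, ht0, htn, htk, htR, htF⟩, hZ⟩
  · exact OK.of_cap hs hc hv'
  · have htZ : t ∉ Z := fun h => hZ t h ht0 htn htk htR
    exact OK.of_partner H h0 hn t ht0 htn htk htR hv hv'
      (fun u hu => ⟨fun h => absurd h htZ, fun _ _ => hu, fun _ h => absurd htF h⟩)
      (fun l hl0 hln hlk hlR => weak_pairDemand fun h => hZ l h hl0 hln hlk hlR)
      (fun e _ _ => weak_forb e)

omit H in
theorem exists_partner (hs : ¬ Single R n f k) : ∃ t, 0 < t ∧ t < n ∧ t ≠ k ∧ R (f t) (f k) := by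
  by_contra hcon
  exact hs fun l h0 hn hl => by
    by_contra hlk
    exact hcon ⟨l, h0, hn, hlk, hl⟩

omit H in
theorem pairDemand_eq {x : ε → Fin 3} {Z F : Set ℤ} (h : x (f k) ∈ pairDemand v Z F k)
    (hk : k ∈ Z) : x (f k) = v := h.1 hk

omit H in
theorem pairDemand_ne {x : ε → Fin 3} {Z F : Set ℤ} (h : x (f k) ∈ pairDemand v Z F k)
    (hk : k ∉ Z) (hk' : k ∉ F) : x (f k) ≠ v := h.2.2 hk hk'

/-- If the root cannot take the value `0`, the slot `1` is alone in its class and cannot take the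
value `0`. -/
theorem single_one_of_not_rootZero (hn : 7 ≤ n) (hN : ¬ RootZero S B f ψ) :
    Single R n f 1 ∧ ¬ Cap R S B f (forb ψ) 1 0 := by
  by_contra hcon
  apply hN
  -- one of the two sides of the pair `0, 1` does not contain the partner `t` of the slot `1`
  obtain ⟨t, ht⟩ : ∃ t : ℤ, (Single R n f 1 ∧ Cap R S B f (forb ψ) 1 0) ∨
      (0 < t ∧ t < n ∧ t ≠ 1 ∧ R (f t) (f 1)) := by
    by_cases hs : Single R n f 1
    · exact ⟨0, Or.inl ⟨hs, by_contra fun hc => hcon ⟨hs, hc⟩⟩⟩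
    · obtain ⟨t, ht⟩ := exists_partner hs
      exact ⟨t, Or.inr ht⟩
  refine H.rootZero_of_slots (pairDemand 0 {1} {t}) {1} ?_ (fun k _ _ hk => weak_pairDemand hk) ?_
  · rintro k rfl
    refine ⟨by norm_num, by omega, H.ok_pairDemand (by norm_num) (by omega) (by decide) rfl ?_⟩
    rcases ht with h | ⟨h0, h1, h2, h3⟩
    · exact Or.inl h
    · exact Or.inr ⟨⟨t, h0, h1, h2, h3, rfl⟩, fun l hl _ _ hne => absurd hl hne⟩
  · intro x h0 hx
    have e1 := pairDemand_eq (hx 1 (by omega) (by omega)) rfl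
    by_cases ht' : t = 2 ∨ t = 3
    · refine H.good_of (a := 1) (b := 0) (c := n - 1) (d := n - 2) (Or.inr (by norm_num))
        (pat_of (by decide) e1 h0 ?_ ?_)
      · exact pairDemand_ne (hx (n - 1) (by omega) (by omega)) (by simp; omega) (by simp; omega)
      · exact pairDemand_ne (hx (n - 2) (by omega) (by omega)) (by simp; omega) (by simp; omega)
    · refine H.good_of (a := 0) (b := 1) (c := 2) (d := 3) (Or.inl (by norm_num))
        (pat_of (by decide) h0 e1 ?_ ?_)
      · exact pairDemand_ne (hx 2 (by omega) (by omega)) (by simp) (by simp; omega)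
      · exact pairDemand_ne (hx 3 (by omega) (by omega)) (by simp) (by simp; omega)

/-- If the root cannot take the value `0`, the slot `2` is alone in its class and cannot take the
value `2`. -/
theorem single_two_of_not_rootZero (hn : 7 ≤ n) (hN : ¬ RootZero S B f ψ) :
    Single R n f 2 ∧ ¬ Cap R S B f (forb ψ) 2 2 := by
  obtain ⟨hs1, hc1⟩ := H.single_one_of_not_rootZero hn hN
  have hE := H.kit.equiv
  have hc1' := (H.cap_or 1 fun e _ _ => weak_forb e).resolve_left hc1
  by_contra hcon
  apply hN
  obtain ⟨t, ht⟩ : ∃ t : ℤ, (Single R n f 2 ∧ Cap R S B f (forb ψ) 2 2 ∧ t = 0) ∨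
      (0 < t ∧ t < n ∧ t ≠ 2 ∧ R (f t) (f 2)) := by
    by_cases hs : Single R n f 2
    · exact ⟨0, Or.inl ⟨hs, by_contra fun hc => hcon ⟨hs, hc⟩, rfl⟩⟩
    · obtain ⟨t, ht⟩ := exists_partner hs
      exact ⟨t, Or.inr ht⟩
  have h12 : ¬ R (f 1) (f 2) := fun h => absurd (hs1 2 (by omega) (by omega) (hE.symm h)) (by omega)
  refine H.rootZero_of_slots (pairDemand 2 {1, 2} {t}) {1, 2} ?_
    (fun k _ _ hk => weak_pairDemand hk) ?_
  · rintro k (rfl | rfl)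
    · exact ⟨by norm_num, by omega, H.ok_pairDemand (by norm_num) (by omega) (by decide) (by simp)
        (Or.inl ⟨hs1, hc1'⟩)⟩
    · refine ⟨by norm_num, by omega, H.ok_pairDemand (by norm_num) (by omega) (by decide)
        (by simp) ?_⟩
      rcases ht with ⟨h, h', -⟩ | ⟨h0, h1, h2, h3⟩
      · exact Or.inl ⟨h, h'⟩
      · refine Or.inr ⟨⟨t, h0, h1, h2, h3, rfl⟩, ?_⟩
        rintro l (rfl | rfl) _ _ hne
        exacts [h12, absurd rfl hne]
  · intro x h0 hx
    have e1 := pairDemand_eq (hx 1 (by omega) (by omega)) (by simp)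
    have e2 := pairDemand_eq (hx 2 (by omega) (by omega)) (by simp)
    by_cases ht' : t = 3 ∨ t = 4
    · refine H.good_of (a := 2) (b := 1) (c := 0) (d := n - 1) (Or.inr (by norm_num))
        (pat_of (by decide) e2 e1 (by rw [h0]; decide) ?_)
      exact pairDemand_ne (hx (n - 1) (by omega) (by omega)) (by simp; omega) (by simp; omega)
    · refine H.good_of (a := 1) (b := 2) (c := 3) (d := 4) (Or.inl (by norm_num))
        (pat_of (by decide) e1 e2 ?_ ?_)
      · exact pairDemand_ne (hx 3 (by omega) (by omega)) (by simp) (by simp; omega)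
      · exact pairDemand_ne (hx 4 (by omega) (by omega)) (by simp) (by simp; omega)

/-- A pair of slots `j - 1, j` of the same type, with both slots before it free to avoid the common
value. -/
theorem rootZero_of_pair {j t : ℤ} (hj : 4 ≤ j) (hjn : j < n) (hv : v ≠ 1)
    (hs : Single R n f (j - 1)) (hc : Cap R S B f (forb ψ) (j - 1) v)
    (ht : (Single R n f j ∧ Cap R S B f (forb ψ) j v ∧ t = 0) ∨
      (j < t ∧ t < n ∧ R (f t) (f j))) : RootZero S B f ψ := by
  refine H.rootZero_of_slots (pairDemand v {j - 1, j} {t}) {j - 1, j} ?_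
    (fun k _ _ hk => weak_pairDemand hk) ?_
  · rintro k (rfl | rfl)
    · exact ⟨by omega, by omega, H.ok_pairDemand (by omega) (by omega) hv (by simp)
        (Or.inl ⟨hs, hc⟩)⟩
    · refine ⟨by omega, by omega, H.ok_pairDemand (by omega) (by omega) hv (by simp) ?_⟩
      rcases ht with ⟨h, h', -⟩ | ⟨h0, h1, h3⟩
      · exact Or.inl ⟨h, h'⟩
      · refine Or.inr ⟨⟨t, by omega, h1, by omega, h3, rfl⟩, ?_⟩
        rintro l (rfl | rfl) _ _ hne
        · exact fun h => absurd (hs k (by omega) (by omega) (H.kit.equiv.symm h)) (by omega)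
        · exact absurd rfl hne
  · intro x h0 hx
    have ht' : t = 0 ∨ j < t := by
      rcases ht with ⟨-, -, h⟩ | ⟨h, -⟩
      exacts [Or.inl h, Or.inr h]
    refine H.good_of (a := j) (b := j - 1) (c := j - 2) (d := j - 3) (Or.inr (by simp))
      (pat_of hv (pairDemand_eq (hx j (by omega) (by omega)) (by simp))
        (pairDemand_eq (hx (j - 1) (by omega) (by omega)) (by simp)) ?_ ?_)
    · exact pairDemand_ne (hx (j - 2) (by omega) (by omega)) (by simp) (by simp; omega)
    · exact pairDemand_ne (hx (j - 3) (by omega) (by omega)) (by simp) (by simp; omega)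

/-- The case in which the slot `3` is not of the type of the slot `1`. -/
theorem rootZero_of_three (hn : 7 ≤ n) (hs1 : Single R n f 1) (hs2 : Single R n f 2)
    (hc2 : Cap R S B f (forb ψ) 2 0)
    (h3 : Single R n f 3 → Cap R S B f (forb ψ) 3 0) : RootZero S B f ψ := by
  have hE := H.kit.equiv
  have hr1 : ∀ l, 1 < l → l < n → ¬ R (f 1) (f l) := fun l hl hln h =>
    absurd (hs1 l (by omega) hln (hE.symm h)) (by omega)
  have hr2 : ∀ l, 2 < l → l < n → ¬ R (f 2) (f l) := fun l hl hln h =>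
    absurd (hs2 l (by omega) hln (hE.symm h)) (by omega)
  have h3p : ∀ l, 2 < l → l < n → ∀ t, 0 < t → t < n → R (f t) (f l) → 2 < t := by
    intro l hl hln t ht0 htn h
    by_contra hcon
    have : t = 1 ∨ t = 2 := by omega
    rcases this with rfl | rfl
    exacts [hr1 l (by omega) hln h, hr2 l hl hln h]
  by_cases hs3 : Single R n f 3
  · refine H.rootZero_of_slots (pairDemand 0 {2, 3} ∅) {2, 3} ?_
      (fun k _ _ hk => weak_pairDemand hk) ?_
    · rintro k (rfl | rfl)
      · exact ⟨by omega, by omega, H.ok_pairDemand (by omega) (by omega) (by decide) (by simp)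
          (Or.inl ⟨hs2, hc2⟩)⟩
      · exact ⟨by omega, by omega, H.ok_pairDemand (by omega) (by omega) (by decide) (by simp)
          (Or.inl ⟨hs3, h3 hs3⟩)⟩
    · intro x h0 hx
      exact H.good_of (a := 2) (b := 3) (c := 4) (d := 5) (Or.inl (by norm_num))
        (pat_of (by decide) (pairDemand_eq (hx 2 (by omega) (by omega)) (by simp))
          (pairDemand_eq (hx 3 (by omega) (by omega)) (by simp))
          (pairDemand_ne (hx 4 (by omega) (by omega)) (by simp) (by simp))
          (pairDemand_ne (hx 5 (by omega) (by omega)) (by simp) (by simp)))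
  obtain ⟨t, ht0, htn, ht3, htR⟩ := exists_partner hs3
  have ht2 := h3p 3 (by omega) (by omega) t ht0 htn htR
  by_cases h43 : R (f 4) (f 3)
  · -- the class of the slots `3` and `4` is labelled before the role of the cycle is chosen
    let A₀ : ℤ → Set (Fin 3) := fun k => if k = 3 then {0} else if k = 5 then {0}ᶜ else {1}ᶜ
    have hA₀ : ∀ k, k ≠ 3 → Weak (A₀ k) := by
      intro k hk
      simp only [A₀, hk, if_false]
      split_ifs <;> exact weak_compl _
    have ok0 : OK R S B n f (forb ψ) A₀ 3 :=
      OK.of_partner H (v := 0) (by omega) (by omega) 4 (by omega) (by omega) (by omega) h43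
        (by decide) (by simp [A₀]) (fun u hu => by simpa [A₀] using hu)
        (fun l _ _ hl _ => hA₀ l hl) (fun e _ _ => weak_forb e)
    obtain ⟨x, hx, hxB, hxs⟩ := ok0
    have hx4 : x (f 4) ≠ 1 := by simpa [A₀] using hxs 4 (by omega) (by omega) h43
    have hc : ∀ u : Fin 3, u ≠ 1 → u = 0 ∨ u = 2 := by decide
    let A : ℤ → Set (Fin 3) := fun k =>
      if k = 4 then {x (f 4)} else if k = 1 then {0}ᶜ else
      if k = 2 then (if x (f 4) = 0 then {0}ᶜ else {0}) else A₀ k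
    have okA : OK R S B n f (forb ψ) A 3 := by
      refine ⟨x, hx, hxB, fun l hl0 hln hlR => ?_⟩
      have := h3p 3 (by omega) (by omega) l hl0 hln hlR
      by_cases hl4 : l = 4
      · subst hl4; simp [A]
      · have e1 : l ≠ 1 := by omega
        have e2 : l ≠ 2 := by omega
        simp only [A, hl4, e1, e2, if_false]
        exact hxs l hl0 hln hlR
    have okA4 : OK R S B n f (forb ψ) A 4 := OK.trans H okA (hE.symm h43)
    have wA : ∀ k, k ≠ 2 → k ≠ 3 → k ≠ 4 → Weak (A k) := by
      intro k h2 h3 h4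
      simp only [A, h2, h4, if_false]
      split_ifs
      exacts [weak_compl _, hA₀ k h3]
    rcases hc _ hx4 with h4 | h4
    · refine H.rootZero_of_slots A {3, 4} ?_ (fun k _ _ hk => ?_) ?_
      · rintro k (rfl | rfl)
        exacts [⟨by omega, by omega, okA⟩, ⟨by omega, by omega, okA4⟩]
      · by_cases h2 : k = 2
        · subst h2; simp [A, h4, weak_compl]
        · exact wA k h2 (fun h => hk (by simp [h])) (fun h => hk (by simp [h]))
      · intro y h0 hy
        have e4 : y (f 4) = 0 := by simpa [A, h4] using hy 4 (by omega) (by omega)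
        have e3 : y (f 3) = 0 := by simpa [A, A₀] using hy 3 (by omega) (by omega)
        have e2 : y (f 2) ≠ 0 := by simpa [A, h4] using hy 2 (by omega) (by omega)
        have e1 : y (f 1) ≠ 0 := by simpa [A] using hy 1 (by omega) (by omega)
        exact H.good_of (a := 4) (b := 3) (c := 2) (d := 1) (Or.inr (by norm_num))
          (Or.inl ⟨e4, e3, e2, e1⟩)
    · refine H.rootZero_of_slots A {2, 3, 4} ?_ (fun k _ _ hk => ?_) ?_
      · rintro k (rfl | rfl | rfl)
        exacts [⟨by omega, by omega, OK.of_cap hs2 hc2 (by simp [A, h4])⟩,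
          ⟨by omega, by omega, okA⟩, ⟨by omega, by omega, okA4⟩]
      · exact wA k (fun h => hk (by simp [h])) (fun h => hk (by simp [h]))
          (fun h => hk (by simp [h]))
      · intro y h0 hy
        have e4 : y (f 4) = 2 := by simpa [A, h4] using hy 4 (by omega) (by omega)
        have e3 : y (f 3) = 0 := by simpa [A, A₀] using hy 3 (by omega) (by omega)
        have e2 : y (f 2) = 0 := by simpa [A, h4] using hy 2 (by omega) (by omega)
        have e5 : y (f 5) ≠ 0 := by simpa [A, A₀] using hy 5 (by omega) (by omega)
        exact H.good_of (a := 2) (b := 3) (c := 4) (d := 5) (Or.inl (by norm_num))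
          (Or.inl ⟨e2, e3, by rw [e4]; decide, e5⟩)
  · have h34 : ¬ R (f 3) (f 4) := fun h => h43 (hE.symm h)
    have ht4 : t ≠ 4 := by rintro rfl; exact h43 htR
    obtain ⟨w, t', hw, ht'⟩ : ∃ w : Fin 3, ∃ t' : ℤ, w ≠ 1 ∧
        ((Single R n f 4 ∧ Cap R S B f (forb ψ) 4 w ∧ t' = 0) ∨
          (0 < t' ∧ t' < n ∧ t' ≠ 4 ∧ R (f t') (f 4) ∧ 4 < t')) := by
      by_cases hs4 : Single R n f 4
      · rcases H.cap_or 4 (O := forb ψ) fun e _ _ => weak_forb e with h | h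
        exacts [⟨0, 0, by decide, Or.inl ⟨hs4, h, rfl⟩⟩, ⟨2, 0, by decide, Or.inl ⟨hs4, h, rfl⟩⟩]
      · obtain ⟨t', h0, h1, h2, h3⟩ := exists_partner hs4
        have := h3p 4 (by omega) (by omega) t' h0 h1 h3
        have h33 : t' ≠ 3 := by rintro rfl; exact h34 h3
        exact ⟨0, t', by decide, Or.inr ⟨h0, h1, h2, h3, by omega⟩⟩
    refine H.rootZero_of_slots (pairDemand w {3, 4} {t, t'}) {3, 4} ?_
      (fun k _ _ hk => weak_pairDemand hk) ?_
    · rintro k (rfl | rfl)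
      · refine ⟨by omega, by omega, H.ok_pairDemand (by omega) (by omega) hw (by simp)
          (Or.inr ⟨⟨t, ht0, htn, ht3, htR, by simp⟩, ?_⟩)⟩
        rintro l (rfl | rfl) _ _ hne
        exacts [absurd rfl hne, h43]
      · refine ⟨by omega, by omega, H.ok_pairDemand (by omega) (by omega) hw (by simp) ?_⟩
        rcases ht' with ⟨h, h', -⟩ | ⟨h0, h1, h2, h3, -⟩
        · exact Or.inl ⟨h, h'⟩
        · refine Or.inr ⟨⟨t', h0, h1, h2, h3, by simp⟩, ?_⟩
          rintro l (rfl | rfl) _ _ hne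
          exacts [h34, absurd rfl hne]
    · intro x h0 hx
      have ht'' : t' = 0 ∨ 4 < t' := by
        rcases ht' with ⟨-, -, h⟩ | ⟨-, -, -, -, h⟩
        exacts [Or.inl h, Or.inr h]
      exact H.good_of (a := 4) (b := 3) (c := 2) (d := 1) (Or.inr (by norm_num))
        (pat_of hw (pairDemand_eq (hx 4 (by omega) (by omega)) (by simp))
          (pairDemand_eq (hx 3 (by omega) (by omega)) (by simp))
          (pairDemand_ne (hx 2 (by omega) (by omega)) (by simp) (by simp; omega))
          (pairDemand_ne (hx 1 (by omega) (by omega)) (by simp) (by simp; omega)))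

/-- On a cycle of length at least seven the root can always take the value `0`. -/
theorem rootZero_of_seven_le (hn : 7 ≤ n) (ψ : ε → Fin 3) : RootZero S B f ψ := by
  have hE := H.kit.equiv
  by_contra hN
  have H' := H.reflect
  have hN' : ¬ RootZero S B (fun k => f (-k)) ψ := fun ⟨x, hx, hg, h0, h⟩ =>
    hN ⟨x, hx, hg.reflect, by simpa using h0, by simpa using h⟩
  obtain ⟨hs1, hc1⟩ := H.single_one_of_not_rootZero hn hN
  obtain ⟨hs2, hc2⟩ := H.single_two_of_not_rootZero hn hN
  obtain ⟨-, hcl⟩ := H'.single_one_of_not_rootZero hn hN'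
  have hcl : ¬ Cap R S B f (forb ψ) (n - 1) 0 := by
    rw [← cap_reflect H.per]
    simpa using hcl
  let P : ℤ → Prop := fun j => Single R n f j ∧ ¬ Cap R S B f (forb ψ) j (if Even j then 2 else 0)
  have hP1 : P 1 := ⟨hs1, by simpa using hc1⟩
  have hP2 : P 2 := ⟨hs2, by simpa using hc2⟩
  have hPl : ¬ P (n - 1) := fun ⟨_, h⟩ => by
    have : Even (n - 1) := by obtain ⟨c, hc⟩ := H.odd; exact ⟨c, by omega⟩
    rw [if_pos this] at h
    rcases H.cap_or (n - 1) (O := forb ψ) fun e _ _ => weak_forb e with h' | h'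
    exacts [hcl h', h h']
  classical
  have hex : ∃ m : ℕ, ¬ P (m + 1) := ⟨(n - 2).toNat, by
    rwa [show (((n - 2).toNat : ℕ) : ℤ) + 1 = n - 1 by omega]⟩
  obtain ⟨j, hj1, hjn, hPj, hmin⟩ : ∃ j : ℤ, 1 ≤ j ∧ j < n ∧ ¬ P j ∧ ∀ i, 1 ≤ i → i < j → P i := by
    refine ⟨Nat.find hex + 1, by omega, ?_, Nat.find_spec hex, fun i h1 hi => ?_⟩
    · have : Nat.find hex ≤ (n - 2).toNat := Nat.find_min' hex (by
        rwa [show (((n - 2).toNat : ℕ) : ℤ) + 1 = n - 1 by omega])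
      omega
    · have := Nat.find_min hex (m := (i - 1).toNat) (by omega)
      rw [show (((i - 1).toNat : ℕ) : ℤ) + 1 = i by omega] at this
      exact not_not.1 this
  have hj3 : 3 ≤ j := by
    by_contra h
    have : j = 1 ∨ j = 2 := by omega
    rcases this with rfl | rfl
    exacts [hPj hP1, hPj hP2]
  rcases eq_or_lt_of_le hj3 with rfl | hj4
  · refine hN (H.rootZero_of_three hn hs1 hs2
      ((H.cap_or 2 fun e _ _ => weak_forb e).resolve_right hc2) fun hs3 => ?_)
    by_contra hc
    exact hPj ⟨hs3, by simpa [show ¬ Even (3 : ℤ) by decide] using hc⟩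
  · obtain ⟨hs, hc⟩ := hmin (j - 1) (by omega) (by omega)
    -- the value that both slots `j - 1` and `j` can take
    let v : Fin 3 := if Even j then 2 else 0
    have hv : v ≠ 1 := by simp only [v]; split_ifs <;> decide
    have hcv : Cap R S B f (forb ψ) (j - 1) v := by
      simp only [v]
      by_cases he : Even j
      · have : ¬ Even (j - 1) := by simpa [Int.even_sub_one] using he
        rw [if_neg this] at hc
        rw [if_pos he]
        exact (H.cap_or (j - 1) fun e _ _ => weak_forb e).resolve_left hc
      · have : Even (j - 1) := by simpa [Int.even_sub_one] using he
        rw [if_pos this] at hc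
        rw [if_neg he]
        exact (H.cap_or (j - 1) fun e _ _ => weak_forb e).resolve_right hc
    by_cases hsj : Single R n f j
    · have : Cap R S B f (forb ψ) j v := by
        by_contra h
        exact hPj ⟨hsj, h⟩
      exact hN (H.rootZero_of_pair (t := 0) (by omega) hjn hv hs hcv (Or.inl ⟨hsj, this, rfl⟩))
    · obtain ⟨t, h0, htn, htj, htR⟩ := exists_partner hsj
      have : j < t := by
        by_contra h
        have := (hmin t (by omega) (by omega)).1 j (by omega) hjn (hE.symm htR)
        omega
      exact hN (H.rootZero_of_pair (t := t) (by omega) hjn hv hs hcv (Or.inr ⟨this, htn, htR⟩))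

end LongCycle

end Attach
end CubicLabel

/-! ### Families of odd cycles with a boundary -/

namespace CubicLabel
namespace Attach

variable {ε : Type*} {B' B : Set ε} {R : ε → ε → Prop} {S : Set (ε → Fin 3)} {n : ℤ} {f : ℤ → ε}
  {O : ε → Set (Fin 3)} {ψ : ε → Fin 3} {k l : ℤ} {v : Fin 3}

theorem RootValue.flip (h : RootValue (flipSet S) B f (fun e => Fin.rev (ψ e)) v) :
    RootValue S B f ψ v.rev := by
  obtain ⟨x, hx, hg, h0, h⟩ := h
  exact ⟨_, hx, hg.flip, by simp [h0], fun e he hne => by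
    have := h e he hne
    rw [rev_ne_iff, ]
    exact this⟩

theorem n_cases (H : Attach B' R S B n f) : n = 5 ∨ 7 ≤ n := by
  obtain ⟨c, hc⟩ := H.odd
  have := H.five_le
  omega

theorem rootValue_zero_or (H : Attach B' R S B n f) (ψ : ε → Fin 3) :
    RootValue S B f ψ 0 ∨ ∀ v, v ≠ 0 → RootValue S B f ψ v := by
  rcases H.n_cases with rfl | hn
  · rcases H.rootZero_or_form ψ with h | h | h | h
    · exact Or.inl h
    · exact Or.inr fun v hv => h.root H hv
    · exact Or.inr fun v hv => h.root H hv
    · exact Or.inr fun v hv => (h.root H.reflect hv).reflect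
  · exact Or.inl (H.rootZero_of_seven_le hn ψ)

/-- The first extension property of `Kit` for the larger family. -/
theorem solve_one (H : Attach B' R S B n f) (ψ : ε → Fin 3) :
    ∃ x ∈ S, Good f x ∧ ∀ e ∈ B, x e ≠ ψ e := by
  obtain ⟨v, hv, x, hx, hg, h0, h⟩ : ∃ v, v ≠ ψ (f 0) ∧ RootValue S B f ψ v := by
    by_cases hψ : ψ (f 0) = 0
    · rcases H.flip.rootValue_zero_or (fun e => Fin.rev (ψ e)) with h | h
      · exact ⟨_, by rw [hψ]; decide, h.flip⟩
      · exact ⟨_, by rw [hψ]; decide, (h 1 (by decide)).flip⟩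
    · rcases H.rootValue_zero_or ψ with h | h
      · exact ⟨0, Ne.symm hψ, h⟩
      · have : ∀ u : Fin 3, ∃ v, v ≠ u ∧ v ≠ 0 := by decide
        obtain ⟨v, hv1, hv2⟩ := this (ψ (f 0))
        exact ⟨v, hv1, h v hv2⟩
  refine ⟨x, hx, hg, fun e he => ?_⟩
  by_cases he0 : e = f 0
  · rw [he0, h0]; exact hv
  · exact h e he he0

/-- `Flagged` for the root, expressed by the classes of the slots. -/
def RootFlagged (R : ε → ε → Prop) (B : Set ε) (n : ℤ) (f : ℤ → ε) (ψ : ε → Fin 3) : Prop :=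
  (∃ t ∈ B, (∃ k, 0 < k ∧ k < n ∧ R t (f k)) ∧ ψ t = 1) ∨
    (∀ t ∈ B, (∃ k, 0 < k ∧ k < n ∧ R t (f k)) → ψ t ≠ 2) ∨
    (∀ t ∈ B, (∃ k, 0 < k ∧ k < n ∧ R t (f k)) → ψ t ≠ 0)

theorem RootFlagged.flip (h : RootFlagged R B n f ψ) :
    RootFlagged R B n f (fun e => Fin.rev (ψ e)) := by
  rcases h with ⟨t, ht, h1, h3⟩ | h | h
  · exact Or.inl ⟨t, ht, h1, rev_eq_one.2 h3⟩
  · exact Or.inr (Or.inr fun t ht h1 h3 => h t ht h1 (rev_eq_zero.1 h3))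
  · exact Or.inr (Or.inl fun t ht h1 h3 => h t ht h1 (rev_eq_two.1 h3))

theorem FormA.not_flagged (H : Attach B' R S B 5 f) (hF : FormA R S B f ψ) :
    ¬ RootFlagged R B 5 f ψ := by
  rintro (⟨t, ht, ⟨k, h0, h5, hR⟩, h1⟩ | h | h)
  · interval_cases k
    · exact hF.c1 (H.cap_of_flag hF.s1 h0 h5 (by decide) (Or.inl ⟨t, ht, hR, h1⟩))
    · exact hF.c2 (H.cap_of_flag hF.s2 h0 h5 (by decide) (Or.inl ⟨t, ht, hR, h1⟩))
    · exact hF.c3 (H.cap_of_flag hF.s3 h0 h5 (by decide) (Or.inl ⟨t, ht, hR, h1⟩))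
    · exact hF.c4 (H.cap_of_flag hF.s4 h0 h5 (by decide) (Or.inl ⟨t, ht, hR, h1⟩))
  · exact hF.c2 (H.cap_of_flag hF.s2 (by norm_num) (by norm_num) (by decide)
      (Or.inr (Or.inl ⟨fun t ht hR => h t ht ⟨2, by norm_num, by norm_num, hR⟩, rfl⟩)))
  · exact hF.c1 (H.cap_of_flag hF.s1 (by norm_num) (by norm_num) (by decide)
      (Or.inr (Or.inr ⟨fun t ht hR => h t ht ⟨1, by norm_num, by norm_num, hR⟩, rfl⟩)))

theorem FormB.not_flagged (H : Attach B' R S B 5 f) (hF : FormB R S B f ψ) :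
    ¬ RootFlagged R B 5 f ψ := by
  rintro (⟨t, ht, ⟨k, h0, h5, hR⟩, h1⟩ | h | h)
  · interval_cases k
    · exact hF.own t ht hR h1
    · exact hF.c2 (H.cap_of_flag hF.s2 h0 h5 (by decide) (Or.inl ⟨t, ht, hR, h1⟩))
    · exact hF.own t ht (H.kit.equiv.trans hR hF.rel) h1
    · exact hF.c4 (H.cap_of_flag hF.s4 h0 h5 (by decide) (Or.inl ⟨t, ht, hR, h1⟩))
  · exact hF.c2 (H.cap_of_flag hF.s2 (by norm_num) (by norm_num) (by decide)
      (Or.inr (Or.inl ⟨fun t ht hR => h t ht ⟨2, by norm_num, by norm_num, hR⟩, rfl⟩)))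
  · exact hF.c4 (H.cap_of_flag hF.s4 (by norm_num) (by norm_num) (by decide)
      (Or.inr (Or.inr ⟨fun t ht hR => h t ht ⟨4, by norm_num, by norm_num, hR⟩, rfl⟩)))

theorem slot_reflect (hper : ∀ k, f (k + n) = f k) (t : ε) :
    (∃ k, 0 < k ∧ k < n ∧ R t (f (-k))) ↔ ∃ k, 0 < k ∧ k < n ∧ R t (f k) := by
  have e2 : ∀ k, f (-(n - k)) = f k := fun k => by rw [← hper (-(n - k))]; congr 1; ring
  constructor
  · rintro ⟨k, h0, hn, h⟩
    exact ⟨n - k, by omega, by omega, by rw [← e2]; simpa using h⟩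
  · rintro ⟨k, h0, hn, h⟩
    exact ⟨n - k, by omega, by omega, by rwa [e2]⟩

theorem solve_zero (H : Attach B' R S B n f) (hF : RootFlagged R B n f ψ) :
    RootValue S B f ψ 0 := by
  rcases H.n_cases with rfl | hn
  · rcases H.rootZero_or_form ψ with h | h | h | h
    · exact h
    · exact absurd hF (h.not_flagged H)
    · exact absurd hF (h.not_flagged H)
    · refine absurd ?_ (h.not_flagged H.reflect)
      simpa only [RootFlagged, slot_reflect H.per] using hF
  · exact H.rootZero_of_seven_le hn ψ

/-- The third extension property of `Kit` for the larger family, with the root as the given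
variable. -/
theorem solve_three (H : Attach B' R S B n f) (hF : RootFlagged R B n f ψ) (hv : v ≠ 1) :
    RootValue S B f ψ v := by
  have h3 : ∀ u : Fin 3, u ≠ 1 → u = 0 ∨ u = 2 := by decide
  rcases h3 v hv with rfl | rfl
  exacts [H.solve_zero hF, (H.flip.solve_zero hF.flip).flip]

/-- The second extension property of `Kit` for the larger family, with the root as first variable.
-/
theorem solve_two {e : ε} (H : Attach B' R S B n f) (ψ : ε → Fin 3) (he : e ∈ B) (he0 : e ≠ f 0)
    (heR : ∃ k, 0 < k ∧ k < n ∧ R e (f k)) :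
    (∃ x ∈ S, Good f x ∧ x (f 0) = 0 ∧ x e ≠ 0 ∧ ∀ t ∈ B, t ≠ f 0 → t ≠ e → x t ≠ ψ t) ∨
      TwoValues S B f ψ e := by
  classical
  by_cases hN : RootZero S B f (Function.update ψ e 0)
  · obtain ⟨x, hx, hg, h0, h⟩ := hN
    exact Or.inl ⟨x, hx, hg, h0, by simpa using h e he he0, fun t ht ht0 hte => by
      simpa [hte] using h t ht ht0⟩
  right
  rcases H.n_cases with rfl | hn
  · rcases (H.rootZero_or_form _).resolve_left hN with h | h | h
    · obtain ⟨k, h0, h5, hk⟩ := heR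
      have n1 : f (-1) = f 4 := H.neg_eq _ _ (by decide)
      have n2 : f (-2) = f 3 := H.neg_eq _ _ (by decide)
      interval_cases k
      · exact h.two H he he0 (Or.inl hk)
      · exact h.two H he he0 (Or.inr hk)
      · exact ((h.reflect H).two H.reflect he (by simpa using he0)
          (Or.inr (by simpa only [n2] using hk))).reflect
      · exact ((h.reflect H).two H.reflect he (by simpa using he0)
          (Or.inl (by simpa only [n1] using hk))).reflect
    · exact h.two H he he0 heR
    · exact (h.two H.reflect he (by simpa using he0) ((slot_reflect H.per e).2 heR)).reflect
  · exact absurd (H.rootZero_of_seven_le hn _) hN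

end Attach

theorem Good.congr {ε : Type*} {f : ℤ → ε} {x y : ε → Fin 3} (h : Good f x)
    (hxy : ∀ k, y (f k) = x (f k)) :
    Good f y := by
  obtain ⟨k, h⟩ := h
  refine ⟨k, ?_⟩
  simpa only [Pat, hxy] using h

theorem Good.shift {ε : Type*} {f : ℤ → ε} {x : ε → Fin 3} (c : ℤ)
    (h : Good (fun k => f (c + k)) x) : Good f x := by
  obtain ⟨k, h⟩ := h
  refine ⟨c + k, ?_⟩
  simpa only [add_assoc, add_sub_assoc] using h

theorem good_shift_iff {ε : Type*} {f : ℤ → ε} {x : ε → Fin 3} (c : ℤ) :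
    Good (fun k => f (c + k)) x ↔ Good f x := by
  refine ⟨Good.shift c, fun h => Good.shift (-c) ?_⟩
  simpa using h

/-- A family of cycles of odd lengths at least five whose slots carry variables: every variable is
carried by at most two slots, and no cycle of length five has two crossing chords. -/
structure CycleFamily (I ε : Type*) where
  /-- The length of a cycle. -/
  len : I → ℕ
  /-- The variable carried by a slot. -/
  var : ∀ i, ZMod (len i) → ε
  odd : ∀ i, Odd (len i)
  five_le : ∀ i, 5 ≤ len i
  two_slots : ∀ a b c : Σ i, ZMod (len i), var a.1 a.2 = var b.1 b.2 → var b.1 b.2 = var c.1 c.2 →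
    a = b ∨ b = c ∨ a = c
  cross : ∀ i, len i = 5 → ∀ j, ¬ (var i (j + 1) = var i (j + 3) ∧ var i (j + 2) = var i (j + 4))

namespace CycleFamily

variable {I ε : Type*} (F : CycleFamily I ε) {U : Finset I} {x : ε → Fin 3} {e e' : ε} {i : I}

/-- The variables along a cycle, as a periodic sequence. -/
def seq (i : I) (k : ℤ) : ε := F.var i k

/-- The variable `e` is carried by two slots of cycles in `U`. -/
def Interior (U : Finset I) (e : ε) : Prop :=
  ∃ a b : Σ i, ZMod (F.len i), a ≠ b ∧ a.1 ∈ U ∧ b.1 ∈ U ∧ F.var a.1 a.2 = e ∧ F.var b.1 b.2 = e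

/-- Two variables are connected through cycles in `U`. -/
def Conn (U : Finset I) : ε → ε → Prop :=
  Relation.EqvGen fun e e' => ∃ i ∈ U, ∃ j k, F.var i j = e ∧ F.var i k = e'

/-- The labellings that are good on all cycles in `U`. -/
def Sol (U : Finset I) : Set (ε → Fin 3) := {x | ∀ i ∈ U, Good (F.seq i) x}

/-- The variable `e` is carried by a slot of a cycle in `U`. -/
def Touched (U : Finset I) (e : ε) : Prop := ∃ i ∈ U, ∃ j, F.var i j = e

theorem conn_equiv (U : Finset I) : Equivalence (F.Conn U) := Relation.EqvGen.is_equivalence _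

variable {F}

theorem conn_var (hi : i ∈ U) (j k : ZMod (F.len i)) : F.Conn U (F.var i j) (F.var i k) :=
  Relation.EqvGen.rel _ _ ⟨i, hi, j, k, rfl, rfl⟩

theorem Conn.mono {V : Finset I} (hUV : U ⊆ V) (h : F.Conn U e e') : F.Conn V e e' :=
  Relation.EqvGen.mono (r := fun e e' => ∃ i ∈ U, ∃ j k, F.var i j = e ∧ F.var i k = e')
    (fun _ _ ⟨i, hi, h⟩ => ⟨i, hUV hi, h⟩) _ _ h

theorem Interior.mono {V : Finset I} (hUV : U ⊆ V) (h : F.Interior U e) : F.Interior V e :=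
  let ⟨a, b, h1, h2, h3, h4⟩ := h
  ⟨a, b, h1, hUV h2, hUV h3, h4⟩

theorem Conn.eq_or_touched (h : F.Conn U e e') : e = e' ∨ F.Touched U e ∧ F.Touched U e' := by
  induction h with
  | rel a b h =>
    obtain ⟨i, hi, j, k, rfl, rfl⟩ := h
    exact Or.inr ⟨⟨i, hi, j, rfl⟩, ⟨i, hi, k, rfl⟩⟩
  | refl => exact Or.inl rfl
  | symm a b _ ih =>
    rcases ih with rfl | h
    exacts [Or.inl rfl, Or.inr h.symm]
  | trans a b c _ _ ih1 ih2 =>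
    rcases ih1 with rfl | h1
    · exact ih2
    · rcases ih2 with rfl | h2
      exacts [Or.inr h1, Or.inr ⟨h1.1, h2.2⟩]

theorem loose_of_not_touched (h : ¬ F.Touched U e) : Loose (F.Conn U) (F.Sol U) e := by
  refine ⟨fun t ht => ht.eq_or_touched.resolve_right fun h' => h h'.2, fun x hx y hy i hi => ?_⟩
  exact Good.congr (hx i hi) fun k => hy _ fun h' => h ⟨i, hi, _, h'⟩

/-- A connection through `U` either uses cycles of `V` only or starts and ends with a connection
through `V` to a cycle outside `V`. -/
theorem conn_or_of_subset {V : Finset I} (U : Finset I) (h : F.Conn U e e') : F.Conn V e e' ∨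
    (∃ i ∈ U, i ∉ V ∧ ∃ j, F.Conn V e (F.var i j)) ∧
      ∃ i ∈ U, i ∉ V ∧ ∃ j, F.Conn V e' (F.var i j) := by
  have hE := F.conn_equiv V
  induction h with
  | rel a b h =>
    obtain ⟨i, hi, j, k, rfl, rfl⟩ := h
    by_cases hiV : i ∈ V
    · exact Or.inl (conn_var hiV j k)
    · exact Or.inr ⟨⟨i, hi, hiV, j, hE.refl _⟩, ⟨i, hi, hiV, k, hE.refl _⟩⟩
  | refl => exact Or.inl (hE.refl _)
  | symm a b _ ih =>
    rcases ih with h | h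
    exacts [Or.inl (hE.symm h), Or.inr h.symm]
  | trans a b c _ _ ih1 ih2 =>
    rcases ih1 with h1 | ⟨h1, ⟨i, hi, hiV, k, h1'⟩⟩
    · rcases ih2 with h2 | ⟨⟨i, hi, hiV, j, h2⟩, h2'⟩
      exacts [Or.inl (hE.trans h1 h2), Or.inr ⟨⟨i, hi, hiV, j, hE.trans h1 h2⟩, h2'⟩]
    · rcases ih2 with h2 | ⟨-, h2'⟩
      exacts [Or.inr ⟨h1, ⟨i, hi, hiV, k, hE.trans (hE.symm h2) h1'⟩⟩, Or.inr ⟨h1, h2'⟩]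

theorem conn_erase [DecidableEq I] (i : I) (h : F.Conn U e e') : F.Conn (U.erase i) e e' ∨
    (∃ j, F.Conn (U.erase i) e (F.var i j)) ∧ ∃ j, F.Conn (U.erase i) e' (F.var i j) := by
  rcases conn_or_of_subset (V := U.erase i) U h with h | ⟨⟨i₁, h1, h1', h2⟩, i₂, h3, h3', h4⟩
  · exact Or.inl h
  · have e1 : i₁ = i := by_contra fun h => h1' (Finset.mem_erase.2 ⟨h, h1⟩)
    have e2 : i₂ = i := by_contra fun h => h3' (Finset.mem_erase.2 ⟨h, h3⟩)
    subst e1 e2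
    exact Or.inr ⟨h2, h4⟩

theorem not_interior_erase [DecidableEq I] (i : I) (j : ZMod (F.len i)) :
    ¬ F.Interior (U.erase i) (F.var i j) := by
  rintro ⟨a, b, hab, ha, hb, hae, hbe⟩
  rcases F.two_slots a b ⟨i, j⟩ (hae.trans hbe.symm) hbe with h | h | h
  · exact hab h
  · rw [h] at hb; simp at hb
  · rw [h] at ha; simp at ha

theorem var_eq_iff (i : I) (j : ZMod (F.len i)) (k l : ℤ) :
    j + (k : ZMod (F.len i)) = j + l ↔ (F.len i : ℤ) ∣ k - l := by
  rw [add_right_inj, eq_comm, ZMod.intCast_eq_intCast_iff_dvd_sub]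

/-- A cycle of `U` with a slot on the boundary of `U` is attached at this slot to the other cycles.
-/
theorem attach [DecidableEq I] (hi : i ∈ U) (j : ZMod (F.len i))
    (hj : ¬ F.Interior U (F.var i j))
    (K : Kit {e | ¬ F.Interior (U.erase i) e} (F.Conn (U.erase i)) (F.Sol (U.erase i))) :
    Attach {e | ¬ F.Interior (U.erase i) e} (F.Conn (U.erase i)) (F.Sol (U.erase i))
      {e | ¬ F.Interior U e} (F.len i) (fun k => F.var i (j + k)) where
  kit := K
  odd := by exact_mod_cast F.odd i
  five_le := by exact_mod_cast F.five_le i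
  per k := by simp
  mem' k := not_interior_erase i _
  sub e he h := he (h.mono (Finset.erase_subset _ _))
  chord k l h hkl := by
    apply loose_of_not_touched
    rintro ⟨i', hi', j', h'⟩
    have hkl' : (⟨i, j + k⟩ : Σ i, ZMod (F.len i)) ≠ ⟨i, j + l⟩ := fun h => by
      simp only [Sigma.mk.injEq, heq_eq_eq, true_and] at h
      exact hkl ((var_eq_iff i j k l).1 h)
    have hne := Finset.ne_of_mem_erase hi'
    rcases F.two_slots ⟨i', j'⟩ ⟨i, j + k⟩ ⟨i, j + l⟩ h' h with h | h | h
    · exact hne (congrArg Sigma.fst h)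
    · exact hkl' h
    · exact hne (congrArg Sigma.fst h)
  two_slots a b c h h' := by
    rcases F.two_slots ⟨i, j + a⟩ ⟨i, j + b⟩ ⟨i, j + c⟩ h h' with h | h | h <;>
    · simp only [Sigma.mk.injEq, heq_eq_eq, true_and] at h
      have := (var_eq_iff i j _ _).1 h
      tauto
  root := by simpa using hj
  boundary k hk := by
    refine ⟨loose_of_not_touched ?_, fun l hl => ?_⟩
    · rintro ⟨i', hi', j', h'⟩
      have hne := Finset.ne_of_mem_erase hi'
      exact hk ⟨⟨i', j'⟩, ⟨i, j + k⟩, fun h => hne (congrArg Sigma.fst h),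
        Finset.mem_of_mem_erase hi', hi, h', rfl⟩
    · by_contra hlk
      refine hk ⟨⟨i, j + l⟩, ⟨i, j + k⟩, fun h => ?_, hi, hi, hl, rfl⟩
      simp only [Sigma.mk.injEq, heq_eq_eq, true_and] at h
      exact hlk ((var_eq_iff i j _ _).1 h)
  cross h5 c h := by
    refine F.cross i (by exact_mod_cast h5) (j + c) ?_
    simpa [add_assoc] using h

theorem conn_root [DecidableEq I] {B' S} (hi : i ∈ U) (j : ZMod (F.len i))
    (H : Attach B' (F.Conn (U.erase i)) S {e | ¬ F.Interior U e} (F.len i)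
      (fun k => F.var i (j + k))) {t : ε} :
    (t ≠ F.var i j ∧ F.Conn U t (F.var i j)) ↔
      ∃ k : ℤ, 0 < k ∧ k < F.len i ∧ F.Conn (U.erase i) t (F.var i (j + k)) := by
  have hE := F.conn_equiv (U.erase i)
  have hE' := F.conn_equiv U
  constructor
  · rintro ⟨hne, h⟩
    have hr : ¬ F.Conn (U.erase i) t (F.var i j) := fun h => hne (by
      simpa using H.root_loose.1 t (by simpa using h))
    obtain ⟨⟨l, hl⟩, -⟩ := (conn_erase i h).resolve_left hr
    have : NeZero (F.len i) := ⟨by have := F.five_le i; omega⟩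
    have hl0 : l - j ≠ 0 := fun h0 => hr (by rwa [sub_eq_zero.1 h0] at hl)
    refine ⟨(l - j).val, ?_, ?_, ?_⟩
    · have : (l - j).val ≠ 0 := by simpa [ZMod.val_eq_zero] using hl0
      omega
    · exact_mod_cast ZMod.val_lt (l - j)
    · simpa using hl
  · rintro ⟨k, h0, hn, h⟩
    refine ⟨by simpa using H.not_rel_root h0 hn h, ?_⟩
    exact hE'.trans (h.mono (Finset.erase_subset _ _)) (conn_var hi _ _)

theorem sol_of_erase [DecidableEq I] (j : ZMod (F.len i)) (hx : x ∈ F.Sol (U.erase i))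
    (hg : Good (fun k : ℤ => F.var i (j + k)) x) : x ∈ F.Sol U := by
  intro i' hi'
  by_cases h : i' = i
  · subst h
    have : NeZero (F.len i') := ⟨by have := F.five_le i'; omega⟩
    rw [← good_shift_iff (j.val : ℤ)]
    convert hg using 2 with k
    simp [seq]
  · exact hx i' (Finset.mem_erase.2 ⟨h, hi'⟩)

theorem mix (y : ε → ε → Fin 3) (hy : ∀ s, y s ∈ F.Sol U)
    (hR : ∀ s t, F.Conn U s t → y s = y t) : (fun e => y e e) ∈ F.Sol U := by
  intro i hi
  refine Good.congr (hy (F.seq i 0) i hi) fun k => ?_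
  exact congrFun (hR _ _ (conn_var hi _ _)) _

theorem touched_cases [DecidableEq I] (h : F.Touched U e) (he : ¬ F.Interior U e)
    (hK : ∀ i ∈ U, Kit {e | ¬ F.Interior (U.erase i) e} (F.Conn (U.erase i)) (F.Sol (U.erase i))) :
    ∃ i ∈ U, ∃ j, F.var i j = e ∧
      Attach {e | ¬ F.Interior (U.erase i) e} (F.Conn (U.erase i)) (F.Sol (U.erase i))
        {e | ¬ F.Interior U e} (F.len i) (fun k => F.var i (j + k)) := by
  obtain ⟨i, hi, j, rfl⟩ := h
  exact ⟨i, hi, j, rfl, attach hi j he (hK i hi)⟩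

/-- The induction over the cycles: if every cycle of `U` is connected to a boundary variable, the
labellings that are good on `U` have the properties recorded in `Kit`. -/
theorem kit (F : CycleFamily I ε) (U : Finset I)
    (hU : ∀ i ∈ U, ∃ e, ¬ F.Interior U e ∧ F.Conn U (F.var i 0) e) :
    Kit {e | ¬ F.Interior U e} (F.Conn U) (F.Sol U) := by
  classical
  induction U using Finset.strongInduction with
  | H U ih =>
  have hE := F.conn_equiv U
  have hK : ∀ i ∈ U, Kit {e | ¬ F.Interior (U.erase i) e} (F.Conn (U.erase i))
      (F.Sol (U.erase i)) := by
    intro i hi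
    refine ih _ (Finset.erase_ssubset hi) fun i' hi' => ?_
    obtain ⟨e, he, hc⟩ := hU i' (Finset.mem_of_mem_erase hi')
    rcases conn_erase i hc with h | ⟨⟨j, h⟩, -⟩
    · exact ⟨e, fun h => he (h.mono (Finset.erase_subset _ _)), h⟩
    · exact ⟨_, not_interior_erase i j, h⟩
  have h1 : ∀ ψ : ε → Fin 3, ∃ x ∈ F.Sol U, ∀ e ∈ {e | ¬ F.Interior U e}, x e ≠ ψ e := by
    intro ψ
    rcases U.eq_empty_or_nonempty with rfl | ⟨i, hi⟩
    · refine ⟨fun e => ψ e + 1, fun i hi => by simp at hi, fun e _ => ?_⟩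
      have : ∀ u : Fin 3, u + 1 ≠ u := by decide
      exact this _
    · obtain ⟨e, he, hc⟩ := hU i hi
      have ht : F.Touched U e := by
        rcases hc.eq_or_touched with h | h
        exacts [⟨i, hi, 0, h⟩, h.2]
      obtain ⟨i, hi, j, -, H⟩ := touched_cases ht he hK
      obtain ⟨x, hx, hg, h⟩ := H.solve_one ψ
      exact ⟨x, sol_of_erase j hx hg, h⟩
  refine ⟨hE, mix, h1, fun ψ s t hs ht hst hR => ?_, fun ψ s v hs hv hF => ?_⟩
  · have hs' : F.Touched U s := (hR.eq_or_touched.resolve_left hst).1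
    obtain ⟨i, hi, j, rfl, H⟩ := touched_cases hs' hs hK
    have h0 : F.var i (j + ((0 : ℤ) : ZMod (F.len i))) = F.var i j := by simp
    rcases H.solve_two ψ ht (by simpa using hst.symm)
      ((conn_root hi j H).1 ⟨hst.symm, hE.symm hR⟩) with ⟨x, hx, hg, h⟩ | ⟨x, hx, hg, h⟩
    · exact Or.inl ⟨x, sol_of_erase j hx hg, by simpa only [h0] using h⟩
    · exact Or.inr ⟨x, sol_of_erase j hx hg, by simpa only [h0] using h⟩
  · by_cases hs' : F.Touched U s
    · obtain ⟨i, hi, j, rfl, H⟩ := touched_cases hs' hs hK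
      have h0 : F.var i (j + ((0 : ℤ) : ZMod (F.len i))) = F.var i j := by simp
      have hF' : Attach.RootFlagged (F.Conn (U.erase i)) {e | ¬ F.Interior U e} (F.len i)
          (fun k => F.var i (j + k)) ψ := by
        rcases hF with ⟨t, ht, hts, htR, ht1⟩ | h | h
        · exact Or.inl ⟨t, ht, (conn_root hi j H).1 ⟨hts, htR⟩, ht1⟩
        · refine Or.inr (Or.inl fun t ht hk => ?_)
          obtain ⟨h1, h2⟩ := (conn_root hi j H).2 hk
          exact h t ht h1 h2
        · refine Or.inr (Or.inr fun t ht hk => ?_)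
          obtain ⟨h1, h2⟩ := (conn_root hi j H).2 hk
          exact h t ht h1 h2
      obtain ⟨x, hx, hg, h⟩ := H.solve_three hF' hv
      exact ⟨x, sol_of_erase j hx hg, by simpa only [h0] using h⟩
    · have hL := loose_of_not_touched hs'
      obtain ⟨x, hx, h⟩ := h1 ψ
      refine ⟨Function.update x s v, hL.2 x hx _ fun t ht => by simp [ht], by simp,
        fun e he hes => by simpa [hes] using h e he⟩

end CycleFamily

end CubicLabel

/-! ### Families without a boundary -/

namespace CubicLabel
namespace CycleFamily

variable {I ε : Type*} {F : CycleFamily I ε} {U K : Finset I} {x : ε → Fin 3} {e e' : ε} {i : I}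

/-- A connected set of cycles without boundary variables. -/
structure IsClosed (F : CycleFamily I ε) (K : Finset I) : Prop where
  interior : ∀ i ∈ K, ∀ j, F.Interior K (F.var i j)
  conn : ∀ i ∈ K, ∀ i' ∈ K, F.Conn K (F.var i 0) (F.var i' 0)

section

variable [DecidableEq I]

theorem not_interior_sdiff {T : Finset I} (hi : i ∈ T) (j : ZMod (F.len i)) :
    ¬ F.Interior (K \ T) (F.var i j) := fun h =>
  not_interior_erase i j (h.mono fun _ hi' => Finset.mem_erase.2
    ⟨fun h => (Finset.mem_sdiff.1 hi').2 (h ▸ hi), (Finset.mem_sdiff.1 hi').1⟩)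

theorem IsClosed.kit {T : Finset I} (hK : F.IsClosed K) (hT : T ⊆ K) (hT0 : T.Nonempty) :
    Kit {e | ¬ F.Interior (K \ T) e} (F.Conn (K \ T)) (F.Sol (K \ T)) := by
  refine F.kit _ fun i hi => ?_
  obtain ⟨t, ht⟩ := hT0
  have hc := hK.conn i (Finset.mem_sdiff.1 hi).1 t (hT ht)
  rcases conn_or_of_subset (V := K \ T) K hc with h | ⟨⟨i', hi', hi'', j, h⟩, -⟩
  · exact ⟨_, not_interior_sdiff ht 0, h⟩
  · have : i' ∈ T := by
      by_contra h; exact hi'' (Finset.mem_sdiff.2 ⟨hi', h⟩)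
    exact ⟨_, not_interior_sdiff this j, h⟩

theorem sol_of_sdiff {T : Finset I} (hx : x ∈ F.Sol (K \ T)) (hT : ∀ i ∈ T, Good (F.seq i) x) :
    x ∈ F.Sol K := fun i hi => by
  by_cases h : i ∈ T
  exacts [hT i h, hx i (Finset.mem_sdiff.2 ⟨hi, h⟩)]

omit [DecidableEq I] in
theorem exists_extend (hx : x ∈ F.Sol U) (w : ε → Fin 3) : ∃ y ∈ F.Sol U,
    (∀ e, ¬ F.Touched U e → y e = w e) ∧ ∀ e, F.Touched U e → y e = x e := by
  classical
  refine ⟨fun e => if F.Touched U e then x e else w e, fun i hi => ?_, fun e he => by simp [he],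
    fun e he => by simp [he]⟩
  exact Good.congr (hx i hi) fun k => if_pos ⟨i, hi, _, rfl⟩

/-- A set `Z` of variables, at most one of which lies on cycles in `T` and on other cycles, can be
made the set of variables of cycles in `T` that have the label `0`. -/
theorem IsClosed.exists_zero_set {T : Finset I} (hK : F.IsClosed K) (hT : T ⊆ K)
    (hT0 : T.Nonempty) (Z : Set ε)
    (hZ : ∀ e ∈ Z, ∀ e' ∈ Z, F.Touched T e → F.Touched T e' → F.Touched (K \ T) e →
      F.Touched (K \ T) e' → e = e') :
    ∃ x ∈ F.Sol (K \ T), ∀ i ∈ T, ∀ j, x (F.var i j) = 0 ↔ F.var i j ∈ Z := by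
  classical
  have kit := hK.kit hT hT0
  obtain ⟨x, hx, hxz⟩ : ∃ x ∈ F.Sol (K \ T), ∀ i ∈ T, ∀ j, F.Touched (K \ T) (F.var i j) →
      (x (F.var i j) = 0 ↔ F.var i j ∈ Z) := by
    by_cases hz : ∃ z ∈ Z, F.Touched T z ∧ F.Touched (K \ T) z
    · obtain ⟨z, hzZ, hzT, hzU⟩ := hz
      obtain ⟨i₀, hi₀, j₀, hj₀⟩ := hzT
      obtain ⟨x, hx, hxz, hx0⟩ := kit.three (fun _ => 0) z 0
        (by rw [← hj₀]; exact not_interior_sdiff hi₀ j₀) (by decide)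
        (Or.inr (Or.inl fun _ _ _ _ => (by decide : (0 : Fin 3) ≠ 2)))
      refine ⟨x, hx, fun i hi j hj => ?_⟩
      by_cases h : F.var i j = z
      · rw [h]; exact ⟨fun _ => hzZ, fun _ => hxz⟩
      · refine ⟨fun h0 => absurd h0 (hx0 _ (not_interior_sdiff hi j) h), fun hjZ => ?_⟩
        exact absurd (hZ _ hjZ _ hzZ ⟨i, hi, j, rfl⟩ ⟨i₀, hi₀, j₀, hj₀⟩ hj hzU) h
    · obtain ⟨x, hx, hx0⟩ := kit.one fun _ => 0
      refine ⟨x, hx, fun i hi j hj => ⟨fun h0 => absurd h0 (hx0 _ (not_interior_sdiff hi j)),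
        fun hjZ => absurd ⟨_, hjZ, ⟨i, hi, j, rfl⟩, hj⟩ hz⟩⟩
  obtain ⟨y, hy, hy1, hy2⟩ := exists_extend hx fun e => if e ∈ Z then 0 else 1
  refine ⟨y, hy, fun i hi j => ?_⟩
  by_cases h : F.Touched (K \ T) (F.var i j)
  · rw [hy2 _ h]; exact hxz i hi j h
  · rw [hy1 _ h]
    split_ifs with h' <;> simp [h']

end

/-! ### Slots of the cycles -/

variable (F) in
/-- A slot of one of the cycles. -/
abbrev Slot : Type _ := Σ i, ZMod (F.len i)

namespace Slot

variable {a b c : F.Slot}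

/-- The variable carried by a slot. -/
def val (a : F.Slot) : ε := F.var a.1 a.2

/-- The slot reached by `d` steps along the cycle. -/
def shift (a : F.Slot) (d : ℤ) : F.Slot := ⟨a.1, a.2 + d⟩

theorem shift_shift (a : F.Slot) (d d' : ℤ) : (a.shift d).shift d' = a.shift (d + d') := by
  simp only [shift, Int.cast_add]
  rw [← add_assoc]
  rfl

theorem shift_zero (a : F.Slot) : a.shift 0 = a := by simp [shift]

theorem shift_fst (a : F.Slot) (d : ℤ) : (a.shift d).1 = a.1 := rfl

theorem shift_eq_iff (a : F.Slot) (d d' : ℤ) :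
    a.shift d = a.shift d' ↔ (F.len a.1 : ℤ) ∣ d - d' := by
  rw [← var_eq_iff a.1 a.2]
  simp [shift]

theorem five_le (a : F.Slot) : 5 ≤ (F.len a.1 : ℤ) := by exact_mod_cast F.five_le a.1

theorem len_cases (a : F.Slot) : (F.len a.1 : ℤ) = 5 ∨ 7 ≤ (F.len a.1 : ℤ) := by
  have := F.five_le a.1
  obtain ⟨c, hc⟩ := F.odd a.1
  omega

theorem shift_ne (a : F.Slot) {d d' : ℤ} (h : d ≠ d') (h1 : d - d' < F.len a.1)
    (h2 : d' - d < F.len a.1) : a.shift d ≠ a.shift d' := by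
  rw [Ne, shift_eq_iff]
  intro hd
  have := Int.eq_zero_of_abs_lt_dvd hd (abs_lt.2 ⟨by omega, h1⟩)
  omega

theorem exists_shift (h : c.1 = a.1) : ∃ d : ℤ, 0 ≤ d ∧ d < F.len a.1 ∧ c = a.shift d := by
  obtain ⟨i, j⟩ := a
  obtain ⟨i', j'⟩ := c
  simp only at h
  subst h
  have : NeZero (F.len i') := ⟨by have := F.five_le i'; omega⟩
  refine ⟨(j' - j).val, by positivity, by exact_mod_cast ZMod.val_lt _, ?_⟩
  simp [shift]

theorem good_of (a : F.Slot) {d : ℤ} (hd : d = 1 ∨ d = -1)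
    (h : Pat x a.val (a.shift d).val (a.shift (2 * d)).val (a.shift (3 * d)).val) :
    Good (F.seq a.1) x := by
  obtain ⟨i, j⟩ := a
  have : NeZero (F.len i) := ⟨by have := F.five_le i; omega⟩
  refine ⟨j.val, ?_⟩
  rcases hd with rfl | rfl
  · exact Or.inl (by simpa [seq, val, shift] using h)
  · exact Or.inr (by simpa [seq, val, shift, sub_eq_add_neg] using h)

/-- Two adjacent slots and at most one further slot have the label `0`; on a cycle of length five
the further slot is not opposite to the pair. -/
theorem good_of_three (a : F.Slot) {d : ℤ} (hd : d = 1 ∨ d = -1) (q : F.Slot)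
    (h : ∀ c : F.Slot, c.1 = a.1 → (x c.val = 0 ↔ c = a ∨ c = a.shift d ∨ c = q))
    (hq : 7 ≤ (F.len a.1 : ℤ) ∨ q ≠ a.shift (3 * d)) : Good (F.seq a.1) x := by
  have h5 := a.five_le
  have h0 : x a.val = 0 := (h a rfl).2 (Or.inl rfl)
  have h1 : x (a.shift d).val = 0 := (h (a.shift d) rfl).2 (Or.inr (Or.inl rfl))
  have ne : ∀ e e' : ℤ, e ≠ e' → e - e' < F.len a.1 → e' - e < F.len a.1 →
      a.shift (e * d) ≠ a.shift (e' * d) := by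
    intro e e' he g1 g2
    rcases hd with rfl | rfl
    · simpa using shift_ne a he g1 g2
    · simpa using shift_ne a (d := -e) (d' := -e') (by omega) (by omega) (by omega)
  have ne0 : ∀ e : ℤ, e ≠ 0 → e < F.len a.1 → -e < F.len a.1 → a.shift (e * d) ≠ a :=
    fun e h1 h2 h3 => by simpa [shift_zero] using ne e 0 h1 (by omega) (by omega)
  have ne1 : ∀ e : ℤ, e ≠ 1 → e - 1 < F.len a.1 → 1 - e < F.len a.1 →
      a.shift (e * d) ≠ a.shift d :=
    fun e h1 h2 h3 => by simpa using ne e 1 h1 (by omega) (by omega)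
  by_cases hside : q = a.shift (2 * d) ∨ q = a.shift (3 * d)
  · -- the side beyond `a` is free
    have e0 : (a.shift d).shift (-d) = a := by rw [shift_shift, add_neg_cancel, shift_zero]
    have e1 : (a.shift d).shift (2 * -d) = a.shift (-1 * d) := by
      rw [shift_shift]; congr 1; ring
    have e2 : (a.shift d).shift (3 * -d) = a.shift (-2 * d) := by
      rw [shift_shift]; congr 1; ring
    refine good_of (a.shift d) (d := -d) (by rcases hd with rfl | rfl <;> simp) (Or.inl ?_)
    rw [e0, e1, e2]
    refine ⟨h1, h0, fun hc => ?_, fun hc => ?_⟩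
    · rcases (h (a.shift (-1 * d)) rfl).1 hc with h' | h' | h'
      · exact ne0 _ (by norm_num) (by omega) (by omega) h'
      · exact ne1 _ (by norm_num) (by omega) (by omega) h'
      · rcases hside with rfl | rfl
        · exact ne _ _ (by norm_num) (by omega) (by omega) h'
        · exact ne _ _ (by norm_num) (by omega) (by omega) h'
    · rcases (h (a.shift (-2 * d)) rfl).1 hc with h' | h' | h'
      · exact ne0 _ (by norm_num) (by omega) (by omega) h'
      · exact ne1 _ (by norm_num) (by omega) (by omega) h'
      · rcases hside with rfl | rfl
        · exact ne _ _ (by norm_num) (by omega) (by omega) h'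
        · have h7 := hq.resolve_right fun h => h rfl
          exact ne _ _ (by norm_num) (by omega) (by omega) h'
  · refine good_of a hd (Or.inl ⟨h0, h1, fun hc => ?_, fun hc => ?_⟩)
    · rcases (h (a.shift (2 * d)) rfl).1 hc with h' | h' | h'
      · exact ne0 _ (by norm_num) (by omega) (by omega) h'
      · exact ne1 _ (by norm_num) (by omega) (by omega) h'
      · exact hside (Or.inl h'.symm)
    · rcases (h (a.shift (3 * d)) rfl).1 hc with h' | h' | h'
      · exact ne0 _ (by norm_num) (by omega) (by omega) h'
      · exact ne1 _ (by norm_num) (by omega) (by omega) h'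
      · exact hside (Or.inr h'.symm)

theorem two_slots' {a b c : F.Slot} (h : a.val = b.val) (h' : b.val = c.val) :
    a = b ∨ b = c ∨ a = c := F.two_slots a b c h h'

end Slot

end CycleFamily

end CubicLabel

/-! ### Cycles with a chord -/

namespace CubicLabel
namespace CycleFamily

variable {I ε : Type*} {F : CycleFamily I ε} {U K : Finset I} {x : ε → Fin 3} {e e' : ε} {i : I}

/-- The map `p` sends every slot of a cycle in `K` to the other slot in `K` with the same variable.
-/
structure Partner (F : CycleFamily I ε) (K : Finset I) (p : F.Slot → F.Slot) : Prop where
  mem : ∀ a, a.1 ∈ K → (p a).1 ∈ K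
  ne : ∀ a, a.1 ∈ K → p a ≠ a
  val : ∀ a, a.1 ∈ K → (p a).val = a.val

theorem IsClosed.exists_partner (hK : F.IsClosed K) : ∃ p, Partner F K p := by
  classical
  have : ∀ a : F.Slot, ∃ b : F.Slot, a.1 ∈ K → b.1 ∈ K ∧ b ≠ a ∧ b.val = a.val := by
    intro a
    by_cases ha : a.1 ∈ K
    · obtain ⟨b, c, hbc, hb, hc, hbe, hce⟩ := hK.interior a.1 ha a.2
      by_cases h : b = a
      · exact ⟨c, fun _ => ⟨hc, fun h' => hbc (h.trans h'.symm), hce⟩⟩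
      · exact ⟨b, fun _ => ⟨hb, h, hbe⟩⟩
    · exact ⟨a, fun h => absurd h ha⟩
  choose p hp using this
  exact ⟨p, fun a ha => (hp a ha).1, fun a ha => (hp a ha).2.1, fun a ha => (hp a ha).2.2⟩

namespace Partner

variable {p : F.Slot → F.Slot} (P : Partner F K p) {a b c : F.Slot} {d : ℤ}
include P

theorem eq_or (ha : a.1 ∈ K) (h : c.val = a.val) : c = a ∨ c = p a := by
  rcases Slot.two_slots' h (P.val a ha).symm with h | h | h
  exacts [Or.inl h, absurd h.symm (P.ne a ha), Or.inr h]

theorem val_eq_iff (ha : a.1 ∈ K) : c.val = a.val ↔ c = a ∨ c = p a := by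
  refine ⟨P.eq_or ha, ?_⟩
  rintro (rfl | rfl)
  exacts [rfl, P.val a ha]

theorem invol (ha : a.1 ∈ K) : p (p a) = a := by
  have h1 := P.mem a ha
  exact (P.eq_or ha ((P.val _ h1).trans (P.val a ha))).resolve_right (P.ne _ h1)

/-- The slots in `Z` and their partners can be made the slots with label `0` on the cycles in `T`,
if at most one slot in `Z` has its partner outside `T`. -/
theorem exists_zero_slots [DecidableEq I] {T : Finset I} (hK : F.IsClosed K) (hT : T ⊆ K)
    (hT0 : T.Nonempty) (Z : Set F.Slot) (hZT : ∀ z ∈ Z, z.1 ∈ T)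
    (hZ : ∀ z ∈ Z, ∀ z' ∈ Z, (p z).1 ∉ T → (p z').1 ∉ T → z = z') :
    ∃ x ∈ F.Sol (K \ T), ∀ c : F.Slot, c.1 ∈ T → (x c.val = 0 ↔ ∃ z ∈ Z, c = z ∨ c = p z) := by
  obtain ⟨x, hx, h⟩ := hK.exists_zero_set hT hT0 (Slot.val '' Z) (by
    rintro _ ⟨z, hz, rfl⟩ _ ⟨z', hz', rfl⟩ - - ⟨i, hi, j, hj⟩ ⟨i', hi', j', hj'⟩
    have h1 : ∀ z ∈ Z, ∀ i ∈ K \ T, ∀ j, F.var i j = z.val → (p z).1 ∉ T := by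
      intro z hz i hi j hj
      rcases P.eq_or (c := ⟨i, j⟩) (hT (hZT z hz)) hj with h | h
      · rw [← h] at hz
        exact absurd (hZT _ hz) (Finset.mem_sdiff.1 hi).2
      · rw [← h]
        exact (Finset.mem_sdiff.1 hi).2
    rw [hZ z hz z' hz' (h1 z hz i hi j hj) (h1 z' hz' i' hi' j' hj')])
  refine ⟨x, hx, fun c hc => (h c.1 hc c.2).trans ?_⟩
  constructor
  · rintro ⟨z, hz, hzc⟩
    exact ⟨z, hz, P.eq_or (hT (hZT z hz)) hzc.symm⟩
  · rintro ⟨z, hz, hzc⟩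
    exact ⟨z, hz, ((P.val_eq_iff (hT (hZT z hz))).2 hzc).symm⟩

/-- A single cycle of the component is settled by the zero slots `Z` and their partners. -/
theorem sol_of_chord (hK : F.IsClosed K) (ha : a.1 ∈ K) (Z : Set F.Slot) (hZT : ∀ z ∈ Z, z.1 = a.1)
    (hZ : ∀ z ∈ Z, ∀ z' ∈ Z, (p z).1 ≠ a.1 → (p z').1 ≠ a.1 → z = z')
    (hg : ∀ x : ε → Fin 3, (∀ c : F.Slot, c.1 = a.1 → (x c.val = 0 ↔ ∃ z ∈ Z, c = z ∨ c = p z)) →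
      Good (F.seq a.1) x) : (F.Sol K).Nonempty := by
  classical
  obtain ⟨x, hx, h⟩ := P.exists_zero_slots hK (T := {a.1}) (by simpa using ha) (by simp) Z
    (by simpa using hZT) (by simpa using hZ)
  exact ⟨x, sol_of_sdiff hx (by simpa using hg x (by simpa using h))⟩

/-- A chord between adjacent slots settles the component. -/
theorem sol_of_adjacent (hK : F.IsClosed K) (ha : a.1 ∈ K) (hd : d = 1 ∨ d = -1)
    (hpa : p a = a.shift d) : (F.Sol K).Nonempty := by
  refine P.sol_of_chord hK ha {a} (by simp) (by rintro z rfl z' rfl _ _; rfl) fun x hx =>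
    a.good_of_three hd a (fun c hc => ?_) (Or.inr ?_)
  · rw [hx c hc]
    simp only [Set.mem_singleton_iff, exists_eq_left, hpa]
    tauto
  · have := a.five_le
    have h := Slot.shift_ne a (d := 0) (d' := 3 * d) (by omega) (by omega) (by omega)
    rwa [Slot.shift_zero] at h

/-- A chord at `a` whose neighbour `a.shift d` has its partner on another cycle. -/
theorem sol_of_chord_neighbour (hK : F.IsClosed K) (ha : a.1 ∈ K) (hd : d = 1 ∨ d = -1)
    (hpa : (p a).1 = a.1) (hm : (p (a.shift d)).1 ≠ a.1)
    (hq : 7 ≤ (F.len a.1 : ℤ) ∨ p a ≠ a.shift (3 * d)) : (F.Sol K).Nonempty := by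
  refine P.sol_of_chord hK ha {a, a.shift d} ?_ ?_ fun x hx =>
    a.good_of_three hd (p a) (fun c hc => ?_) hq
  · rintro z (rfl | rfl) <;> rfl
  · rintro z (rfl | rfl) z' (rfl | rfl) h h'
    exacts [rfl, absurd hpa h, absurd hpa h', rfl]
  · rw [hx c hc]
    have : c ≠ p (a.shift d) := fun h => hm (h ▸ hc)
    simp only [Set.mem_insert_iff, Set.mem_singleton_iff, exists_eq_or_imp, exists_eq_left, this,
      or_false]
    tauto

theorem sol_of_chord_five (hK : F.IsClosed K) (ha : a.1 ∈ K) (hpa : (p a).1 = a.1)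
    (h5 : (F.len a.1 : ℤ) = 5) : (F.Sol K).Nonempty := by
  obtain ⟨e, he0, he5, he⟩ := Slot.exists_shift hpa
  rw [h5] at he5
  have hv : ∀ d d' : ℤ, (5 : ℤ) ∣ d - d' → a.shift d = a.shift d' := fun d d' h => by
    rw [Slot.shift_eq_iff, h5]; exact h
  have he1 : e ≠ 0 := fun h => P.ne a ha (by rw [he, h, Slot.shift_zero])
  -- the middle slot of a chord of span two
  have key : ∀ d : ℤ, (d = 1 ∨ d = -1) → p a = a.shift (2 * d) → (F.Sol K).Nonempty := by
    intro d hd hpd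
    refine P.sol_of_chord_neighbour hK ha hd hpa (fun hm => ?_) (Or.inr ?_)
    · obtain ⟨t, ht0, ht5, ht⟩ := Slot.exists_shift (a := a) hm
      rw [h5] at ht5
      have hval := P.val (a.shift d) ha
      have hval' := P.val a ha
      rw [ht] at hval
      rw [hpd] at hval'
      have n1 : a.shift t ≠ a.shift d := ht ▸ P.ne (a.shift d) ha
      have n2 : a.shift t ≠ a := fun h => by
        have := P.invol (a := a.shift d) ha
        rw [ht, h, hpd, Slot.shift_eq_iff, h5] at this
        rcases hd with rfl | rfl <;> norm_num at this
      have n3 : a.shift t ≠ a.shift (2 * d) := fun h => by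
        have := P.invol (a := a.shift d) ha
        rw [ht, h, ← hpd, P.invol ha] at this
        have h0 := Slot.shift_ne a (d := 0) (d' := d) (by omega) (by omega) (by omega)
        rw [Slot.shift_zero] at h0
        exact h0 this
      have hcr : ∀ s : ℤ, ¬ ((a.shift (s + 1)).val = (a.shift (s + 3)).val ∧
          (a.shift (s + 2)).val = (a.shift (s + 4)).val) := by
        intro s
        have := F.cross a.1 (by exact_mod_cast h5) (a.2 + s)
        simpa [Slot.val, Slot.shift, add_assoc] using this
      have ht' : t = 0 ∨ t = 1 ∨ t = 2 ∨ t = 3 ∨ t = 4 := by omega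
      have e0 : a = a.shift 0 := a.shift_zero.symm
      rcases hd with rfl | rfl
      · rcases ht' with rfl | rfl | rfl | rfl | rfl
        · exact n2 e0.symm
        · exact n1 rfl
        · exact n3 rfl
        · refine hcr (-1) ⟨?_, by norm_num; exact hval.symm⟩
          norm_num [← e0]
          simpa using hval'.symm
        · refine hcr (-2) ⟨?_, ?_⟩
          · rw [hv (-2 + 1) 4 (by norm_num)]; simpa using hval
          · norm_num [← e0]; simpa using hval'.symm
      · rcases ht' with rfl | rfl | rfl | rfl | rfl
        · exact n2 e0.symm
        · refine hcr (-3) ⟨?_, ?_⟩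
          · norm_num [← e0]; simpa using hval'
          · norm_num; exact hval.symm
        · refine hcr (-4) ⟨?_, ?_⟩
          · rw [hv (-4 + 1) 2 (by norm_num)]; norm_num; exact hval
          · norm_num [← e0]; simpa using hval'
        · exact n3 (hv _ _ (by norm_num))
        · exact n1 (hv _ _ (by norm_num))
    · rw [hpd]
      exact Slot.shift_ne a (by omega) (by omega) (by omega)
  have : e = 1 ∨ e = 2 ∨ e = 3 ∨ e = 4 := by omega
  rcases this with rfl | rfl | rfl | rfl
  · exact P.sol_of_adjacent hK ha (Or.inl rfl) he
  · exact key 1 (Or.inl rfl) he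
  · exact key (-1) (Or.inr rfl) (he.trans (hv _ _ (by norm_num)))
  · exact P.sol_of_adjacent hK ha (Or.inr rfl) (he.trans (hv _ _ (by norm_num)))

/-- Two chords, with zero slots `a, p a, b, p b`. -/
theorem sol_of_two_chords (hK : F.IsClosed K) (ha : a.1 ∈ K) {s t u r : ℤ}
    (hps : p (a.shift s) = a.shift t) (hpu : p (a.shift u) = a.shift r) (c : ℤ)
    (hd : d = 1 ∨ d = -1)
    (h0 : c = s ∨ c = t ∨ c = u ∨ c = r) (h1 : c + d = s ∨ c + d = t ∨ c + d = u ∨ c + d = r)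
    (h2 : ∀ e, (e = s ∨ e = t ∨ e = u ∨ e = r) → a.shift (c + 2 * d) ≠ a.shift e)
    (h3 : ∀ e, (e = s ∨ e = t ∨ e = u ∨ e = r) → a.shift (c + 3 * d) ≠ a.shift e) :
    (F.Sol K).Nonempty := by
  refine P.sol_of_chord hK ha {a.shift s, a.shift u} ?_ ?_ fun x hx => ?_
  · rintro z (rfl | rfl) <;> rfl
  · rintro z (rfl | rfl) z' (rfl | rfl) h h'
    · rfl
    · exact absurd (by rw [hps]; rfl) h
    · exact absurd (by rw [hpu]; rfl) h
    · rfl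
  have hx' : ∀ e : ℤ, x (a.shift e).val = 0 ↔ (a.shift e = a.shift s ∨ a.shift e = a.shift t) ∨
      a.shift e = a.shift u ∨ a.shift e = a.shift r := by
    intro e
    rw [hx (a.shift e) rfl]
    simp only [Set.mem_insert_iff, Set.mem_singleton_iff, exists_eq_or_imp, exists_eq_left, hps,
      hpu]
  refine Slot.good_of (a.shift c) hd (Or.inl ?_)
  rw [Slot.shift_shift, Slot.shift_shift, Slot.shift_shift]
  refine ⟨(hx' _).2 ?_, (hx' _).2 ?_, fun h => ?_, fun h => ?_⟩
  · rcases h0 with rfl | rfl | rfl | rfl <;> simp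
  · rcases h1 with h | h | h | h <;> rw [h] <;> simp
  · rcases (hx' _).1 h with (h | h) | h | h
    exacts [h2 _ (by simp) h, h2 _ (by simp) h, h2 _ (by simp) h, h2 _ (by simp) h]
  · rcases (hx' _).1 h with (h | h) | h | h
    exacts [h3 _ (by simp) h, h3 _ (by simp) h, h3 _ (by simp) h, h3 _ (by simp) h]

theorem sol_of_chord_seven_le (hK : F.IsClosed K) (ha : a.1 ∈ K) (hpa : (p a).1 = a.1)
    (h7 : 7 ≤ (F.len a.1 : ℤ)) : (F.Sol K).Nonempty := by
  classical
  -- a chord of minimal span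
  have hex : ∃ l : ℕ, 0 < l ∧ ∃ b : F.Slot, b.1 = a.1 ∧ p b = b.shift l := by
    obtain ⟨e, he0, -, he⟩ := Slot.exists_shift hpa
    have : e ≠ 0 := fun h => P.ne a ha (by rw [he, h, Slot.shift_zero])
    exact ⟨e.toNat, by omega, a, rfl, by rwa [Int.toNat_of_nonneg he0]⟩
  obtain ⟨l, hl0, hmin, b, hb, hpb⟩ : ∃ l : ℤ, 0 < l ∧
      (∀ (c : F.Slot) (t : ℤ), c.1 = a.1 → 0 < t → p c = c.shift t → l ≤ t) ∧
      ∃ b : F.Slot, b.1 = a.1 ∧ p b = b.shift l := by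
    refine ⟨Nat.find hex, by exact_mod_cast (Nat.find_spec hex).1, fun c t hc ht hpc => ?_,
      (Nat.find_spec hex).2⟩
    have := Nat.find_min' hex (m := t.toNat) ⟨by omega, c, hc, by
      rwa [Int.toNat_of_nonneg ht.le]⟩
    omega
  have hbK : b.1 ∈ K := hb ▸ ha
  have h7b : 7 ≤ (F.len b.1 : ℤ) := hb ▸ h7
  -- chords have span at least `l` in both directions
  have span : ∀ s : ℤ, (p (b.shift s)).1 = b.1 → ∃ t : ℤ, p (b.shift s) = b.shift (s + t) ∧
      l ≤ t ∧ t ≤ F.len b.1 - l := by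
    intro s hs
    obtain ⟨t, ht0, htn, ht⟩ := Slot.exists_shift (a := b.shift s) hs
    have hbs : (b.shift s).1 ∈ K := hbK
    have ht0' : t ≠ 0 := fun h => P.ne (b.shift s) hbs (by rw [ht, h, Slot.shift_zero])
    have h1 := hmin (b.shift s) t hb (by omega) ht
    refine ⟨t, by rw [ht, Slot.shift_shift], h1, ?_⟩
    have h2 := hmin ((b.shift s).shift t) (F.len b.1 - t) hb
      (by have : (F.len (b.shift s).1 : ℤ) = F.len b.1 := rfl
          omega) (by
        rw [← ht, P.invol hbs, ht, Slot.shift_shift, Slot.shift_shift, Slot.shift_eq_iff]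
        exact ⟨-1, by ring⟩)
    omega
  have hln : l ≤ F.len b.1 - l := by
    obtain ⟨t, ht, h1, h2⟩ := span 0 (by rw [Slot.shift_zero, hpb]; rfl)
    omega
  have hpb0 : p (b.shift 0) = b.shift l := by rw [Slot.shift_zero, hpb]
  by_cases hl1 : l = 1
  · exact P.sol_of_adjacent hK hbK (Or.inl rfl) (hl1 ▸ hpb)
  by_cases hm : (p (b.shift 1)).1 = b.1
  swap
  · exact P.sol_of_chord_neighbour hK hbK (Or.inl rfl) (by rw [hpb]; rfl) hm (Or.inl h7b)
  obtain ⟨t, ht, ht1, ht2⟩ := span 1 hm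
  by_cases hl2 : l = 2
  · subst hl2
    by_cases ht3 : t = 2 ∨ t = 3
    · refine P.sol_of_two_chords hK hbK hpb0 ht 1 (Or.inr rfl) (by omega) (by omega) ?_ ?_ <;>
        rintro e (rfl | rfl | rfl | rfl) <;> exact Slot.shift_ne b (by omega) (by omega) (by omega)
    · refine P.sol_of_two_chords hK hbK hpb0 ht 1 (Or.inl rfl) (by omega) (by omega) ?_ ?_ <;>
        rintro e (rfl | rfl | rfl | rfl) <;> exact Slot.shift_ne b (by omega) (by omega) (by omega)
  by_cases hl4 : 4 ≤ l
  · refine P.sol_of_two_chords hK hbK hpb0 ht 0 (Or.inl rfl) (by omega) (by omega) ?_ ?_ <;>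
      rintro e (rfl | rfl | rfl | rfl) <;> exact Slot.shift_ne b (by omega) (by omega) (by omega)
  obtain rfl : l = 3 := by omega
  by_cases ht3 : t = F.len b.1 - 3
  swap
  · refine P.sol_of_two_chords hK hbK hpb0 ht 1 (Or.inr rfl) (by omega) (by omega) ?_ ?_ <;>
      rintro e (rfl | rfl | rfl | rfl) <;> exact Slot.shift_ne b (by omega) (by omega) (by omega)
  have ht' : p (b.shift 1) = b.shift (-2) := by
    rw [ht, Slot.shift_eq_iff, ht3]; exact ⟨1, by ring⟩
  by_cases hm2 : (p (b.shift 2)).1 = b.1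
  swap
  · refine P.sol_of_chord_neighbour (a := b.shift 3) hK hbK (Or.inr rfl) ?_ ?_ (Or.inl h7b)
    · rw [← hpb, P.invol hbK, hpb]; rfl
    · rw [Slot.shift_shift]; exact hm2
  obtain ⟨r, hr, hr1, hr2⟩ := span 2 hm2
  by_cases hr3 : r = 3
  · subst hr3
    refine P.sol_of_two_chords hK hbK ht' hr 1 (Or.inl rfl) (by omega) (by omega) ?_ ?_ <;>
      rintro e (rfl | rfl | rfl | rfl) <;> exact Slot.shift_ne b (by omega) (by omega) (by omega)
  · refine P.sol_of_two_chords hK hbK hpb0 hr 2 (Or.inl rfl) (by omega) (by omega) ?_ ?_ <;>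
      rintro e (rfl | rfl | rfl | rfl) <;> exact Slot.shift_ne b (by omega) (by omega) (by omega)

/-- A cycle with a chord settles its component. -/
theorem sol_of_same_cycle (hK : F.IsClosed K) (ha : a.1 ∈ K) (hpa : (p a).1 = a.1) :
    (F.Sol K).Nonempty := by
  rcases a.len_cases with h | h
  exacts [P.sol_of_chord_five hK ha hpa h, P.sol_of_chord_seven_le hK ha hpa h]

end Partner

end CycleFamily

end CubicLabel

/-! ### Loops of cycles -/

namespace CubicLabel
namespace CycleFamily

variable {I ε : Type*} {F : CycleFamily I ε} {U K : Finset I} {x : ε → Fin 3} {e e' : ε} {i : I}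

/-- A closed sequence of `k + 1` different cycles: it leaves the `l`-th cycle at the slot `b l`, and
enters the next one at the partner of `b l`, which is adjacent to the next exit. -/
structure IsLoop (K : Finset I) (p : F.Slot → F.Slot) (k : ℕ) (b : ℕ → F.Slot) : Prop where
  mem : ∀ l ≤ k, (b l).1 ∈ K
  inj : ∀ l ≤ k, ∀ l' ≤ k, (b l).1 = (b l').1 → l = l'
  step : ∀ l < k, ∃ d : ℤ, (d = 1 ∨ d = -1) ∧ b (l + 1) = (p (b l)).shift d
  close : (p (b k)).1 = (b 0).1

namespace Partner

variable {p : F.Slot → F.Slot} (P : Partner F K p) {a b c : F.Slot} {d d' : ℤ}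
include P

/-- Following the cycles through partners, one eventually returns to a cycle. -/
theorem exists_loop (hi : i ∈ K) : ∃ k b, IsLoop K p k b := by
  classical
  let b : ℕ → F.Slot := fun l => (fun a => (p a).shift 1)^[l] ⟨i, 0⟩
  have hb : ∀ l, b (l + 1) = (p (b l)).shift 1 := fun l => Function.iterate_succ_apply' _ _ _
  have hbK : ∀ l, (b l).1 ∈ K := by
    intro l
    induction l with
    | zero => exact hi
    | succ l ih => rw [hb]; exact P.mem _ ih
  have hex : ∃ m, ∃ l < m, (b l).1 = (b m).1 := by
    obtain ⟨m, l, hne, h⟩ := Finite.exists_ne_map_eq_of_infinite fun l : ℕ => (⟨(b l).1, hbK l⟩ : K)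
    have h' : (b m).1 = (b l).1 := congrArg Subtype.val h
    rcases lt_or_gt_of_ne hne with hlt | hlt
    exacts [⟨l, m, hlt, h'⟩, ⟨m, l, hlt, h'.symm⟩]
  obtain ⟨l, hl, hlm⟩ := Nat.find_spec hex
  obtain ⟨m, hm⟩ : ∃ m, m = Nat.find hex := ⟨_, rfl⟩
  rw [← hm] at hl hlm
  have hmin : ∀ l' m', l' < m' → m' < m → (b l').1 ≠ (b m').1 := fun l' m' h1 h2 h3 =>
    Nat.find_min hex (hm ▸ h2) ⟨l', h1, h3⟩
  refine ⟨m - 1 - l, fun t => b (l + t), fun t _ => hbK _, fun t ht t' ht' h => ?_,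
    fun t _ => ⟨1, Or.inl rfl, hb (l + t)⟩, ?_⟩
  · rcases lt_trichotomy t t' with h' | h' | h'
    · exact absurd h (hmin _ _ (by omega) (by omega))
    · exact h'
    · exact absurd h.symm (hmin _ _ (by omega) (by omega))
  · show (p (b (l + (m - 1 - l)))).1 = (b (l + 0)).1
    rw [add_zero, hlm, show m = l + (m - 1 - l) + 1 by omega, hb]
    simp only [Slot.shift_fst]
    congr 3
    omega

theorem not_touched [DecidableEq I] {T : Finset I} (hT : T ⊆ K) (hc : c.1 ∈ T) (hp : (p c).1 ∈ T) :
    ¬ F.Touched (K \ T) c.val := by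
  rintro ⟨i, hi, j, hj⟩
  rcases P.eq_or (c := ⟨i, j⟩) (hT hc) hj with h | h
  · rw [← h] at hc
    exact (Finset.mem_sdiff.1 hi).2 hc
  · rw [← h] at hp
    exact (Finset.mem_sdiff.1 hi).2 hp

section Special

/-- Two five-cycles linked three times such that the middle link joins the slot between the two
others to the slot opposite to the two others. One slot of the second cycle has to take the value
`2`. -/
theorem sol_of_three_links [DecidableEq I] {T : Finset I} (hK : F.IsClosed K) (hT : T ⊆ K)
    (hTb : ∀ i, i ∈ T ↔ i = b.1 ∨ i = a.1) (hch : ∀ c : F.Slot, c.1 ∈ K → (p c).1 ≠ c.1)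
    (hd : d = 1 ∨ d = -1) (hd' : d' = 1 ∨ d' = -1) (hb5 : (F.len b.1 : ℤ) = 5)
    (ha5 : (F.len a.1 : ℤ) = 5) (hpb : p b = a) (hps : p (b.shift (2 * d)) = a.shift d')
    (hpm : p (b.shift d) = a.shift (3 * d'))
    (hfl : (p (a.shift (2 * d'))).1 ∈ T ∨
      F.Conn (K \ T) (b.shift (-d)).val (a.shift (2 * d')).val ∨
      ¬ (F.Conn (K \ T) (b.shift (3 * d)).val (a.shift (2 * d')).val ∧
        F.Conn (K \ T) (a.shift (-d')).val (a.shift (2 * d')).val)) :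
    (F.Sol K).Nonempty := by
  classical
  have hbT : b.1 ∈ T := (hTb _).2 (Or.inl rfl)
  have haT : a.1 ∈ T := (hTb _).2 (Or.inr rfl)
  have hbK := hT hbT
  have haK := hT haT
  have hab : a.1 ≠ b.1 := hpb ▸ hch b hbK
  have neb : ∀ e e' : ℤ, e ≠ e' → e - e' < 5 → e' - e < 5 → b.shift (e * d) ≠ b.shift (e' * d) := by
    intro e e' he h1 h2
    refine Slot.shift_ne b ?_ ?_ ?_ <;> rcases hd with rfl | rfl <;> omega
  have nea : ∀ e e' : ℤ, e ≠ e' → e - e' < 5 → e' - e < 5 →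
      a.shift (e * d') ≠ a.shift (e' * d') := by
    intro e e' he h1 h2
    refine Slot.shift_ne a ?_ ?_ ?_ <;> rcases hd' with rfl | rfl <;> omega
  -- variables of slots of one cycle are different
  have vne : ∀ c c' : F.Slot, c.1 ∈ K → c.1 = c'.1 → c ≠ c' → c.val ≠ c'.val := by
    intro c c' hc h hne hv
    rcases P.eq_or (c := c') hc hv.symm with h' | h'
    · exact hne h'.symm
    · exact hch c hc (h' ▸ h.symm)
  have vneb : ∀ e e' : ℤ, e ≠ e' → e - e' < 5 → e' - e < 5 →
      (b.shift (e * d)).val ≠ (b.shift (e' * d)).val := fun e e' he h1 h2 =>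
    vne _ _ hbK rfl (neb e e' he h1 h2)
  have vnea : ∀ e e' : ℤ, e ≠ e' → e - e' < 5 → e' - e < 5 →
      (a.shift (e * d')).val ≠ (a.shift (e' * d')).val := fun e e' he h1 h2 =>
    vne _ _ haK rfl (nea e e' he h1 h2)
  have e0b : b.shift (0 * d) = b := by rw [zero_mul, Slot.shift_zero]
  have e1b : b.shift (1 * d) = b.shift d := by rw [one_mul]
  have e0a : a.shift (0 * d') = a := by rw [zero_mul, Slot.shift_zero]
  have e1a : a.shift (1 * d') = a.shift d' := by rw [one_mul]
  have e4a : a.shift (4 * d') = a.shift (-d') := by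
    rw [Slot.shift_eq_iff, ha5]; exact ⟨d', by ring⟩
  have v0 : a.val = b.val := hpb ▸ P.val b hbK
  have v2 : (a.shift d').val = (b.shift (2 * d)).val := hps ▸ P.val _ hbK
  have v1 : (a.shift (3 * d')).val = (b.shift d).val := hpm ▸ P.val _ hbK
  obtain ⟨kit⟩ : Nonempty (PLift (Kit {e | ¬ F.Interior (K \ T) e} (F.Conn (K \ T))
    (F.Sol (K \ T)))) := ⟨⟨hK.kit hT ⟨_, hbT⟩⟩⟩
  have kit := kit.down
  have nin : ∀ c : F.Slot, c.1 ∈ T → ¬ F.Interior (K \ T) c.val := fun c hc =>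
    not_interior_sdiff hc _
  -- touched variables of slots in `T` determine the slot
  have tne : ∀ c c' : F.Slot, c.1 ∈ T → c'.1 ∈ T → c ≠ c' → F.Touched (K \ T) c.val →
      c.val ≠ c'.val := by
    intro c c' hc hc' hne ht hv
    rcases P.eq_or (c := c') (hT hc) hv.symm with h' | h'
    · exact hne h'.symm
    · exact P.not_touched hT hc (h' ▸ hc') ht
  let ψ : ε → Fin 3 := fun e => if e = (b.shift (3 * d)).val then 0 else
    if e = (a.shift (-d')).val then 2 else 1
  let w : ε → Fin 3 := fun e => if e = b.val ∨ e = (b.shift d).val then 0 else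
    if e = (a.shift (2 * d')).val ∨ e = (b.shift (2 * d)).val then 2 else 1
  obtain ⟨x, hx, hx1, hx2⟩ : ∃ x ∈ F.Sol (K \ T),
      (F.Touched (K \ T) (a.shift (2 * d')).val → x (a.shift (2 * d')).val = 2) ∧
      ∀ c : F.Slot, c.1 ∈ T → c.val ≠ (a.shift (2 * d')).val → x c.val ≠ ψ c.val := by
    by_cases ht : F.Touched (K \ T) (a.shift (2 * d')).val
    · have hfl := hfl.resolve_left fun h => P.not_touched (c := a.shift (2 * d')) hT haT h ht
      obtain ⟨x, hx, h1, h2⟩ := kit.three ψ (a.shift (2 * d')).val 2 (nin _ haT) (by decide) (by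
        rcases hfl with h | h
        · have h' : F.Touched (K \ T) (b.shift (-d)).val := by
            rcases h.eq_or_touched with h | h
            exacts [h ▸ ht, h.1]
          refine Or.inl ⟨_, nin (b.shift (-d)) hbT, fun h'' => ?_, h, ?_⟩
          · exact tne (b.shift (-d)) (a.shift (2 * d')) hbT haT
              (fun h => hab (congrArg Sigma.fst h).symm) h' h''
          · have n1 : (b.shift (-d)).val ≠ (b.shift (3 * d)).val := by
              simpa using vneb (-1) 3 (by norm_num) (by norm_num) (by norm_num)
            have n2 : (b.shift (-d)).val ≠ (a.shift (-d')).val :=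
              tne _ _ hbT haT (fun h => hab (congrArg Sigma.fst h).symm) h'
            simp only [ψ, n1, n2, if_false]
        · rw [not_and_or] at h
          rcases h with h | h
          · refine Or.inr (Or.inr fun t ht htne htR => ?_)
            simp only [ψ]
            split_ifs with h1 h2
            exacts [absurd (h1 ▸ htR) h, by decide, by decide]
          · refine Or.inr (Or.inl fun t ht htne htR => ?_)
            simp only [ψ]
            split_ifs with h1 h2
            exacts [by decide, absurd (h2 ▸ htR) h, by decide])
      exact ⟨x, hx, fun _ => h1, fun c hc hne => h2 _ (nin c hc) hne⟩
    · obtain ⟨x, hx, h⟩ := kit.one ψ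
      exact ⟨x, hx, fun h => absurd h ht, fun c hc _ => h _ (nin c hc)⟩
  obtain ⟨y, hy, hy1, hy2⟩ := exists_extend hx w
  have ntb : ¬ F.Touched (K \ T) b.val := P.not_touched hT hbT (by rw [hpb]; exact haT)
  have ntm : ¬ F.Touched (K \ T) (b.shift d).val := P.not_touched hT hbT (by rw [hpm]; exact haT)
  have nts : ¬ F.Touched (K \ T) (b.shift (2 * d)).val :=
    P.not_touched hT hbT (by rw [hps]; exact haT)
  have yb : y b.val = 0 := by rw [hy1 _ ntb]; simp [w]
  have ym : y (b.shift d).val = 0 := by rw [hy1 _ ntm]; simp [w]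
  have ys : y (b.shift (2 * d)).val = 2 := by
    rw [hy1 _ nts]
    have n0 : (b.shift (2 * d)).val ≠ b.val := by
      have := vneb 2 0 (by norm_num) (by norm_num) (by norm_num); rwa [e0b] at this
    have n1 : (b.shift (2 * d)).val ≠ (b.shift d).val := by
      have := vneb 2 1 (by norm_num) (by norm_num) (by norm_num); rwa [e1b] at this
    simp [w, n0, n1]
  have y3 : y (a.shift (2 * d')).val = 2 := by
    by_cases ht : F.Touched (K \ T) (a.shift (2 * d')).val
    · rw [hy2 _ ht, hx1 ht]
    · rw [hy1 _ ht]
      have n0 : (a.shift (2 * d')).val ≠ b.val := by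
        have := vnea 2 0 (by norm_num) (by norm_num) (by norm_num); rwa [e0a, v0] at this
      have n1 : (a.shift (2 * d')).val ≠ (b.shift d).val := by
        have := vnea 2 3 (by norm_num) (by norm_num) (by norm_num); rwa [v1] at this
      simp [w, n0, n1]
  have y5 : y (a.shift (-d')).val ≠ 2 := by
    by_cases ht : F.Touched (K \ T) (a.shift (-d')).val
    · rw [hy2 _ ht]
      have h := hx2 (a.shift (-d')) haT (by
        rw [← e4a]; exact vnea 4 2 (by norm_num) (by norm_num) (by norm_num))
      have hne : (a.shift (-d')).val ≠ (b.shift (3 * d)).val :=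
        tne (a.shift (-d')) (b.shift (3 * d)) haT hbT (fun h => hab
          (congrArg Sigma.fst h : (a.shift (-d')).1 = (b.shift (3 * d)).1)) ht
      simpa [ψ, hne] using h
    · rw [hy1 _ ht]
      have n3 : (a.shift (-d')).val ≠ (a.shift (2 * d')).val := by
        rw [← e4a]; exact vnea 4 2 (by norm_num) (by norm_num) (by norm_num)
      have n4 : (a.shift (-d')).val ≠ (b.shift (2 * d)).val := by
        have := vnea 4 1 (by norm_num) (by norm_num) (by norm_num); rwa [e1a, v2, e4a] at this
      simp only [w, n3, n4, or_self, if_false]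
      split_ifs <;> decide
  have x5 : y (b.shift (3 * d)).val ≠ 0 := by
    by_cases h3 : (b.shift (3 * d)).val = (a.shift (2 * d')).val
    · rw [h3, y3]; decide
    by_cases ht : F.Touched (K \ T) (b.shift (3 * d)).val
    · rw [hy2 _ ht]
      simpa [ψ] using hx2 (b.shift (3 * d)) hbT h3
    · rw [hy1 _ ht]
      have n0 : (b.shift (3 * d)).val ≠ b.val := by
        have := vneb 3 0 (by norm_num) (by norm_num) (by norm_num); rwa [e0b] at this
      have n1 : (b.shift (3 * d)).val ≠ (b.shift d).val := by
        have := vneb 3 1 (by norm_num) (by norm_num) (by norm_num); rwa [e1b] at this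
      simp only [w, n0, n1, or_self, if_false]
      split_ifs <;> decide
  refine ⟨y, sol_of_sdiff hy fun i hi => ?_⟩
  rcases (hTb i).1 hi with rfl | rfl
  · exact b.good_of hd (Or.inl ⟨yb, ym, by rw [ys]; decide, x5⟩)
  · refine (a.shift d').good_of hd' (Or.inr ?_)
    rw [Slot.shift_shift, Slot.shift_shift, Slot.shift_shift, show d' + d' = 2 * d' by ring,
      show d' + 2 * d' = 3 * d' by ring, show d' + 3 * d' = 4 * d' by ring, e4a]
    exact ⟨by rw [v2, ys], y3, by rw [v1, ym]; decide, y5⟩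

end Special

/-- A loop of at least two cycles settles the component, unless the slot `m` next to the first exit
has its partner opposite to the entry and the exit of a five-cycle of the loop. -/
theorem sol_of_loop (hK : F.IsClosed K) (hch : ∀ c : F.Slot, c.1 ∈ K → (p c).1 ≠ c.1) {k : ℕ}
    {b : ℕ → F.Slot} (L : IsLoop K p k b) (hd : d = 1 ∨ d = -1)
    (h0 : 7 ≤ (F.len (b 0).1 : ℤ) ∨ p (b k) ≠ (b 0).shift (3 * d))
    (hm : ∀ l < k, ∀ d' : ℤ, (d' = 1 ∨ d' = -1) → b (l + 1) = (p (b l)).shift d' →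
      7 ≤ (F.len (b (l + 1)).1 : ℤ) ∨ p ((b 0).shift d) ≠ (p (b l)).shift (3 * d')) :
    (F.Sol K).Nonempty := by
  classical
  let T : Finset I := (Finset.range (k + 1)).image fun l => (b l).1
  have hTm : ∀ i, i ∈ T ↔ ∃ l ≤ k, (b l).1 = i := by
    intro i
    simp [T]
  have hT : T ⊆ K := fun i hi => by
    obtain ⟨l, hl, rfl⟩ := (hTm i).1 hi
    exact L.mem l hl
  have hpT : ∀ l ≤ k, (p (b l)).1 ∈ T := by
    intro l hl
    rcases hl.eq_or_lt with rfl | hl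
    · exact (hTm _).2 ⟨0, Nat.zero_le _, L.close.symm⟩
    · obtain ⟨d, -, h⟩ := L.step l hl
      exact (hTm _).2 ⟨l + 1, hl, by rw [h]; rfl⟩
  have hZ : ∀ z : F.Slot, z ∈ {z | (∃ l ≤ k, z = b l) ∨ z = (b 0).shift d} → (p z).1 ∉ T →
      z = (b 0).shift d := by
    rintro z (⟨l, hl, rfl⟩ | rfl) h
    exacts [absurd (hpT l hl) h, rfl]
  obtain ⟨x, hx, hx0⟩ := P.exists_zero_slots hK hT ⟨_, (hTm _).2 ⟨0, Nat.zero_le _, rfl⟩⟩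
    {z | (∃ l ≤ k, z = b l) ∨ z = (b 0).shift d} (by
      rintro z (⟨l, hl, rfl⟩ | rfl)
      exacts [(hTm _).2 ⟨l, hl, rfl⟩, (hTm _).2 ⟨0, Nat.zero_le _, rfl⟩])
    (fun z hz z' hz' h h' => (hZ z hz h).trans (hZ z' hz' h').symm)
  refine ⟨x, sol_of_sdiff hx fun i hi => ?_⟩
  obtain ⟨l, hl, rfl⟩ := (hTm i).1 hi
  -- the slots of the loop on its `l`-th cycle
  have key : ∀ c : F.Slot, c.1 = (b l).1 → (x c.val = 0 ↔
      (∃ l' ≤ k, c = b l' ∨ c = p (b l')) ∨ c = (b 0).shift d ∨ c = p ((b 0).shift d)) := by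
    intro c hc
    rw [hx0 c (by rw [hc]; exact hi)]
    constructor
    · rintro ⟨z, ⟨l', hl', rfl⟩ | rfl, h⟩
      exacts [Or.inl ⟨l', hl', h⟩, Or.inr h]
    · rintro (⟨l', hl', h⟩ | h)
      exacts [⟨_, Or.inl ⟨l', hl', rfl⟩, h⟩, ⟨_, Or.inr rfl, h⟩]
  rcases Nat.eq_zero_or_pos l with rfl | hl0
  · refine (b 0).good_of_three hd (p (b k)) (fun c hc => ?_) h0
    rw [key c hc]
    constructor
    · rintro (⟨l', hl', rfl | rfl⟩ | rfl | rfl)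
      · rw [L.inj l' hl' 0 hl hc]; exact Or.inl rfl
      · rcases hl'.eq_or_lt with rfl | hl'
        · exact Or.inr (Or.inr rfl)
        · obtain ⟨d', -, h⟩ := L.step l' hl'
          have := L.inj (l' + 1) hl' 0 hl (by rw [h]; exact hc)
          omega
      · exact Or.inr (Or.inl rfl)
      · exact absurd hc (hch ((b 0).shift d) (L.mem 0 hl))
    · rintro (rfl | rfl | rfl)
      exacts [Or.inl ⟨0, hl, Or.inl rfl⟩, Or.inr (Or.inl rfl), Or.inl ⟨k, le_rfl, Or.inr rfl⟩]
  · obtain ⟨l, rfl⟩ : ∃ l₁, l = l₁ + 1 := ⟨l - 1, by omega⟩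
    obtain ⟨d', hd', hstep⟩ := L.step l hl
    have hfst : (b (l + 1)).1 = (p (b l)).1 := by rw [hstep]; rfl
    rw [hfst]
    refine (p (b l)).good_of_three hd' (p ((b 0).shift d)) (fun c hc => ?_) ?_
    · rw [key c (hc.trans hfst.symm)]
      constructor
      · rintro (⟨l', hl', rfl | rfl⟩ | rfl | rfl)
        · rw [L.inj l' hl' (l + 1) hl (hc.trans hfst.symm), hstep]; exact Or.inr (Or.inl rfl)
        · rcases hl'.eq_or_lt with rfl | hl'
          · have := L.inj 0 (Nat.zero_le _) (l + 1) hl (L.close.symm.trans (hc.trans hfst.symm))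
            omega
          · obtain ⟨d'', -, h⟩ := L.step l' hl'
            have := L.inj (l' + 1) hl' (l + 1) hl (by rw [h]; exact hc.trans hfst.symm)
            obtain rfl : l' = l := by omega
            exact Or.inl rfl
        · have := L.inj 0 (Nat.zero_le _) (l + 1) hl (hc.trans hfst.symm)
          omega
        · exact Or.inr (Or.inr rfl)
      · rintro (rfl | rfl | rfl)
        · exact Or.inl ⟨l, by omega, Or.inr rfl⟩
        · exact Or.inl ⟨l + 1, hl, Or.inl hstep.symm⟩
        · exact Or.inr (Or.inr rfl)
    · rcases hm l hl d' hd' hstep with h | h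
      · left; rwa [hfst] at h
      · exact Or.inr h

/-- Shortening a loop by a link between the neighbour of the first exit and the `l`-th cycle. -/
theorem shorter_loop {k l : ℕ} {b : ℕ → F.Slot} (L : IsLoop K p k b) (hl : l < k)
    (hd : d = 1 ∨ d = -1) (hq : (p ((b 0).shift d)).1 = (b (l + 1)).1) :
    ∃ b', IsLoop K p (l + 1) b' := by
  refine ⟨fun t => if t = 0 then p ((b 0).shift d) else b (t - 1), fun t ht => ?_,
    fun t ht t' ht' h => ?_, fun t ht => ?_, ?_⟩
  · split_ifs
    exacts [P.mem _ (L.mem 0 (Nat.zero_le _)), L.mem _ (by omega)]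
  · by_cases h0 : t = 0 <;> by_cases h0' : t' = 0
    · omega
    · simp only [h0, h0', if_true, if_false, hq] at h
      have := L.inj _ (by omega) _ (by omega) h
      omega
    · simp only [h0, h0', if_true, if_false, hq] at h
      have := L.inj _ (by omega) _ (by omega) h
      omega
    · simp only [h0, h0', if_false] at h
      have := L.inj _ (by omega) _ (by omega) h
      omega
  · by_cases h0 : t = 0
    · subst h0
      refine ⟨-d, by omega, ?_⟩
      simp only [zero_add, one_ne_zero, if_false, if_true, Nat.sub_self]
      rw [P.invol (a := (b 0).shift d) (L.mem 0 (Nat.zero_le _)), Slot.shift_shift,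
        add_neg_cancel, Slot.shift_zero]
    · obtain ⟨d', hd', h⟩ := L.step (t - 1) (by omega)
      refine ⟨d', hd', ?_⟩
      simp only [h0, if_false, Nat.succ_ne_zero, Nat.add_sub_cancel]
      rw [← h]
      congr 1
      omega
  · obtain ⟨d', hd', h⟩ := L.step l hl
    simp only [Nat.succ_ne_zero, if_false, if_true, Nat.add_sub_cancel, hq]
    rw [h]
    rfl

/-- A component without boundary has a solution: a shortest loop of cycles can be settled by a
neighbour of its first exit, or else the loop consists of two cycles of length five linked three
times. -/
theorem sol_nonempty (hK : F.IsClosed K) (hi : i ∈ K) : (F.Sol K).Nonempty := by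
  classical
  by_contra hne
  have hch : ∀ c : F.Slot, c.1 ∈ K → (p c).1 ≠ c.1 := fun c hc h =>
    hne (P.sol_of_same_cycle hK hc h)
  have hex := P.exists_loop hi
  obtain ⟨k, b, L, hmin⟩ : ∃ k b, IsLoop K p k b ∧ ∀ k' b', IsLoop K p k' b' → k ≤ k' := by
    obtain ⟨b, hb⟩ := Nat.find_spec hex
    exact ⟨_, b, hb, fun k' b' h => Nat.find_min' hex ⟨b', h⟩⟩
  have hb0 := L.mem 0 (Nat.zero_le _)
  have hk : 0 < k := by
    rcases Nat.eq_zero_or_pos k with rfl | h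
    exacts [absurd L.close (hch _ hb0), h]
  have hbk := L.mem k le_rfl
  -- an obstruction at a neighbour of the first exit lies on the last cycle
  have hbad : ∀ d : ℤ, (d = 1 ∨ d = -1) →
      (7 ≤ (F.len (b 0).1 : ℤ) ∨ p (b k) ≠ (b 0).shift (3 * d)) →
      ∃ d' : ℤ, (d' = 1 ∨ d' = -1) ∧ b k = (p (b (k - 1))).shift d' ∧ (F.len (b k).1 : ℤ) = 5 ∧
        p ((b 0).shift d) = (p (b (k - 1))).shift (3 * d') := by
    intro d hd h0
    by_contra hcon
    refine hne (P.sol_of_loop hK hch L hd h0 fun l hl d' hd' hstep => ?_)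
    by_contra h
    rw [not_or, not_not] at h
    obtain ⟨h7, hq⟩ := h
    have hfst : (p ((b 0).shift d)).1 = (b (l + 1)).1 := by rw [hq, hstep]; rfl
    obtain ⟨b', hb'⟩ := P.shorter_loop L hl hd hfst
    obtain rfl : l = k - 1 := by have := hmin _ _ hb'; omega
    rw [show k - 1 + 1 = k by omega] at hstep h7
    exact hcon ⟨d', hd', hstep, by have := (b k).len_cases; omega, hq⟩
  have hne5 : ∀ (a : F.Slot) (d : ℤ), (d = 1 ∨ d = -1) →
      a.shift d ≠ a.shift (3 * d) := fun a d hd =>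
    Slot.shift_ne a (by omega) (by have := a.five_le; omega) (by have := a.five_le; omega)
  rcases (b 0).len_cases with h5 | h7
  · obtain ⟨e, he0, he5, he⟩ := Slot.exists_shift L.close
    rw [h5] at he5
    have hv : ∀ d d' : ℤ, (5 : ℤ) ∣ d - d' → (b 0).shift d = (b 0).shift d' := fun d d' h => by
      rw [Slot.shift_eq_iff, h5]; exact h
    -- the first exit is not the last entry
    have he1 : e ≠ 0 := by
      rintro rfl
      rw [Slot.shift_zero] at he
      obtain ⟨d, hd, h⟩ := L.step 0 hk
      have h1 : b k = p (b 0) := by rw [← he, P.invol hbk]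
      rw [zero_add, ← h1] at h
      have := L.inj 1 (by omega) k le_rfl (by rw [h]; rfl)
      subst this
      have h2 := Slot.shift_ne (b 1) (d := 0) (d' := d) (by omega)
        (by have := (b 1).five_le; omega) (by have := (b 1).five_le; omega)
      rw [Slot.shift_zero] at h2
      exact h2 h
    have hadj : ∀ d : ℤ, (d = 1 ∨ d = -1) → p (b k) ≠ (b 0).shift d := by
      intro d hd hs
      obtain ⟨d', hd', h1, -, h2⟩ := hbad d hd (Or.inr (by rw [hs]; exact hne5 _ _ hd))
      rw [← hs, P.invol hbk, h1] at h2
      exact hne5 _ _ hd' h2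
    obtain ⟨d, hd, hs⟩ : ∃ d : ℤ, (d = 1 ∨ d = -1) ∧ p (b k) = (b 0).shift (2 * d) := by
      have : e = 1 ∨ e = 2 ∨ e = 3 ∨ e = 4 := by omega
      rcases this with rfl | rfl | rfl | rfl
      · exact absurd he (hadj 1 (Or.inl rfl))
      · exact ⟨1, Or.inl rfl, he⟩
      · exact ⟨-1, Or.inr rfl, he.trans (hv _ _ (by norm_num))⟩
      · exact absurd (he.trans (hv _ _ (by norm_num))) (hadj (-1) (Or.inr rfl))
    obtain ⟨d', hd', h1, hk5, h2⟩ := hbad d hd (Or.inr (by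
      rw [hs]; exact Slot.shift_ne _ (by omega) (by omega) (by omega)))
    -- the last cycle and the first cycle form a loop through the slot between entry and exit
    have hloop : IsLoop K p 1 fun t => if t = 0 then b k else (b 0).shift d := by
      refine ⟨fun l hl => ?_, fun l hl l' hl' h => ?_, fun l hl => ?_, ?_⟩
      · by_cases h0 : l = 0
        · simp only [h0, if_true]; exact hbk
        · simp only [h0, if_false]; exact hb0
      · have hk0 : (b k).1 ≠ (b 0).1 := fun h => by
          have := L.inj k le_rfl 0 (Nat.zero_le _) h; omega
        by_cases h0 : l = 0 <;> by_cases h0' : l' = 0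
        · omega
        · simp only [h0, h0', if_true, if_false] at h; exact absurd h hk0
        · simp only [h0, h0', if_true, if_false] at h; exact absurd h.symm hk0
        · omega
      · obtain rfl : l = 0 := by omega
        refine ⟨-d, by omega, ?_⟩
        simp only [zero_add, one_ne_zero, if_false, if_true]
        rw [hs, Slot.shift_shift]
        congr 1; ring
      · simp only [one_ne_zero, if_false, if_true]
        rw [h2, h1]; rfl
    obtain rfl : k = 1 := by have := hmin _ _ hloop; omega
    rw [Nat.sub_self] at h1 h2
    have ha5 : (F.len (p (b 0)).1 : ℤ) = 5 := by rw [h1] at hk5; exact hk5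
    have haK := P.mem _ hb0
    let T : Finset I := {(b 0).1, (p (b 0)).1}
    have hT : T ⊆ K := by
      intro i hi
      simp only [T, Finset.mem_insert, Finset.mem_singleton] at hi
      rcases hi with rfl | rfl
      exacts [hb0, haK]
    have hps : p ((b 0).shift (2 * d)) = (p (b 0)).shift d' := by rw [← hs, P.invol hbk, h1]
    by_cases hc : ((p ((p (b 0)).shift (-d'))).1 ∈ T) ∨
        F.Conn (K \ T) ((b 0).shift (3 * d)).val ((p (b 0)).shift (-d')).val
    · -- the mirror image
      refine hne (P.sol_of_three_links (b := (b 0).shift (2 * d)) (a := (p (b 0)).shift d')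
        (d := -d) (d' := -d') hK hT (fun i => by simp [T, Slot.shift_fst]) hch (by omega) (by omega)
        h5 ha5 hps ?_ ?_ ?_)
      · rw [Slot.shift_shift, Slot.shift_shift]
        simp [Slot.shift_zero]
      · rw [Slot.shift_shift, Slot.shift_shift, show 2 * d + -d = d by ring, h2, Slot.shift_eq_iff,
          ha5]
        exact ⟨d', by ring⟩
      · have e1 : ((p (b 0)).shift d').shift (2 * -d') = (p (b 0)).shift (-d') := by
          rw [Slot.shift_shift]; congr 1; ring
        have e2 : ((b 0).shift (2 * d)).shift (- -d) = (b 0).shift (3 * d) := by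
          rw [Slot.shift_shift]; congr 1; ring
        rw [e1, e2]
        rcases hc with h | h
        exacts [Or.inl h, Or.inr (Or.inl h)]
    · rw [not_or] at hc
      refine hne (P.sol_of_three_links (b := b 0) (a := p (b 0)) (d := d) (d' := d') hK hT
        (fun i => by simp [T]) hch hd hd' h5 ha5 rfl hps h2 (Or.inr (Or.inr fun h => hc.2 ?_)))
      exact (F.conn_equiv _).trans h.1 ((F.conn_equiv _).symm h.2)
  · obtain ⟨d₁, hd₁, h1, hk5, h2⟩ := hbad 1 (Or.inl rfl) (Or.inl h7)
    obtain ⟨d₂, hd₂, h3, -, h4⟩ := hbad (-1) (Or.inr rfl) (Or.inl h7)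
    have h12 : d₁ = d₂ := by
      by_contra h
      rw [h1] at h3
      exact Slot.shift_ne _ h (by have := (p (b (k - 1))).five_le; omega)
        (by have := (p (b (k - 1))).five_le; omega) h3
    rw [h12, ← h4] at h2
    have h5 := congrArg p h2
    rw [P.invol (a := (b 0).shift 1) hb0, P.invol (a := (b 0).shift (-1)) hb0] at h5
    exact Slot.shift_ne (b 0) (by norm_num) (by omega) (by omega) h5

end Partner

/-- Every family of cycles as in `CycleFamily` has a labelling that is good on all cycles of a
finite set. -/
theorem sol_nonempty (F : CycleFamily I ε) (U : Finset I) : (F.Sol U).Nonempty := by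
  classical
  induction U using Finset.strongInduction with
  | H U ih =>
  by_cases hU : ∀ i ∈ U, ∃ e, ¬ F.Interior U e ∧ F.Conn U (F.var i 0) e
  · obtain ⟨x, hx, -⟩ := (F.kit U hU).one fun _ => 0
    exact ⟨x, hx⟩
  push Not at hU
  obtain ⟨i₀, hi₀, hint⟩ := hU
  have hE := F.conn_equiv U
  let K : Finset I := U.filter fun i => F.Conn U (F.var i₀ 0) (F.var i 0)
  have hKU : K ⊆ U := Finset.filter_subset _ _
  have hi₀K : i₀ ∈ K := Finset.mem_filter.2 ⟨hi₀, hE.refl _⟩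
  have hmem : ∀ i ∈ U, ∀ j, F.Conn U (F.var i₀ 0) (F.var i j) → i ∈ K := fun i hi j h =>
    Finset.mem_filter.2 ⟨hi, hE.trans h (conn_var hi _ _)⟩
  have hconn : ∀ i ∈ K, ∀ j, F.Conn U (F.var i₀ 0) (F.var i j) := fun i hi j =>
    hE.trans (Finset.mem_filter.1 hi).2 (conn_var (hKU hi) _ _)
  -- connections of variables of the component stay in the component
  have hsub : ∀ e e', F.Conn U e e' → F.Conn U (F.var i₀ 0) e → F.Conn K e e' := by
    intro e e' h
    rcases conn_or_of_subset (V := K) U h with h | ⟨⟨i, hi, hiK, j, h⟩, -⟩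
    · exact fun _ => h
    · intro h0
      exact absurd (hmem i hi j (hE.trans h0 (h.mono hKU))) hiK
  have hK : F.IsClosed K := by
    refine ⟨fun i hi j => ?_, fun i hi i' hi' => ?_⟩
    · obtain ⟨a, b, hab, ha, hb, hae, hbe⟩ := by_contra fun h => hint (F.var i j) h (hconn i hi j)
      refine ⟨a, b, hab, hmem a.1 ha a.2 ?_, hmem b.1 hb b.2 ?_, hae, hbe⟩
      exacts [hae ▸ hconn i hi j, hbe ▸ hconn i hi j]
    · exact hsub _ _ (hE.trans (hE.symm (hconn i hi 0)) (hconn i' hi' 0)) (hconn i hi 0)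
  obtain ⟨p, P⟩ := hK.exists_partner
  obtain ⟨x, hx⟩ := P.sol_nonempty hK hi₀K
  obtain ⟨y, hy⟩ := ih (U \ K) (Finset.sdiff_ssubset hKU ⟨_, hi₀K⟩)
  refine ⟨fun e => if F.Conn U (F.var i₀ 0) e then x e else y e, fun i hi => ?_⟩
  by_cases h : i ∈ K
  · exact Good.congr (hx i h) fun k => if_pos (hconn i h _)
  · refine Good.congr (hy i (Finset.mem_sdiff.2 ⟨hi, h⟩)) fun k => if_neg fun hc => h ?_
    exact hmem i hi _ hc

end CycleFamily

end CubicLabel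

/-! ### Petersen's theorem with half-edges -/

namespace CubicLabel

section Incidence

variable {V ε : Type*}

/-- A cubic incidence structure on the vertex set `A`: every vertex is incident with exactly three
edges, and every edge has at most two ends. An edge with a single end is a half-edge; half-edges
are used to raise the degree of a vertex to three. -/
structure IsCubic (A : Finset V) (inc : V → Finset ε) : Prop where
  card : ∀ v ∈ A, (inc v).card = 3
  two : ∀ u ∈ A, ∀ v ∈ A, ∀ w ∈ A, ∀ e, e ∈ inc u → e ∈ inc v → e ∈ inc w →
    u = v ∨ v = w ∨ u = w

/-- The edge `e` joins a vertex of `X` to a vertex of `A` outside `X`. -/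
def Crossing (A : Finset V) (inc : V → Finset ε) (X : Finset V) (e : ε) : Prop :=
  (∃ v ∈ X, e ∈ inc v) ∧ ∃ w ∈ A, w ∉ X ∧ e ∈ inc w

/-- At least two edges leave every proper nonempty set of vertices: the structure is connected
and has no bridge. -/
def Bridgeless (A : Finset V) (inc : V → Finset ε) : Prop :=
  ∀ X ⊆ A, X.Nonempty → X ≠ A → ∃ e e', e ≠ e' ∧ Crossing A inc X e ∧ Crossing A inc X e'

open Classical in
/-- Two copies of an incidence structure are glued along their half-edges. The neighbour of
`(v, i)` along `e` is the other end of `e` in the same copy, or `v` in the other copy if `e` is a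
half-edge. -/
noncomputable def nb (inc : V → Finset ε) (x : V × Bool) (e : ε) : V × Bool :=
  if h : ∃ w, w ≠ x.1 ∧ e ∈ inc w then (h.choose, x.2) else (x.1, !x.2)

section Double

variable {inc : V → Finset ε}

lemma nb_eq_flip {x : V × Bool} {e : ε} (h : ∀ w, e ∈ inc w → w = x.1) :
    nb inc x e = (x.1, !x.2) :=
  dif_neg fun ⟨w, hw, he⟩ => hw (h w he)

open Classical in
/-- The darts (vertex–edge incidences) of the doubled structure that start in `Q` and end in `u`. -/
noncomputable def leaving (inc : V → Finset ε) (u Q : Finset (V × Bool)) :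
    Finset (Σ _ : V × Bool, ε) :=
  (Q.sigma fun x => inc x.1).filter fun p => nb inc p.1 p.2 ∈ u

lemma mem_leaving {u Q : Finset (V × Bool)} {p : Σ _ : V × Bool, ε} :
    p ∈ leaving inc u Q ↔ (p.1 ∈ Q ∧ p.2 ∈ inc p.1.1) ∧ nb inc p.1 p.2 ∈ u := by
  simp [leaving]

variable [Fintype V]

lemma nb_eq (h : IsCubic Finset.univ inc) {x : V × Bool} {e : ε} (he : e ∈ inc x.1) {w : V}
    (hw : w ≠ x.1) (hew : e ∈ inc w) : nb inc x e = (w, x.2) := by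
  have hex : ∃ w, w ≠ x.1 ∧ e ∈ inc w := ⟨w, hw, hew⟩
  rw [nb, dif_pos hex]
  obtain ⟨h1, h2⟩ := hex.choose_spec
  rcases h.two _ (Finset.mem_univ _) _ (Finset.mem_univ _) _ (Finset.mem_univ _) e h2 hew he with
    h3 | h3 | h3
  · rw [h3]
  · exact absurd h3 hw
  · exact absurd h3 h1

lemma mem_nb (h : IsCubic Finset.univ inc) {x : V × Bool} {e : ε} (he : e ∈ inc x.1) :
    e ∈ inc (nb inc x e).1 := by
  by_cases hw : ∃ w, w ≠ x.1 ∧ e ∈ inc w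
  · obtain ⟨w, hw, hew⟩ := hw
    rwa [nb_eq h he hw hew]
  · rwa [nb_eq_flip (fun w hew => by_contra fun hn => hw ⟨w, hn, hew⟩)]

lemma nb_nb (h : IsCubic Finset.univ inc) {x : V × Bool} {e : ε} (he : e ∈ inc x.1) :
    nb inc (nb inc x e) e = x := by
  by_cases hw : ∃ w, w ≠ x.1 ∧ e ∈ inc w
  · obtain ⟨w, hw, hew⟩ := hw
    rw [nb_eq h he hw hew, nb_eq h (x := (w, x.2)) hew hw.symm he]
  · have hx : ∀ w, e ∈ inc w → w = x.1 := fun w hew => by_contra fun hn => hw ⟨w, hn, hew⟩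
    rw [nb_eq_flip hx, nb_eq_flip (x := (x.1, !x.2)) hx]
    simp

lemma nb_ne (h : IsCubic Finset.univ inc) {x : V × Bool} {e : ε} (he : e ∈ inc x.1) :
    nb inc x e ≠ x := by
  by_cases hw : ∃ w, w ≠ x.1 ∧ e ∈ inc w
  · obtain ⟨w, hw, hew⟩ := hw
    rw [nb_eq h he hw hew]
    exact fun hn => hw (congrArg Prod.fst hn)
  · rw [nb_eq_flip (fun w hew => by_contra fun hn => hw ⟨w, hn, hew⟩)]
    intro hn
    simpa using congrArg Prod.snd hn

/-- The darts that stay in `Q` are paired up by reversal. -/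
lemma odd_card_leaving (h : IsCubic Finset.univ inc) {u Q : Finset (V × Bool)} (hQ : Odd Q.card)
    (hd : Disjoint Q u) (hcl : ∀ x ∈ Q, ∀ e ∈ inc x.1, nb inc x e ∉ u → nb inc x e ∈ Q) :
    Odd (leaving inc u Q).card := by
  classical
  have hstay : Even ((Q.sigma fun x => inc x.1).filter fun p => ¬ nb inc p.1 p.2 ∈ u).card := by
    rw [← ZMod.natCast_eq_zero_iff_even, Finset.card_eq_sum_ones, Nat.cast_sum]
    refine Finset.sum_involution (fun p _ => ⟨nb inc p.1 p.2, p.2⟩) ?_ ?_ ?_ ?_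
    · intro p _; decide
    · intro p hp _ heq
      simp only [Finset.mem_filter, Finset.mem_sigma] at hp
      exact nb_ne h hp.1.2 (congrArg Sigma.fst heq)
    · intro p hp
      simp only [Finset.mem_filter, Finset.mem_sigma] at hp ⊢
      refine ⟨⟨hcl _ hp.1.1 _ hp.1.2 hp.2, mem_nb h hp.1.2⟩, ?_⟩
      rw [nb_nb h hp.1.2]
      exact Finset.disjoint_left.1 hd hp.1.1
    · intro p hp
      simp only [Finset.mem_filter, Finset.mem_sigma] at hp
      exact Sigma.ext (nb_nb h hp.1.2) HEq.rfl
  have htot : (Q.sigma fun x => inc x.1).card = 3 * Q.card := by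
    rw [Finset.card_sigma, Finset.sum_congr rfl fun x _ => h.card x.1 (Finset.mem_univ _)]
    simp [mul_comm]
  have hsum := Finset.card_filter_add_card_filter_not (s := Q.sigma fun x => inc x.1)
    (fun p => nb inc p.1 p.2 ∈ u)
  rw [htot] at hsum
  have hodd : Odd (3 * Q.card) := (by decide : Odd 3).mul hQ
  rw [← hsum] at hodd
  exact (Nat.odd_add.1 hodd).2 hstay

/-- A set of the doubled structure with a single leaving dart consists of one of the two copies:
otherwise it meets a copy in a proper nonempty subset, and two edges leave that subset. -/
lemma eq_slice_of_card_leaving_eq_one (h : IsCubic Finset.univ inc)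
    (hb : Bridgeless Finset.univ inc) {u Q : Finset (V × Bool)} (hQ : Odd Q.card)
    (hcl : ∀ x ∈ Q, ∀ e ∈ inc x.1, nb inc x e ∉ u → nb inc x e ∈ Q)
    (hL : (leaving inc u Q).card = 1) : ∃ i : Bool, ∀ x, x ∈ Q ↔ x.2 = i := by
  classical
  have key : ∀ i : Bool, (∀ v, (v, i) ∉ Q) ∨ ∀ v, (v, i) ∈ Q := by
    intro i
    by_contra! hc
    obtain ⟨⟨v, hv⟩, w, hw⟩ := hc
    let X : Finset V := Finset.univ.filter fun v => (v, i) ∈ Q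
    have hX : ∀ v, v ∈ X ↔ (v, i) ∈ Q := fun v => by simp [X]
    obtain ⟨e, e', hne, h1, h2⟩ := hb X (Finset.subset_univ _) ⟨v, (hX v).2 hv⟩
      fun hn => hw ((hX w).1 (hn ▸ Finset.mem_univ w))
    have hleave : ∀ e, Crossing Finset.univ inc X e → ∃ v, (⟨(v, i), e⟩ : Σ _ : V × Bool, ε) ∈
        leaving inc u Q := by
      rintro e ⟨⟨a, ha, hea⟩, b, -, hb, heb⟩
      rw [hX] at ha hb
      have hab : b ≠ a := by rintro rfl; exact hb ha
      have hnb := nb_eq h (x := (a, i)) hea hab heb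
      refine ⟨a, mem_leaving.2 ⟨⟨ha, hea⟩, ?_⟩⟩
      by_contra hu
      have := hcl _ ha e hea hu
      rw [hnb] at this
      exact hb this
    obtain ⟨a, ha⟩ := hleave e h1
    obtain ⟨b, hb⟩ := hleave e' h2
    obtain ⟨p, hp⟩ := Finset.card_eq_one.1 hL
    rw [hp, Finset.mem_singleton] at ha hb
    exact hne (congrArg Sigma.snd (ha.trans hb.symm))
  rcases key false with h0 | h0 <;> rcases key true with h1 | h1
  · exfalso
    have : Q = ∅ := Finset.eq_empty_of_forall_notMem fun ⟨v, i⟩ => by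
      cases i; exacts [h0 v, h1 v]
    simp [this] at hQ
  · exact ⟨true, fun ⟨v, i⟩ => by cases i <;> simp [h0, h1]⟩
  · exact ⟨false, fun ⟨v, i⟩ => by cases i <;> simp [h0, h1]⟩
  · exfalso
    have : Q = Finset.univ := Finset.eq_univ_of_forall fun ⟨v, i⟩ => by
      cases i; exacts [h0 v, h1 v]
    rw [this, Finset.card_univ, Fintype.card_prod, Fintype.card_bool] at hQ
    exact Nat.not_even_iff_odd.2 hQ ⟨_, mul_two _⟩

/-- Tutte's condition for the doubled structure: removing `u` leaves at most `|u|` odd pieces.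
All pieces but at most one send at least three darts to `u`. -/
lemma card_odd_pieces_le (h : IsCubic Finset.univ inc) (hb : Bridgeless Finset.univ inc)
    {ι : Type*} [Fintype ι] (u : Finset (V × Bool)) (Q : ι → Finset (V × Bool))
    (hQ : ∀ c, Odd (Q c).card) (hd : ∀ c, Disjoint (Q c) u)
    (hdis : ∀ c c' x, x ∈ Q c → x ∈ Q c' → c = c')
    (hcl : ∀ c, ∀ x ∈ Q c, ∀ e ∈ inc x.1, nb inc x e ∉ u → nb inc x e ∈ Q c) :
    Fintype.card ι ≤ u.card := by
  classical
  have hodd := fun c => odd_card_leaving h (hQ c) (hd c) (hcl c)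
  have hsum : ∑ c, (leaving inc u (Q c)).card ≤ 3 * u.card := by
    have htot : (u.sigma fun x => inc x.1).card = 3 * u.card := by
      rw [Finset.card_sigma, Finset.sum_congr rfl fun x _ => h.card x.1 (Finset.mem_univ _)]
      simp [mul_comm]
    rw [← htot, ← Finset.card_sigma]
    refine Finset.card_le_card_of_injOn (fun p => ⟨nb inc p.2.1 p.2.2, p.2.2⟩) ?_ ?_
    · rintro ⟨c, p⟩ hp
      rw [Finset.mem_coe, Finset.mem_sigma] at hp ⊢
      obtain ⟨h1, h2⟩ := mem_leaving.1 hp.2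
      exact ⟨h2, mem_nb h h1.2⟩
    · rintro ⟨c, x, e⟩ hp ⟨c', x', e'⟩ hp' heq
      rw [Finset.mem_coe, Finset.mem_sigma] at hp hp'
      obtain ⟨h1, -⟩ := mem_leaving.1 hp.2
      obtain ⟨h1', -⟩ := mem_leaving.1 hp'.2
      have h3 : e = e' := congrArg Sigma.snd heq
      subst h3
      have h4 : nb inc x e = nb inc x' e := congrArg Sigma.fst heq
      have h5 : x = x' := (nb_nb h h1.2).symm.trans
        ((congrArg (fun y => nb inc y e) h4).trans (nb_nb h h1'.2))
      subst h5
      have h6 := hdis c c' x h1.1 h1'.1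
      subst h6
      rfl
  have hone : ∀ c c', (leaving inc u (Q c)).card = 1 → (leaving inc u (Q c')).card = 1 →
      c = c' := by
    intro c c' h1 h1'
    obtain ⟨i, hi⟩ := eq_slice_of_card_leaving_eq_one h hb (hQ c) (hcl c) h1
    obtain ⟨i', hi'⟩ := eq_slice_of_card_leaving_eq_one h hb (hQ c') (hcl c') h1'
    obtain ⟨p, hp⟩ := Finset.card_pos.1 (by rw [h1]; exact one_pos : 0 < (leaving inc u (Q c)).card)
    obtain ⟨-, hpu⟩ := mem_leaving.1 hp
    have hn : (nb inc p.1 p.2).2 ≠ i := fun hn =>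
      Finset.disjoint_left.1 (hd c) ((hi _).2 hn) hpu
    have hn' : (nb inc p.1 p.2).2 ≠ i' := fun hn =>
      Finset.disjoint_left.1 (hd c') ((hi' _).2 hn) hpu
    have hii : i = i' := by
      revert hn hn'
      cases (nb inc p.1 p.2).2 <;> cases i <;> cases i' <;> simp
    exact hdis c c' (p.1.1, i) ((hi _).2 rfl) ((hi' _).2 hii)
  have hlow : ∀ c, 3 ≤ (leaving inc u (Q c)).card +
      if (leaving inc u (Q c)).card = 1 then 2 else 0 := by
    intro c
    obtain ⟨k, hk⟩ := hodd c
    split_ifs <;> omega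
  have hcard : 3 * Fintype.card ι ≤ ∑ c, (leaving inc u (Q c)).card + 2 := by
    calc 3 * Fintype.card ι = ∑ _c : ι, 3 := by simp [mul_comm]
      _ ≤ ∑ c, ((leaving inc u (Q c)).card +
          if (leaving inc u (Q c)).card = 1 then 2 else 0) := Finset.sum_le_sum fun c _ => hlow c
      _ ≤ _ := by
        rw [Finset.sum_add_distrib, add_le_add_iff_left, ← Finset.sum_filter,
          Finset.sum_const, smul_eq_mul]
        have : (Finset.univ.filter fun c => (leaving inc u (Q c)).card = 1).card ≤ 1 :=
          Finset.card_le_one.2 fun a ha b hb =>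
            hone a b (Finset.mem_filter.1 ha).2 (Finset.mem_filter.1 hb).2
        omega
  omega

/-- The simple graph underlying the doubled structure. -/
def doubleGraph (h : IsCubic Finset.univ inc) : SimpleGraph (V × Bool) where
  Adj x y := ∃ e ∈ inc x.1, nb inc x e = y
  symm := ⟨by
    rintro x _ ⟨e, he, rfl⟩
    exact ⟨e, mem_nb h he, nb_nb h he⟩⟩
  loopless := ⟨by
    rintro x ⟨e, he, hx⟩
    exact nb_ne h he hx⟩

lemma exists_isPerfectMatching_doubleGraph (h : IsCubic Finset.univ inc)
    (hb : Bridgeless Finset.univ inc) :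
    ∃ M : (doubleGraph h).Subgraph, M.IsPerfectMatching := by
  classical
  rw [SimpleGraph.tutte]
  intro u hu
  rw [SimpleGraph.IsTutteViolator] at hu
  refine absurd hu (not_lt.2 ?_)
  let K := ((⊤ : (doubleGraph h).Subgraph).deleteVerts u).coe
  let Q : K.oddComponents → Finset (V × Bool) := fun c =>
    (c.1.supp.toFinset).map ⟨Subtype.val, Subtype.val_injective⟩
  have hmem : ∀ c x, x ∈ Q c ↔ ∃ hx : x ∈ ((⊤ : (doubleGraph h).Subgraph).deleteVerts u).verts,
      K.connectedComponentMk ⟨x, hx⟩ = c.1 := by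
    intro c x
    simp only [Q, Finset.mem_map, Set.mem_toFinset, SimpleGraph.ConnectedComponent.mem_supp_iff,
      Function.Embedding.coeFn_mk, Subtype.exists, exists_and_right, exists_eq_right]
  have hverts : ∀ x, x ∈ ((⊤ : (doubleGraph h).Subgraph).deleteVerts u).verts ↔ x ∉ u := by
    intro x; simp
  have := card_odd_pieces_le h hb u.toFinset Q ?_ ?_ ?_ ?_
  · rw [Set.ncard_eq_toFinset_card', Set.ncard_eq_toFinset_card', Set.toFinset_card]
    exact this
  · intro c
    have := c.2
    simp only [Q, Finset.card_map]
    rw [← Set.ncard_eq_toFinset_card']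
    exact c.2
  · intro c
    rw [Finset.disjoint_left]
    intro x hx hxu
    obtain ⟨hx, -⟩ := (hmem c x).1 hx
    exact (hverts x).1 hx (by simpa using hxu)
  · intro c c' x hx hx'
    obtain ⟨_, hx⟩ := (hmem c x).1 hx
    obtain ⟨_, hx'⟩ := (hmem c' x).1 hx'
    exact Subtype.ext (hx.symm.trans hx')
  · intro c x hx e he hn
    obtain ⟨hxv, hx⟩ := (hmem c x).1 hx
    have hn' : nb inc x e ∉ u := by simpa using hn
    refine (hmem c _).2 ⟨(hverts _).2 hn', ?_⟩
    rw [← hx]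
    refine (SimpleGraph.ConnectedComponent.sound (SimpleGraph.Adj.reachable ?_)).symm
    simp only [K, SimpleGraph.Subgraph.coe_adj, SimpleGraph.Subgraph.deleteVerts_adj,
      SimpleGraph.Subgraph.verts_top, Set.mem_univ, true_and, SimpleGraph.Subgraph.top_adj]
    exact ⟨(hverts x).1 hxv, hn', e, he, rfl⟩

/-- **Petersen's theorem** with half-edges: a cubic structure without bridges has a perfect
matching, in which some vertices may be matched by a half-edge. -/
theorem exists_matching_univ (h : IsCubic Finset.univ inc) (hb : Bridgeless Finset.univ inc) :
    ∃ M : Set ε, ∀ v, ∃ e ∈ inc v, e ∈ M ∧ ∀ f ∈ inc v, f ∈ M → f = e := by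
  classical
  obtain ⟨M, hM⟩ := exists_isPerfectMatching_doubleGraph h hb
  rw [SimpleGraph.Subgraph.isPerfectMatching_iff] at hM
  choose p hp hpu using hM
  let S : V → Set ε := fun v => {e | e ∈ inc v ∧ nb inc (v, false) e = p (v, false)}
  have hS : ∀ v, (S v).Nonempty := fun v => by
    obtain ⟨e, he, hpe⟩ := M.adj_sub (hp (v, false))
    exact ⟨e, he, hpe⟩
  -- the ends of a matched edge have the same set of candidates
  have hSS : ∀ v w e, e ∈ S v → e ∈ inc w → S v = S w := by
    intro v w e he hew
    rcases eq_or_ne w v with rfl | hwv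
    · rfl
    have h1 := nb_eq h (x := (v, false)) he.1 hwv hew
    have h2 : p (v, false) = (w, false) := he.2.symm.trans h1
    have h3 : p (w, false) = (v, false) := by
      refine (hpu _ _ ?_).symm
      have := hp (v, false)
      rw [h2] at this
      exact this.symm
    ext f
    simp only [S, Set.mem_ofPred_eq, h2, h3]
    constructor
    · rintro ⟨hf, hn⟩
      have hm := mem_nb h (x := (v, false)) hf
      have hr := nb_nb h (x := (v, false)) hf
      rw [hn] at hm hr
      exact ⟨hm, hr⟩
    · rintro ⟨hf, hn⟩
      have hm := mem_nb h (x := (w, false)) hf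
      have hr := nb_nb h (x := (w, false)) hf
      rw [hn] at hm hr
      exact ⟨hm, hr⟩
  let m : V → ε := fun v => (hS v).some
  have hm : ∀ v, m v ∈ S v := fun v => (hS v).some_mem
  have hmm : ∀ v w, S v = S w → m v = m w := by
    intro v w hvw
    simp only [m]
    congr
  refine ⟨Set.range m, fun v => ⟨m v, (hm v).1, ⟨v, rfl⟩, ?_⟩⟩
  rintro f hf ⟨w, rfl⟩
  exact hmm _ _ (hSS w v (m w) (hm w) hf)

end Double

end Incidence

end CubicLabel

/-! ### Matchings that meet all triangles -/

namespace CubicLabel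

section Triangles

variable {V ε : Type*}

/-- `M` meets the edges at every vertex of `A` in exactly one edge. -/
def IsMatching (A : Finset V) (inc : V → Finset ε) (M : Set ε) : Prop :=
  ∀ v ∈ A, ∃ e ∈ inc v, e ∈ M ∧ ∀ f ∈ inc v, f ∈ M → f = e

lemma exists_isMatching {A : Finset V} {inc : V → Finset ε} (h : IsCubic A inc)
    (hb : Bridgeless A inc) : ∃ M, IsMatching A inc M := by
  classical
  have h' : IsCubic (Finset.univ : Finset A) (fun v => inc v) := by
    refine ⟨fun v _ => h.card v v.2, fun u _ v _ w _ e hu hv hw => ?_⟩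
    rcases h.two u u.2 v v.2 w w.2 e hu hv hw with h1 | h1 | h1
    exacts [.inl (Subtype.ext h1), .inr (.inl (Subtype.ext h1)), .inr (.inr (Subtype.ext h1))]
  have hb' : Bridgeless (Finset.univ : Finset A) (fun v => inc v) := by
    intro X _ hne hX
    have hmem : ∀ v, v ∈ X.map (Function.Embedding.subtype _) ↔ ∃ w ∈ X, w.1 = v := fun v => by
      simp only [Finset.mem_map, Function.Embedding.subtype_apply]
    obtain ⟨e, e', hee, h1, h2⟩ := hb (X.map (Function.Embedding.subtype _))
      (fun v hv => by obtain ⟨w, -, rfl⟩ := (hmem v).1 hv; exact w.2) (by simpa using hne) (by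
        intro hXA
        refine hX (Finset.eq_univ_of_forall fun v => ?_)
        have hv : v.1 ∈ X.map (Function.Embedding.subtype _) := by rw [hXA]; exact v.2
        obtain ⟨w, hw, hwv⟩ := (hmem _).1 hv
        rwa [← Subtype.ext hwv])
    have key : ∀ e, Crossing A inc (X.map (Function.Embedding.subtype _)) e →
        Crossing (Finset.univ : Finset A) (fun v => inc v) X e := by
      rintro e ⟨⟨u, hu, hev⟩, w, hwA, hwX, hew⟩
      obtain ⟨v, hv, rfl⟩ := (hmem u).1 hu
      exact ⟨⟨v, hv, hev⟩, ⟨w, hwA⟩, Finset.mem_univ _, fun hw => hwX ((hmem _).2 ⟨_, hw, rfl⟩),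
        hew⟩
    exact ⟨e, e', hee, key _ h1, key _ h2⟩
  obtain ⟨M, hM⟩ := exists_matching_univ h' hb'
  exact ⟨M, fun v hv => hM ⟨v, hv⟩⟩

variable [DecidableEq ε]

/-- The vertices `a, b, c` form a triangle without parallel edges; `e`, `f`, `g` are the edges
opposite to `a`, `b`, `c`. -/
structure SimpleTriangle (A : Finset V) (inc : V → Finset ε) (a b c : V) (e f g : ε) : Prop where
  ha : a ∈ A
  hb : b ∈ A
  hc : c ∈ A
  ab : a ≠ b
  bc : b ≠ c
  ca : c ≠ a
  he : inc b ∩ inc c = {e}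
  hf : inc c ∩ inc a = {f}
  hg : inc a ∩ inc b = {g}

/-- Every triangle without parallel edges contains an edge of `M`. -/
def HitsTriangles (A : Finset V) (inc : V → Finset ε) (M : Set ε) : Prop :=
  ∀ a b c e f g, SimpleTriangle A inc a b c e f g → e ∈ M ∨ f ∈ M ∨ g ∈ M

namespace SimpleTriangle

variable {A : Finset V} {inc : V → Finset ε} {a b c : V} {e f g : ε}

lemma rotate (T : SimpleTriangle A inc a b c e f g) : SimpleTriangle A inc b c a f g e :=
  ⟨T.hb, T.hc, T.ha, T.bc, T.ca, T.ab, T.hf, T.hg, T.he⟩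

lemma mem_b (T : SimpleTriangle A inc a b c e f g) : e ∈ inc b :=
  Finset.mem_of_mem_inter_left (T.he ▸ Finset.mem_singleton_self e)

lemma mem_c (T : SimpleTriangle A inc a b c e f g) : e ∈ inc c :=
  Finset.mem_of_mem_inter_right (T.he ▸ Finset.mem_singleton_self e)

lemma eq_of_mem (T : SimpleTriangle A inc a b c e f g) {x : ε} (hb : x ∈ inc b)
    (hc : x ∈ inc c) : x = e :=
  Finset.mem_singleton.1 (T.he ▸ Finset.mem_inter.2 ⟨hb, hc⟩)

lemma eq_or_eq_of_mem (T : SimpleTriangle A inc a b c e f g) (h : IsCubic A inc) {v : V}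
    (hv : v ∈ A) (hev : e ∈ inc v) : v = b ∨ v = c := by
  rcases h.two _ hv _ T.hb _ T.hc e hev T.mem_b T.mem_c with h1 | h1 | h1
  exacts [.inl h1, absurd h1 T.bc, .inr h1]

lemma notMem (T : SimpleTriangle A inc a b c e f g) (h : IsCubic A inc) : e ∉ inc a := fun hn => by
  rcases T.eq_or_eq_of_mem h T.ha hn with h1 | h1
  exacts [T.ab h1, T.ca h1.symm]

lemma ne (T : SimpleTriangle A inc a b c e f g) (h : IsCubic A inc) : f ≠ g := fun hn =>
  T.rotate.notMem h (hn ▸ T.rotate.rotate.mem_c)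

lemma exists_third (T : SimpleTriangle A inc a b c e f g) (h : IsCubic A inc) :
    ∃ p, p ≠ f ∧ p ≠ g ∧ inc a = {f, g, p} := by
  have hsub : {f, g} ⊆ inc a := by
    intro x hx
    simp only [Finset.mem_insert, Finset.mem_singleton] at hx
    rcases hx with rfl | rfl
    exacts [T.rotate.mem_c, T.rotate.rotate.mem_b]
  have hcard : (inc a \ {f, g}).card = 1 := by
    rw [Finset.card_sdiff_of_subset hsub, h.card a T.ha, Finset.card_pair (T.ne h)]
  obtain ⟨p, hp⟩ := Finset.card_eq_one.1 hcard
  have hpm : p ∈ inc a \ {f, g} := hp ▸ Finset.mem_singleton_self p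
  simp only [Finset.mem_sdiff, Finset.mem_insert, Finset.mem_singleton, not_or] at hpm
  refine ⟨p, hpm.2.1, hpm.2.2, ?_⟩
  rw [← Finset.sdiff_union_of_subset hsub, hp]
  ext x; simp only [Finset.mem_union, Finset.mem_singleton, Finset.mem_insert]; tauto

/-- A matching outside a simple triangle that selects exactly one of the three edges leaving the
triangle extends to the triangle by the edge opposite to the matched vertex. A triangle that
shares a vertex with `abc` then contains the matched leaving edge or the added edge. -/
lemma lift (T : SimpleTriangle A inc a b c e f g) (h : IsCubic A inc) {M : Set ε}
    (hM : ∀ v ∈ A, v ≠ a → v ≠ b → v ≠ c → ∃ x ∈ inc v, x ∈ M ∧ ∀ y ∈ inc v, y ∈ M → y = x)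
    {p : ε} (hp : p ∈ inc a) (hpf : p ≠ f) (hpg : p ≠ g) (hpM : p ∈ M)
    (huniq : ∀ x, x ∈ inc a ∨ x ∈ inc b ∨ x ∈ inc c → x ≠ e → x ≠ f → x ≠ g → x ∈ M → x = p)
    (hhit : ∀ x y z e f g, (∀ v, v = x ∨ v = y ∨ v = z → v ≠ a ∧ v ≠ b ∧ v ≠ c) →
      SimpleTriangle A inc x y z e f g → e ∈ M ∨ f ∈ M ∨ g ∈ M) :
    ∃ N, IsMatching A inc N ∧ HitsTriangles A inc N := by
  have hpe : p ≠ e := fun hn => T.notMem h (hn ▸ hp)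
  have hpb : p ∉ inc b := fun hn => hpg (T.rotate.rotate.eq_of_mem hp hn)
  have hpc : p ∉ inc c := fun hn => hpf (T.rotate.eq_of_mem hn hp)
  have hef : e ≠ f := T.rotate.rotate.ne h
  have heg : e ≠ g := (T.rotate.ne h).symm
  let N : Set ε := {x | x = e ∨ (x ∈ M ∧ x ≠ e ∧ x ≠ f ∧ x ≠ g)}
  have hout : ∀ v ∈ A, v ≠ a → v ≠ b → v ≠ c → ∀ x ∈ inc v, x ≠ e ∧ x ≠ f ∧ x ≠ g := by
    intro v hv ha hb hc x hx
    refine ⟨?_, ?_, ?_⟩ <;> rintro rfl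
    · rcases T.eq_or_eq_of_mem h hv hx with rfl | rfl
      exacts [hb rfl, hc rfl]
    · rcases T.rotate.eq_or_eq_of_mem h hv hx with rfl | rfl
      exacts [hc rfl, ha rfl]
    · rcases T.rotate.rotate.eq_or_eq_of_mem h hv hx with rfl | rfl
      exacts [ha rfl, hb rfl]
  have hpN : p ∈ N := .inr ⟨hpM, hpe, hpf, hpg⟩
  have heN : e ∈ N := .inl rfl
  refine ⟨N, fun v hv => ?_, ?_⟩
  · by_cases hva : v = a
    · subst hva
      refine ⟨p, hp, hpN, ?_⟩
      rintro x hx (rfl | ⟨hxM, h1, h2, h3⟩)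
      · exact absurd hx (T.notMem h)
      · exact huniq x (.inl hx) h1 h2 h3 hxM
    by_cases hvb : v = b
    · subst hvb
      refine ⟨e, T.mem_b, heN, ?_⟩
      rintro x hx (rfl | ⟨hxM, h1, h2, h3⟩)
      · rfl
      · exact absurd (huniq x (.inr (.inl hx)) h1 h2 h3 hxM ▸ hx) hpb
    by_cases hvc : v = c
    · subst hvc
      refine ⟨e, T.mem_c, heN, ?_⟩
      rintro x hx (rfl | ⟨hxM, h1, h2, h3⟩)
      · rfl
      · exact absurd (huniq x (.inr (.inr hx)) h1 h2 h3 hxM ▸ hx) hpc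
    obtain ⟨x, hx, hxM, hxu⟩ := hM v hv hva hvb hvc
    refine ⟨x, hx, .inr ⟨hxM, hout v hv hva hvb hvc x hx⟩, ?_⟩
    rintro y hy (rfl | ⟨hyM, -⟩)
    · exact absurd rfl (hout v hv hva hvb hvc _ hy).1
    · exact hxu y hy hyM
  have third : ∀ {a b c e f g}, SimpleTriangle A inc a b c e f g → ∀ k ∈ inc a, ∀ k' ∈ inc a,
      k ≠ f → k ≠ g → k' ≠ f → k' ≠ g → k = k' := by
    intro a b c e f g T k hk k' hk' h1 h2 h3 h4
    obtain ⟨q, -, -, hinc⟩ := T.exists_third h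
    rw [hinc] at hk hk'
    simp only [Finset.mem_insert, Finset.mem_singleton, h1, h2, h3, h4, false_or] at hk hk'
    rw [hk, hk']
  have hap : ∀ y ∈ A, y ≠ a → y ≠ b → y ≠ c → ∀ k ∈ inc a, k ∈ inc y → k ∈ N := by
    intro y hy h1 h2 h3 k hk hky
    obtain ⟨-, h4, h5⟩ := hout y hy h1 h2 h3 k hky
    exact third T k hk p hp h4 h5 hpf hpg ▸ hpN
  have hbc : ∀ s t, (s = b ∧ t = c ∨ s = c ∧ t = b) → (∀ k ∈ inc s, k ∈ inc t → k ∈ N) ∧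
      ∀ k ∈ inc s, ∀ k' ∈ inc s, k ≠ e → k ≠ f → k ≠ g → k' ≠ e → k' ≠ f → k' ≠ g → k = k' := by
    rintro s t (⟨rfl, rfl⟩ | ⟨rfl, rfl⟩)
    · exact ⟨fun k h1 h2 => T.eq_of_mem h1 h2 ▸ heN, fun k hk k' hk' h1 h2 h3 h4 h5 h6 =>
        third T.rotate k hk k' hk' h3 h1 h6 h4⟩
    · exact ⟨fun k h1 h2 => T.eq_of_mem h2 h1 ▸ heN, fun k hk k' hk' h1 h2 h3 h4 h5 h6 =>
        third T.rotate.rotate k hk k' hk' h1 h2 h4 h5⟩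
  have key : ∀ x y z e' f' g', SimpleTriangle A inc x y z e' f' g' →
      x = a ∨ x = b ∨ x = c → e' ∈ N ∨ f' ∈ N ∨ g' ∈ N := by
    intro x y z e' f' g' T' hx
    have hxy := T'.ab
    have hyz := T'.bc
    have hzx := T'.ca
    have he1 := T'.mem_b
    have he2 := T'.mem_c
    have hf1 := T'.rotate.mem_b
    have hf2 := T'.rotate.mem_c
    have hg1 := T'.rotate.rotate.mem_b
    have hg2 := T'.rotate.rotate.mem_c
    by_cases hxa : x = a
    · subst hxa
      by_cases h1 : y ≠ b ∧ y ≠ c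
      · exact .inr (.inr (hap y T'.hb hxy.symm h1.1 h1.2 _ hg1 hg2))
      by_cases h2 : z ≠ b ∧ z ≠ c
      · exact .inr (.inl (hap z T'.hc hzx h2.1 h2.2 _ hf2 hf1))
      exact .inl ((hbc y z (by grind)).1 _ he1 he2)
    obtain ⟨t, hst⟩ : ∃ t, x = b ∧ t = c ∨ x = c ∧ t = b := by
      rcases hx with h1 | rfl | rfl
      exacts [absurd h1 hxa, ⟨c, .inl ⟨rfl, rfl⟩⟩, ⟨b, .inr ⟨rfl, rfl⟩⟩]
    obtain ⟨h1, h2⟩ := hbc x t hst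
    by_cases hyt : y = t
    · exact .inr (.inr (h1 _ hg1 (hyt ▸ hg2)))
    by_cases hzt : z = t
    · exact .inr (.inl (h1 _ hf2 (hzt ▸ hf1)))
    by_cases hya : y = a
    · subst hya
      exact .inl (hap z T'.hc hyz.symm (by grind) (by grind) _ he1 he2)
    by_cases hza : z = a
    · subst hza
      exact .inl (hap y T'.hb hyz (by grind) (by grind) _ he2 he1)
    obtain ⟨h3, h4, h5⟩ := hout y T'.hb hya (by grind) (by grind) _ hg2
    obtain ⟨h6, h7, h8⟩ := hout z T'.hc hza (by grind) (by grind) _ hf1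
    exact absurd (h2 _ hf2 _ hg1 h6 h7 h8 h3 h4 h5) (T'.ne h)
  intro x y z e' f' g' T'
  by_cases hx : x = a ∨ x = b ∨ x = c
  · exact key _ _ _ _ _ _ T' hx
  by_cases hy : y = a ∨ y = b ∨ y = c
  · have := key _ _ _ _ _ _ T'.rotate hy; tauto
  by_cases hz : z = a ∨ z = b ∨ z = c
  · have := key _ _ _ _ _ _ T'.rotate.rotate hz; tauto
  have := hhit x y z e' f' g' (by rintro v (rfl | rfl | rfl) <;> tauto) T'
  have ho : ∀ v w x, v ∈ A → x ∈ inc v → v = w → w ≠ a → w ≠ b → w ≠ c → x ∈ M → x ∈ N := by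
    rintro v _ x hv hxv rfl h1 h2 h3 hxM
    exact .inr ⟨hxM, hout v hv h1 h2 h3 x hxv⟩
  rcases this with h1 | h1 | h1
  · exact .inl (ho y y _ T'.hb T'.mem_b rfl (by tauto) (by tauto) (by tauto) h1)
  · exact .inr (.inl (ho z z _ T'.hc T'.rotate.mem_b rfl (by tauto) (by tauto) (by tauto) h1))
  · exact .inr (.inr (ho x x _ T'.ha T'.rotate.rotate.mem_b rfl (by tauto) (by tauto) (by tauto)
      h1))

end SimpleTriangle

variable [DecidableEq V]

/-- The incidences after contracting a triangle `a, b, c` with edges `e, f, g` to the vertex `a`. -/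
def contract (inc : V → Finset ε) (a b c : V) (e f g : ε) : V → Finset ε :=
  Function.update inc a ((inc a ∪ inc b ∪ inc c) \ {e, f, g})

namespace SimpleTriangle

variable {A : Finset V} {inc : V → Finset ε} {a b c : V} {e f g : ε}

lemma mem_contract_self {x : ε} : x ∈ contract inc a b c e f g a ↔
    (x ∈ inc a ∨ x ∈ inc b ∨ x ∈ inc c) ∧ x ≠ e ∧ x ≠ f ∧ x ≠ g := by
  simp only [contract, Function.update_self, Finset.mem_sdiff, Finset.mem_union,
    Finset.mem_insert, Finset.mem_singleton, not_or, or_assoc]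

lemma contract_of_ne {v : V} (hv : v ≠ a) : contract inc a b c e f g v = inc v :=
  Function.update_of_ne hv _ _

lemma mem_contract (T : SimpleTriangle A inc a b c e f g) {v : V} (hv : v ∈ A \ {b, c}) {x : ε}
    (hx : x ∈ contract inc a b c e f g v) :
    ∃ w ∈ A, x ∈ inc w ∧ (if w = b ∨ w = c then a else w) = v := by
  simp only [Finset.mem_sdiff, Finset.mem_insert, Finset.mem_singleton] at hv
  by_cases hva : v = a
  · subst hva
    rcases (mem_contract_self.1 hx).1 with h1 | h1 | h1
    · exact ⟨v, T.ha, h1, if_neg hv.2⟩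
    · exact ⟨b, T.hb, h1, if_pos (.inl rfl)⟩
    · exact ⟨c, T.hc, h1, if_pos (.inr rfl)⟩
  · rw [contract_of_ne hva] at hx
    exact ⟨v, hv.1, hx, if_neg hv.2⟩

lemma mem_contract_of_mem {w : V} {x : ε} (hx : x ∈ inc w) (hxe : x ≠ e) (hxf : x ≠ f)
    (hxg : x ≠ g) : x ∈ contract inc a b c e f g (if w = b ∨ w = c then a else w) := by
  split_ifs with h1
  · refine mem_contract_self.2 ⟨?_, hxe, hxf, hxg⟩
    rcases h1 with rfl | rfl
    exacts [.inr (.inl hx), .inr (.inr hx)]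
  · by_cases hwa : w = a
    · subst hwa
      exact mem_contract_self.2 ⟨.inl hx, hxe, hxf, hxg⟩
    · rwa [contract_of_ne hwa]

lemma isCubic_contract (T : SimpleTriangle A inc a b c e f g) (h : IsCubic A inc) :
    IsCubic (A \ {b, c}) (contract inc a b c e f g) := by
  refine ⟨fun v hv => ?_, ?_⟩
  · by_cases hva : v = a
    · subst hva
      obtain ⟨p, hpf, hpg, hp⟩ := T.exists_third h
      obtain ⟨q, hqg, hqe, hq⟩ := T.rotate.exists_third h
      obtain ⟨r, hre, hrf, hr⟩ := T.rotate.rotate.exists_third h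
      have hef := T.rotate.rotate.ne h
      have heg := T.rotate.ne h
      have hfg := T.ne h
      have hea := T.notMem h
      have hfb := T.rotate.notMem h
      have hgc := T.rotate.rotate.notMem h
      have hbc := fun x => T.eq_of_mem (x := x)
      have hca := fun x => T.rotate.eq_of_mem (x := x)
      have hab := fun x => T.rotate.rotate.eq_of_mem (x := x)
      simp only [hp, hq, hr, Finset.mem_insert, Finset.mem_singleton] at hea hfb hgc hbc hca hab
      have hpq : p ≠ q := fun hn => hpg (hab p (by simp) (by simp [hn]))
      have hqr : q ≠ r := fun hn => hqe (hbc q (by simp) (by simp [hn]))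
      have hrp : r ≠ p := fun hn => hrf (hca r (by simp) (by simp [hn]))
      rw [Finset.card_eq_three]
      refine ⟨p, q, r, hpq, hrp.symm, hqr, ?_⟩
      ext x
      rw [mem_contract_self, hp, hq, hr]
      simp only [Finset.mem_insert, Finset.mem_singleton]
      grind
    · rw [contract_of_ne hva]
      exact h.card v (Finset.mem_sdiff.1 hv).1
  · intro u hu v hv w hw x hxu hxv hxw
    obtain ⟨u', hu', hxu', rfl⟩ := T.mem_contract hu hxu
    obtain ⟨v', hv', hxv', rfl⟩ := T.mem_contract hv hxv
    obtain ⟨w', hw', hxw', rfl⟩ := T.mem_contract hw hxw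
    rcases h.two _ hu' _ hv' _ hw' x hxu' hxv' hxw' with rfl | rfl | rfl
    exacts [.inl rfl, .inr (.inl rfl), .inr (.inr rfl)]

lemma bridgeless_contract (T : SimpleTriangle A inc a b c e f g) (h : IsCubic A inc)
    (hbr : Bridgeless A inc) : Bridgeless (A \ {b, c}) (contract inc a b c e f g) := by
  intro X hXA hne hX
  let φ : V → V := fun v => if v = b ∨ v = c then a else v
  have hφ : ∀ v, v ∉ ({b, c} : Finset V) → φ v = v := by
    intro v hv
    simp only [Finset.mem_insert, Finset.mem_singleton] at hv
    exact if_neg hv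
  have hφA : ∀ v ∈ A, φ v ∈ A \ {b, c} := by
    intro v hv
    simp only [φ]
    split_ifs with h1
    · simp [T.ha, T.ab, T.ca.symm]
    · simpa [hv] using h1
  obtain ⟨v₀, hv₀⟩ := hne
  obtain ⟨w₀, hw₀, hw₀X⟩ : ∃ w ∈ A \ {b, c}, w ∉ X := by
    by_contra! hn
    exact hX (Finset.Subset.antisymm hXA hn)
  have hv₀' := Finset.mem_sdiff.1 (hXA hv₀)
  have hw₀' := Finset.mem_sdiff.1 hw₀
  obtain ⟨x, x', hxx, h1, h2⟩ := hbr (A.filter fun v => φ v ∈ X) (Finset.filter_subset _ _)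
    ⟨v₀, Finset.mem_filter.2 ⟨hv₀'.1, by rwa [hφ _ hv₀'.2]⟩⟩ (by
      intro hn
      have := hn ▸ hw₀'.1
      rw [Finset.mem_filter, hφ _ hw₀'.2] at this
      exact hw₀X this.2)
  have key : ∀ x, Crossing A inc (A.filter fun v => φ v ∈ X) x →
      Crossing (A \ {b, c}) (contract inc a b c e f g) X x := by
    rintro x ⟨⟨v, hv, hxv⟩, w, hw, hwX, hxw⟩
    rw [Finset.mem_filter] at hv hwX
    have hvw : φ w ≠ φ v := fun hn => hwX ⟨hw, hn ▸ hv.2⟩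
    have ha : φ a = a := hφ a (by simp [T.ab, T.ca.symm])
    have hb : φ b = a := if_pos (.inl rfl)
    have hc : φ c = a := if_pos (.inr rfl)
    have hxe : x ≠ e ∧ x ≠ f ∧ x ≠ g := by
      refine ⟨?_, ?_, ?_⟩ <;> rintro rfl <;> apply hvw
      · rcases T.eq_or_eq_of_mem h hv.1 hxv with rfl | rfl <;>
        rcases T.eq_or_eq_of_mem h hw hxw with rfl | rfl <;> simp [hb, hc]
      · rcases T.rotate.eq_or_eq_of_mem h hv.1 hxv with rfl | rfl <;>
        rcases T.rotate.eq_or_eq_of_mem h hw hxw with rfl | rfl <;> simp [ha, hc]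
      · rcases T.rotate.rotate.eq_or_eq_of_mem h hv.1 hxv with rfl | rfl <;>
        rcases T.rotate.rotate.eq_or_eq_of_mem h hw hxw with rfl | rfl <;> simp [ha, hb]
    exact ⟨⟨φ v, hv.2, mem_contract_of_mem hxv hxe.1 hxe.2.1 hxe.2.2⟩, φ w, hφA w hw,
      fun hn => hwX ⟨hw, hn⟩, mem_contract_of_mem hxw hxe.1 hxe.2.1 hxe.2.2⟩
  exact ⟨x, x', hxx, key x h1, key x' h2⟩

end SimpleTriangle

/-- A cubic structure without bridges has a perfect matching that contains an edge of every
triangle without parallel edges. -/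
theorem exists_isMatching_hitsTriangles {A : Finset V} {inc : V → Finset ε} (h : IsCubic A inc)
    (hbr : Bridgeless A inc) : ∃ M, IsMatching A inc M ∧ HitsTriangles A inc M := by
  induction hn : A.card using Nat.strong_induction_on generalizing A inc with
  | _ n ih =>
  by_cases hT : ∃ a b c e f g, SimpleTriangle A inc a b c e f g
  · obtain ⟨a, b, c, e, f, g, T⟩ := hT
    obtain ⟨M, hM, hhit⟩ := ih (A \ {b, c}).card (by
      rw [← hn]
      exact Finset.card_lt_card (Finset.sdiff_ssubset
        (by simp [Finset.insert_subset_iff, T.hb, T.hc])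
        ⟨b, by simp⟩)) (T.isCubic_contract h) (T.bridgeless_contract h hbr) rfl
    obtain ⟨p, hp, hpM, hpu⟩ := hM a (by simp [T.ha, T.ab, T.ca.symm])
    have huniq : ∀ x, x ∈ inc a ∨ x ∈ inc b ∨ x ∈ inc c → x ≠ e → x ≠ f → x ≠ g → x ∈ M →
        x = p := fun x h1 h2 h3 h4 h5 =>
      hpu x (SimpleTriangle.mem_contract_self.2 ⟨h1, h2, h3, h4⟩) h5
    have hM' : ∀ v ∈ A, v ≠ a → v ≠ b → v ≠ c →
        ∃ x ∈ inc v, x ∈ M ∧ ∀ y ∈ inc v, y ∈ M → y = x := by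
      intro v hv h1 h2 h3
      have := hM v (by simp [hv, h2, h3])
      rwa [SimpleTriangle.contract_of_ne h1] at this
    have hhit' : ∀ x y z e f g, (∀ v, v = x ∨ v = y ∨ v = z → v ≠ a ∧ v ≠ b ∧ v ≠ c) →
        SimpleTriangle A inc x y z e f g → e ∈ M ∨ f ∈ M ∨ g ∈ M := by
      intro x y z e' f' g' hv T'
      obtain ⟨hx1, hx2, hx3⟩ := hv x (.inl rfl)
      obtain ⟨hy1, hy2, hy3⟩ := hv y (.inr (.inl rfl))
      obtain ⟨hz1, hz2, hz3⟩ := hv z (.inr (.inr rfl))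
      refine hhit x y z e' f' g' ⟨?_, ?_, ?_, T'.ab, T'.bc, T'.ca, ?_, ?_, ?_⟩
      · simp [T'.ha, hx2, hx3]
      · simp [T'.hb, hy2, hy3]
      · simp [T'.hc, hz2, hz3]
      · rw [SimpleTriangle.contract_of_ne hy1, SimpleTriangle.contract_of_ne hz1, T'.he]
      · rw [SimpleTriangle.contract_of_ne hx1, SimpleTriangle.contract_of_ne hz1, T'.hf]
      · rw [SimpleTriangle.contract_of_ne hx1, SimpleTriangle.contract_of_ne hy1, T'.hg]
    obtain ⟨hp, hpe, hpf, hpg⟩ := SimpleTriangle.mem_contract_self.1 hp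
    rcases hp with hp | hp | hp
    · exact T.lift h hM' hp hpf hpg hpM huniq hhit'
    · exact T.rotate.lift h (fun v hv h1 h2 h3 => hM' v hv h3 h1 h2) hp hpg hpe hpM
        (fun x h1 h2 h3 h4 => huniq x (by tauto) h4 h2 h3)
        fun x y z e f g hv => hhit' x y z e f g fun v hvx => by have := hv v hvx; tauto
    · exact T.rotate.rotate.lift h (fun v hv h1 h2 h3 => hM' v hv h2 h3 h1) hp hpe hpf hpM
        (fun x h1 h2 h3 h4 => huniq x (by tauto) h3 h4 h2)
        fun x y z e f g hv => hhit' x y z e f g fun v hvx => by have := hv v hvx; tauto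
  · obtain ⟨M, hM⟩ := exists_isMatching h hbr
    exact ⟨M, hM, fun a b c e f g T => absurd ⟨a, b, c, e, f, g, T⟩ hT⟩

end Triangles

end CubicLabel

/-! ### Colours of an odd cycle from the labels -/

namespace CubicLabel

section Colors

/-- The colours `a` and `b` are at circular distance at least `3` modulo `11`. -/
def Far (a b : Fin 11) : Prop := 3 ≤ (a - b).val ∧ (a - b).val ≤ 8

instance (a b : Fin 11) : Decidable (Far a b) := inferInstanceAs (Decidable (_ ∧ _))

lemma Far.symm {a b : Fin 11} (h : Far a b) : Far b a := by
  revert a b; decide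

lemma Far.add_right {a b : Fin 11} (h : Far a b) (t : Fin 11) : Far (a + t) (b + t) := by
  rwa [Far, add_sub_add_right_eq_sub]

/-- The labels `0, 1, 2` of the matching edges, read as colours. -/
def label (t : Fin 3) : Fin 11 := Fin.castLE (by decide) t

/-- `col` colours the edges of a cycle whose `k`-th vertex lies on the edges `k` and `k + 1` and on
a matching edge with label `y k`. -/
def IsCycleColoring {n : ℕ} (y : ZMod n → Fin 3) (col : ZMod n → Fin 11) : Prop :=
  ∀ k, Far (col k) (col (k + 1)) ∧ Far (col k) (label (y k)) ∧ Far (col (k + 1)) (label (y k))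

/-- The colours of an odd cycle: `r, s, t` at the places `1, 2, 3`, then `b, a, b, a, …, b`,
and `a` at the place `0`. -/
def cycleColor (r s t a b : Fin 11) (j : ℕ) : Fin 11 :=
  if j = 1 then r else if j = 2 then s else if j = 3 then t else
  if j = 0 then a else if j % 2 = 0 then b else a

lemma isCycleColoring_cycleColor {n : ℕ} (hn : Odd n) (hn5 : 5 ≤ n) {y : ZMod n → Fin 3}
    {r s t a b : Fin 11} (hrs : Far r s) (hst : Far s t) (htb : Far t b) (hba : Far b a)
    (har : Far a r) (ha : ∀ z, Far a (label z)) (hb : ∀ z, Far b (label z))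
    (hr0 : Far r (label (y 0))) (hr1 : Far r (label (y 1)))
    (hs1 : Far s (label (y 1))) (hs2 : Far s (label (y 2)))
    (ht2 : Far t (label (y 2))) (ht3 : Far t (label (y 3))) :
    IsCycleColoring y fun k => cycleColor r s t a b k.val := by
  have : NeZero n := ⟨by omega⟩
  intro k
  obtain ⟨j, hj⟩ : ∃ j, k.val = j := ⟨_, rfl⟩
  have hjn : j < n := hj ▸ k.val_lt
  have hk : k = (j : ZMod n) := by rw [← hj, ZMod.natCast_zmod_val]
  have hnext : (k + 1).val = if j + 1 = n then 0 else j + 1 := by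
    rw [hk, ← Nat.cast_one, ← Nat.cast_add, ZMod.val_natCast]
    split_ifs with h
    · rw [h, Nat.mod_self]
    · exact Nat.mod_eq_of_lt (by omega)
  simp only [hnext, hj]
  obtain ⟨m, hm⟩ := hn
  by_cases h0 : j = 0
  · subst h0
    rw [if_neg (by omega)]
    have hk0 : k = 0 := by rw [hk, Nat.cast_zero]
    subst hk0
    exact ⟨har, ha _, hr0⟩
  by_cases h1 : j = 1
  · subst h1
    rw [if_neg (by omega)]
    have hk0 : k = 1 := by rw [hk, Nat.cast_one]
    subst hk0
    exact ⟨hrs, hr1, hs1⟩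
  by_cases h2 : j = 2
  · subst h2
    rw [if_neg (by omega)]
    have hk0 : k = 2 := by rw [hk, Nat.cast_ofNat]
    subst hk0
    exact ⟨hst, hs2, ht2⟩
  by_cases h3 : j = 3
  · subst h3
    rw [if_neg (by omega)]
    have hk0 : k = 3 := by rw [hk, Nat.cast_ofNat]
    subst hk0
    exact ⟨htb, ht3, hb _⟩
  have hlast : cycleColor r s t a b (if j + 1 = n then 0 else j + 1) =
      if j % 2 = 0 then a else b := by
    by_cases hjn : j + 1 = n
    · rw [if_pos hjn, if_pos (by omega)]
      rfl
    · rw [if_neg hjn, cycleColor, if_neg (by omega), if_neg (by omega), if_neg (by omega),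
        if_neg (by omega)]
      split_ifs <;> first | rfl | omega
  have hcur : cycleColor r s t a b j = if j % 2 = 0 then b else a := by
    rw [cycleColor, if_neg h1, if_neg h2, if_neg h3, if_neg h0]
  rw [hlast, hcur]
  split_ifs
  · exact ⟨hba, hb _, ha _⟩
  · exact ⟨hba.symm, ha _, hb _⟩

lemma exists_isCycleColoring_of_pat {n : ℕ} (hn : Odd n) (hn5 : 5 ≤ n) {y : ZMod n → Fin 3}
    (h : Pat y 0 1 2 3) : ∃ col, IsCycleColoring y col := by
  rcases h with ⟨h0, h1, h2, h3⟩ | ⟨h0, h1, h2, h3⟩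
  · refine ⟨_, isCycleColoring_cycleColor hn hn5 (r := 3) (s := 6) (t := 9) (a := 8) (b := 5)
      (by decide) (by decide) (by decide) (by decide) (by decide) (by decide) (by decide) ?_ ?_ ?_
      ?_ ?_ ?_⟩
    all_goals first | rw [h0] | rw [h1] | skip
    · decide
    · decide
    · decide
    · exact (by decide : ∀ z : Fin 3, Far 6 (label z)) _
    · exact (by decide : ∀ z : Fin 3, z ≠ 0 → Far 9 (label z)) _ h2
    · exact (by decide : ∀ z : Fin 3, z ≠ 0 → Far 9 (label z)) _ h3
  · refine ⟨_, isCycleColoring_cycleColor hn hn5 (r := 10) (s := 7) (t := 4) (a := 5) (b := 8)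
      (by decide) (by decide) (by decide) (by decide) (by decide) (by decide) (by decide) ?_ ?_ ?_
      ?_ ?_ ?_⟩
    all_goals first | rw [h0] | rw [h1] | skip
    · decide
    · decide
    · decide
    · exact (by decide : ∀ z : Fin 3, Far 7 (label z)) _
    · exact (by decide : ∀ z : Fin 3, z ≠ 2 → Far 4 (label z)) _ h2
    · exact (by decide : ∀ z : Fin 3, z ≠ 2 → Far 4 (label z)) _ h3

/-- A cycle with a good labelling is coloured from its pattern: three colours pass the pattern, and
the rest of the cycle alternates between `5` and `8`, which are far from all labels. -/
lemma exists_isCycleColoring {n : ℕ} (hn : Odd n) (hn5 : 5 ≤ n) {y : ZMod n → Fin 3}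
    (h : ∃ k, Pat y k (k + 1) (k + 2) (k + 3) ∨ Pat y k (k - 1) (k - 2) (k - 3)) :
    ∃ col, IsCycleColoring y col := by
  obtain ⟨k, h | h⟩ := h
  · obtain ⟨col, hcol⟩ := exists_isCycleColoring_of_pat hn hn5 (y := fun j => y (k + j)) (by
      simpa [Pat] using h)
    refine ⟨fun j => col (j - k), fun j => ?_⟩
    have := hcol (j - k)
    beta_reduce at this
    rwa [show j - k + 1 = j + 1 - k by ring, show k + (j - k) = j by ring] at this
  · obtain ⟨col, hcol⟩ := exists_isCycleColoring_of_pat hn hn5 (y := fun j => y (k - j)) (by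
      simpa [Pat] using h)
    refine ⟨fun j => col (k + 1 - j), fun j => ?_⟩
    have := hcol (k - j)
    beta_reduce at this
    rw [show k - j + 1 = k + 1 - j by ring, show k - (k - j) = j by ring] at this
    refine ⟨?_, this.2.2, ?_⟩ <;> beta_reduce
    · rw [show k + 1 - (j + 1) = k - j by ring]
      exact this.1.symm
    · rw [show k + 1 - (j + 1) = k - j by ring]
      exact this.2.1

end Colors

end CubicLabel

/-! ### The odd cycles of the 2-factor -/

namespace CubicLabel

section OddCycles

variable {ε : Type*} {G : SimpleGraph ε}

/-- A shortest odd closed walk repeats no vertex: cutting it at a repetition gives two closed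
walks, and one of them is odd. -/
lemma exists_injective_of_odd_closed_walk {u : ε} (w : G.Walk u u) (hw : Odd w.length) :
    ∃ n, Odd n ∧ 3 ≤ n ∧ ∃ f : ZMod n → ε, Function.Injective f ∧
      (∀ k, G.Adj (f k) (f (k + 1))) ∧ ∀ k, G.Reachable u (f k) := by
  induction hn : w.length using Nat.strong_induction_on generalizing u w with
  | _ n ih =>
  by_cases hinj : ∃ i j, i < j ∧ j < n ∧ w.getVert i = w.getVert j
  · obtain ⟨i, j, hij, hjn, heq⟩ := hinj
    have hr : G.Reachable u (w.getVert i) := ⟨w.take i⟩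
    let w₁ : G.Walk (w.getVert i) (w.getVert i) := ((w.drop i).take (j - i)).copy rfl (by
      rw [SimpleGraph.Walk.drop_getVert, Nat.add_sub_cancel' hij.le, heq])
    let w₂ : G.Walk u u := (w.take i).append ((w.drop j).copy heq.symm rfl)
    have h₁ : w₁.length = j - i := by
      simp only [w₁, SimpleGraph.Walk.length_copy, SimpleGraph.Walk.take_length,
        SimpleGraph.Walk.drop_length]
      omega
    have h₂ : w₂.length = i + (n - j) := by
      simp only [w₂, SimpleGraph.Walk.length_append, SimpleGraph.Walk.length_copy,
        SimpleGraph.Walk.take_length, SimpleGraph.Walk.drop_length]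
      omega
    rw [hn] at hw
    rcases Nat.even_or_odd (j - i) with he | ho
    · refine ih w₂.length (by omega) w₂ ?_ rfl
      rw [h₂]
      obtain ⟨a, ha⟩ := he
      obtain ⟨b, hb⟩ := hw
      exact ⟨b - a, by omega⟩
    · obtain ⟨m, h1, h2, f, h3, h4, h5⟩ := ih w₁.length (by omega) w₁ (h₁ ▸ ho) rfl
      exact ⟨m, h1, h2, f, h3, h4, fun k => hr.trans (h5 k)⟩
  · push Not at hinj
    have hpos : 0 < n := by rw [← hn]; exact hw.pos
    have : NeZero n := ⟨hpos.ne'⟩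
    let f : ZMod n → ε := fun k => w.getVert k.val
    have hadj : ∀ k, G.Adj (f k) (f (k + 1)) := by
      intro k
      have hk := w.adj_getVert_succ (i := k.val) (by rw [hn]; exact k.val_lt)
      have hnext : f (k + 1) = w.getVert (k.val + 1) := by
        have hkc : k + 1 = ((k.val + 1 : ℕ) : ZMod n) := by
          rw [Nat.cast_add, ZMod.natCast_zmod_val, Nat.cast_one]
        simp only [f]
        rw [hkc, ZMod.val_natCast]
        by_cases hlast : k.val + 1 = n
        · rw [hlast, Nat.mod_self, SimpleGraph.Walk.getVert_zero, ← hn,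
            SimpleGraph.Walk.getVert_length]
        · have := k.val_lt
          rw [Nat.mod_eq_of_lt (by omega)]
      rw [hnext]
      exact hk
    refine ⟨n, hn ▸ hw, ?_, f, ?_, hadj, fun k => ⟨w.take k.val⟩⟩
    · obtain ⟨m, hm⟩ := hn ▸ hw
      by_contra h3
      obtain rfl : n = 1 := by omega
      exact (hadj 0).ne (congrArg f (Subsingleton.elim _ _))
    · intro a b hab
      refine ZMod.val_injective n ?_
      rcases lt_trichotomy a.val b.val with h | h | h
      · exact absurd hab (hinj _ _ h b.val_lt)
      · exact h
      · exact absurd hab.symm (hinj _ _ h a.val_lt)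

lemma add_one_ne_sub_one {n : ℕ} (h3 : 3 ≤ n) (k : ZMod n) : k + 1 ≠ k - 1 := by
  intro h
  have h2 : ((2 : ℕ) : ZMod n) = 0 := by
    push_cast
    linear_combination h
  rw [ZMod.natCast_eq_zero_iff] at h2
  have := Nat.le_of_dvd (by norm_num) h2
  omega

/-- In a graph of maximum degree two, a component without a proper 2-colouring is an odd cycle. -/
lemma colorable_or_odd_cycle
    (hdeg : ∀ e f g k, G.Adj e f → G.Adj e g → G.Adj e k → f = g ∨ g = k ∨ f = k)
    (c : G.ConnectedComponent) :
    c.toSimpleGraph.Colorable 2 ∨ ∃ n, Odd n ∧ 3 ≤ n ∧ ∃ f : ZMod n → ε, Function.Injective f ∧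
      (∀ k, G.Adj (f k) (f (k + 1))) ∧ (∀ k e, G.Adj (f k) e → e = f (k + 1) ∨ e = f (k - 1)) ∧
      ∀ e, G.connectedComponentMk e = c ↔ ∃ k, f k = e := by
  rw [or_iff_not_imp_left, SimpleGraph.two_colorable_iff_forall_loop_even]
  intro h
  push Not at h
  obtain ⟨u, w, hw⟩ := h
  obtain ⟨n, hn, h3, f, hinj, hadj, hreach⟩ :=
    exists_injective_of_odd_closed_walk (w.map c.toSimpleGraph_hom) (by
      rw [SimpleGraph.Walk.length_map]
      exact Nat.not_even_iff_odd.1 hw)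
  have hnb : ∀ k e, G.Adj (f k) e → e = f (k + 1) ∨ e = f (k - 1) := by
    intro k e he
    have h1 := hadj (k - 1)
    rw [sub_add_cancel] at h1
    rcases hdeg _ _ _ _ (hadj k) h1.symm he with h2 | h2 | h2
    · exact absurd (hinj h2) (add_one_ne_sub_one h3 k)
    · exact .inr h2.symm
    · exact .inl h2.symm
  refine ⟨n, hn, h3, f, hinj, hadj, hnb, fun e => ⟨fun he => ?_, ?_⟩⟩
  · have hu : G.connectedComponentMk u.1 = c := u.2
    have hr : G.Reachable (f 0) e :=
      (hreach 0).symm.trans (SimpleGraph.ConnectedComponent.exact (hu.trans he.symm))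
    obtain ⟨p⟩ := hr
    have key : ∀ {a b : ε}, G.Walk a b → (∃ k, f k = a) → ∃ k, f k = b := by
      intro a b p
      induction p with
      | nil => exact id
      | cons h _ ih =>
        rintro ⟨k, rfl⟩
        rcases hnb k _ h with h1 | h1
        exacts [ih ⟨_, h1.symm⟩, ih ⟨_, h1.symm⟩]
    exact key p ⟨0, rfl⟩
  · rintro ⟨k, rfl⟩
    have hu : G.connectedComponentMk u.1 = c := u.2
    rw [← hu]
    exact (SimpleGraph.ConnectedComponent.sound (hreach k)).symm

end OddCycles

section TwoFactor

variable {V ε : Type*} {A : Finset V} {inc : V → Finset ε} {M : Set ε}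

/-- No two parallel edges have ends with a common neighbour: the structure does not contain three
parallel edges one of which is subdivided. -/
def SubdividedThetaFree (A : Finset V) (inc : V → Finset ε) : Prop :=
  ∀ a ∈ A, ∀ b ∈ A, ∀ c ∈ A, a ≠ b → b ≠ c → c ≠ a → ∀ e f g k, e ≠ f → e ∈ inc a → e ∈ inc b →
    f ∈ inc a → f ∈ inc b → g ∈ inc a → g ∈ inc c → k ∈ inc c → k ∈ inc b → False

/-- The structure does not contain `K₄` with one edge subdivided. -/
def SubdividedK4Free (A : Finset V) (inc : V → Finset ε) : Prop :=
  ∀ v : Fin 5 → V, Function.Injective v → (∀ k, v k ∈ A) →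
    (∀ p ∈ [(0, 2), (0, 3), (1, 2), (1, 3), (2, 3), (0, 4), ((4, 1) : Fin 5 × Fin 5)],
      ∃ e, e ∈ inc (v p.1) ∧ e ∈ inc (v p.2)) → False

/-- The line graph of the 2-factor that remains when the matching `M` is removed. -/
def factorGraph (A : Finset V) (inc : V → Finset ε) (M : Set ε) : SimpleGraph ε where
  Adj e f := e ≠ f ∧ e ∉ M ∧ f ∉ M ∧ ∃ v ∈ A, e ∈ inc v ∧ f ∈ inc v
  symm := ⟨fun _ _ ⟨h1, h2, h3, v, hv, h4, h5⟩ => ⟨h1.symm, h3, h2, v, hv, h5, h4⟩⟩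
  loopless := ⟨fun _ h => h.1 rfl⟩

lemma IsMatching.eq_of_notMem (hM : IsMatching A inc M) (h : IsCubic A inc) {v : V} (hv : v ∈ A)
    {e f g : ε} (he : e ∈ inc v) (hf : f ∈ inc v) (hg : g ∈ inc v) (heM : e ∉ M) (hfM : f ∉ M)
    (hgM : g ∉ M) : e = f ∨ f = g ∨ e = g := by
  classical
  obtain ⟨m, hm, hmM, -⟩ := hM v hv
  by_contra! hne
  have hsub : ({m, e, f, g} : Finset ε) ⊆ inc v := by
    intro x hx
    simp only [Finset.mem_insert, Finset.mem_singleton] at hx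
    rcases hx with rfl | rfl | rfl | rfl <;> assumption
  have h4 : ({m, e, f, g} : Finset ε).card = 4 := by
    rw [Finset.card_insert_of_notMem,
      Finset.card_eq_three.2 ⟨e, f, g, hne.1, hne.2.2, hne.2.1, rfl⟩]
    simp only [Finset.mem_insert, Finset.mem_singleton]
    rintro (rfl | rfl | rfl) <;> contradiction
  have := Finset.card_le_card hsub
  rw [h4, h.card v hv] at this
  omega

lemma factorGraph_degree (h : IsCubic A inc) (hM : IsMatching A inc M) (e f g k : ε)
    (hf : (factorGraph A inc M).Adj e f) (hg : (factorGraph A inc M).Adj e g)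
    (hk : (factorGraph A inc M).Adj e k) : f = g ∨ g = k ∨ f = k := by
  obtain ⟨h1, he, hfM, u, hu, heu, hfu⟩ := hf
  obtain ⟨h2, -, hgM, v, hv, hev, hgv⟩ := hg
  obtain ⟨h3, -, hkM, w, hw, hew, hkw⟩ := hk
  rcases h.two u hu v hv w hw e heu hev hew with rfl | rfl | rfl
  · rcases hM.eq_of_notMem h hu heu hfu hgv he hfM hgM with h4 | h4 | h4
    exacts [absurd h4 h1, .inl h4, absurd h4 h2]
  · rcases hM.eq_of_notMem h hv hev hgv hkw he hgM hkM with h4 | h4 | h4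
    exacts [absurd h4 h2, .inr (.inl h4), absurd h4 h3]
  · rcases hM.eq_of_notMem h hu heu hfu hkw he hfM hkM with h4 | h4 | h4
    exacts [absurd h4 h1, .inr (.inr h4), absurd h4 h3]

/-- An odd cycle of the 2-factor: its edges `edge k`, the vertices `vert k` between `edge k` and
`edge (k + 1)`, and the matching edges `mate k` at these vertices. -/
structure FactorCycle (A : Finset V) (inc : V → Finset ε) (M : Set ε) (n : ℕ) where
  edge : ZMod n → ε
  vert : ZMod n → V
  mate : ZMod n → ε
  odd : Odd n
  three_le : 3 ≤ n
  inj : Function.Injective edge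
  notMem : ∀ k, edge k ∉ M
  vert_mem : ∀ k, vert k ∈ A
  left_mem : ∀ k, edge k ∈ inc (vert k)
  right_mem : ∀ k, edge (k + 1) ∈ inc (vert k)
  mate_mem : ∀ k, mate k ∈ inc (vert k)
  mate_matching : ∀ k, mate k ∈ M
  neighbor : ∀ k e, (factorGraph A inc M).Adj (edge k) e → e = edge (k + 1) ∨ e = edge (k - 1)

lemma colorable_or_factorCycle (h : IsCubic A inc) (hM : IsMatching A inc M)
    (c : (factorGraph A inc M).ConnectedComponent) :
    c.toSimpleGraph.Colorable 2 ∨ ∃ n, ∃ C : FactorCycle A inc M n,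
      ∀ e, (factorGraph A inc M).connectedComponentMk e = c ↔ ∃ k, C.edge k = e := by
  rcases colorable_or_odd_cycle (factorGraph_degree h hM) c with hc | ⟨n, hn, h3, f, hinj, hadj,
    hnb, hc⟩
  · exact .inl hc
  right
  choose hne h1 h2 v hv hl hr using hadj
  choose m hm hmM _ using hM
  exact ⟨n, ⟨f, v, fun k => m (v k) (hv k), hn, h3, hinj, h1, hv, hl, hr, fun k => hm _ _,
    fun k => hmM _ _, hnb⟩, hc⟩

namespace FactorCycle

variable {n : ℕ}

lemma add_one_ne (C : FactorCycle A inc M n) (k : ZMod n) : k + 1 ≠ k := by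
  intro h
  have h2 : ((1 : ℕ) : ZMod n) = 0 := by
    push_cast
    linear_combination h
  rw [ZMod.natCast_eq_zero_iff] at h2
  have := Nat.le_of_dvd (by norm_num) h2
  have := C.three_le
  omega

lemma eq_or_eq (C : FactorCycle A inc M n) (h : IsCubic A inc) (hM : IsMatching A inc M)
    {k : ZMod n} {e : ε}
    (he : e ∈ inc (C.vert k)) (heM : e ∉ M) : e = C.edge k ∨ e = C.edge (k + 1) := by
  rcases hM.eq_of_notMem h (C.vert_mem k) he (C.left_mem k) (C.right_mem k) heM (C.notMem _)
    (C.notMem _) with h1 | h1 | h1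
  exacts [.inl h1, absurd (C.inj h1).symm (C.add_one_ne k), .inr h1]

lemma vert_injective (C : FactorCycle A inc M n) (h : IsCubic A inc) (hM : IsMatching A inc M) :
    Function.Injective C.vert := by
  intro j k hjk
  have h1 := C.eq_or_eq h hM (k := k) (hjk ▸ C.left_mem j) (C.notMem _)
  have h2 := C.eq_or_eq h hM (k := k) (hjk ▸ C.right_mem j) (C.notMem _)
  rcases h1 with h1 | h1
  · exact C.inj h1
  rcases h2 with h2 | h2
  · have h1 := C.inj h1
    have h2 := C.inj h2
    refine absurd ?_ (add_one_ne_sub_one C.three_le k)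
    rw [← h1, ← h2]
    ring
  · exact add_right_cancel (C.inj h2)

lemma mate_eq (C : FactorCycle A inc M n) (hM : IsMatching A inc M)
    {k : ZMod n} {e : ε} (he : e ∈ inc (C.vert k))
    (heM : e ∈ M) : e = C.mate k := by
  obtain ⟨m, -, -, hu⟩ := hM _ (C.vert_mem k)
  rw [hu e he heM, hu _ (C.mate_mem k) (C.mate_matching k)]

lemma right_mem_sub (C : FactorCycle A inc M n) (k : ZMod n) : C.edge k ∈ inc (C.vert (k - 1)) := by
  have := C.right_mem (k - 1)
  rwa [sub_add_cancel] at this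

lemma eq_vert_or_eq_vert (C : FactorCycle A inc M n) (h : IsCubic A inc)
    (hM : IsMatching A inc M) {k : ZMod n} {v : V}
    (hv : v ∈ A) (hk : C.edge k ∈ inc v) : v = C.vert k ∨ v = C.vert (k - 1) := by
  rcases h.two _ hv _ (C.vert_mem k) _ (C.vert_mem (k - 1)) _ hk (C.left_mem k)
    (C.right_mem_sub k) with h1 | h1 | h1
  · exact .inl h1
  · have := C.vert_injective h hM h1
    refine absurd ?_ (C.add_one_ne (k - 1))
    rw [sub_add_cancel]
    exact this
  · exact .inr h1

/-- A cycle of length three is a triangle avoiding the matching, so it has parallel edges, and the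
third vertex is adjacent to both of their ends. -/
lemma five_le [DecidableEq ε] (C : FactorCycle A inc M n) (h : IsCubic A inc)
    (hM : IsMatching A inc M) (hT : HitsTriangles A inc M) (hθ : SubdividedThetaFree A inc) :
    5 ≤ n := by
  have hn3 := C.three_le
  obtain ⟨m, hm⟩ := C.odd
  by_contra hn5
  obtain rfl : n = 3 := by omega
  have hv := C.vert_injective h hM
  have h01 : C.vert 0 ≠ C.vert 1 := hv.ne (by decide)
  have h12 : C.vert 1 ≠ C.vert 2 := hv.ne (by decide)
  have h20 : C.vert 2 ≠ C.vert 0 := hv.ne (by decide)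
  have a0 : C.edge 0 ∈ inc (C.vert 0) := C.left_mem 0
  have a1 : C.edge 1 ∈ inc (C.vert 1) := C.left_mem 1
  have a2 : C.edge 2 ∈ inc (C.vert 2) := C.left_mem 2
  have b0 : C.edge 1 ∈ inc (C.vert 0) := C.right_mem 0
  have b1 : C.edge 2 ∈ inc (C.vert 1) := C.right_mem 1
  have b2 : C.edge 0 ∈ inc (C.vert 2) := C.right_mem 2
  have key : ∀ {u v : V} {e : ε}, e ∈ inc u → e ∈ inc v → inc u ∩ inc v ≠ {e} →
      ∃ f, e ≠ f ∧ f ∈ inc u ∧ f ∈ inc v := by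
    intro u v e hu hv hne
    by_contra! hcon
    refine hne (Finset.eq_singleton_iff_unique_mem.2 ⟨Finset.mem_inter.2 ⟨hu, hv⟩, fun x hx => ?_⟩)
    rw [Finset.mem_inter] at hx
    by_contra hxe
    exact hcon x (Ne.symm hxe) hx.1 hx.2
  by_cases e1 : inc (C.vert 1) ∩ inc (C.vert 2) = {C.edge 2}
  · by_cases e2 : inc (C.vert 2) ∩ inc (C.vert 0) = {C.edge 0}
    · by_cases e3 : inc (C.vert 0) ∩ inc (C.vert 1) = {C.edge 1}
      · rcases hT _ _ _ _ _ _ ⟨C.vert_mem 0, C.vert_mem 1, C.vert_mem 2, h01, h12, h20, e1, e2,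
          e3⟩ with h1 | h1 | h1
        exacts [C.notMem _ h1, C.notMem _ h1, C.notMem _ h1]
      · obtain ⟨f, hf, hf1, hf2⟩ := key b0 a1 e3
        exact hθ _ (C.vert_mem 0) _ (C.vert_mem 1) _ (C.vert_mem 2) h01 h12 h20 _ _ _ _ hf b0 a1
          hf1 hf2 a0 b2 a2 b1
    · obtain ⟨f, hf, hf1, hf2⟩ := key b2 a0 e2
      exact hθ _ (C.vert_mem 2) _ (C.vert_mem 0) _ (C.vert_mem 1) h20 h01 h12 _ _ _ _ hf b2 a0
        hf1 hf2 a2 b1 a1 b0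
  · obtain ⟨f, hf, hf1, hf2⟩ := key b1 a2 e1
    exact hθ _ (C.vert_mem 1) _ (C.vert_mem 2) _ (C.vert_mem 0) h12 h20 h01 _ _ _ _ hf b1 a2
      hf1 hf2 a1 b0 a0 b2

/-- A cycle of length five in which two crossing pairs of vertices are matched would be a `K₄`
with a subdivided edge. -/
lemma not_crossing (C : FactorCycle A inc M n) (h : IsCubic A inc) (hM : IsMatching A inc M)
    (hK : SubdividedK4Free A inc) (hn : n = 5) (j : ZMod n) :
    ¬ (C.mate (j + 1) = C.mate (j + 3) ∧ C.mate (j + 2) = C.mate (j + 4)) := by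
  subst hn
  rintro ⟨h13, h24⟩
  have hv := C.vert_injective h hM
  refine hK (fun k => C.vert (j + ![1, 4, 2, 3, 0] k)) ?_ (fun k => C.vert_mem _) ?_
  · intro a b hab
    have := add_left_cancel (hv hab)
    exact (by decide : ∀ a b : Fin 5, (![1, 4, 2, 3, 0] a : ZMod 5) = ![1, 4, 2, 3, 0] b → a = b)
      a b this
  · intro p hp
    simp only [List.mem_cons, List.not_mem_nil, or_false] at hp
    have hadj : ∀ i i' : ZMod 5, i' = i + 1 → ∃ e, e ∈ inc (C.vert (j + i)) ∧
        e ∈ inc (C.vert (j + i')) := by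
      rintro i _ rfl
      refine ⟨_, C.right_mem _, ?_⟩
      rw [← add_assoc]
      exact C.left_mem _
    rcases hp with rfl | rfl | rfl | rfl | rfl | rfl | rfl
    · exact hadj 1 2 (by decide)
    · exact ⟨_, C.mate_mem (j + 1), h13 ▸ C.mate_mem (j + 3)⟩
    · exact ⟨_, C.mate_mem (j + 4), h24 ▸ C.mate_mem (j + 2)⟩
    · obtain ⟨e, h1, h2⟩ := hadj 3 4 (by decide)
      exact ⟨e, h2, h1⟩
    · exact hadj 2 3 (by decide)
    · obtain ⟨e, h1, h2⟩ := hadj 0 1 (by decide)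
      exact ⟨e, h2, h1⟩
    · obtain ⟨e, h1, h2⟩ := hadj 4 0 (by decide)
      exact ⟨e, h2, h1⟩

end FactorCycle

end TwoFactor

end CubicLabel

/-! ### Colourings of cubic structures -/

namespace CubicLabel

section Coloring

variable {V ε : Type*} {A : Finset V} {inc : V → Finset ε} {M : Set ε}

/-- Edges with a common vertex in `A` have colours at circular distance at least `3`. -/
def IsColoring (A : Finset V) (inc : V → Finset ε) (col : ε → Fin 11) : Prop :=
  ∀ v ∈ A, ∀ e ∈ inc v, ∀ f ∈ inc v, e ≠ f → Far (col e) (col f)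

/-- The labels make every odd cycle of the 2-factor good: this is where the labelling theorem for
families of odd cycles is applied. -/
lemma exists_labels [Finite ε] [DecidableEq ε] (h : IsCubic A inc) (hM : IsMatching A inc M)
    (hT : HitsTriangles A inc M) (hθ : SubdividedThetaFree A inc) (hK : SubdividedK4Free A inc) :
    ∃ x : ε → Fin 3, ∀ c : (factorGraph A inc M).ConnectedComponent,
      c.toSimpleGraph.Colorable 2 ∨ ∃ n, ∃ C : FactorCycle A inc M n,
        (∀ e, (factorGraph A inc M).connectedComponentMk e = c ↔ ∃ k, C.edge k = e) ∧
        ∃ col, IsCycleColoring (fun k => x (C.mate k)) col := by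
  classical
  let I := {c : (factorGraph A inc M).ConnectedComponent // ¬ c.toSimpleGraph.Colorable 2}
  have : Finite I := inferInstance
  have := Fintype.ofFinite I
  have hI : ∀ i : I, ∃ n, ∃ C : FactorCycle A inc M n,
      ∀ e, (factorGraph A inc M).connectedComponentMk e = i.1 ↔ ∃ k, C.edge k = e := fun i =>
    (colorable_or_factorCycle h hM i.1).resolve_left i.2
  choose n C hC using hI
  -- a vertex lies on a single cycle, at a single place
  have hslot : ∀ a b : Σ i, ZMod (n i), (C a.1).vert a.2 = (C b.1).vert b.2 → a = b := by
    rintro ⟨i, j⟩ ⟨i', j'⟩ hv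
    have hl := (C i).left_mem j
    simp only at hv
    rw [hv] at hl
    have hii : i = i' := by
      refine Subtype.ext ?_
      rw [← (hC i ((C i).edge j)).2 ⟨j, rfl⟩]
      rcases (C i').eq_or_eq h hM hl ((C i).notMem j) with h1 | h1
      · exact (hC i' _).2 ⟨_, h1.symm⟩
      · exact (hC i' _).2 ⟨_, h1.symm⟩
    subst hii
    rw [(C i).vert_injective h hM hv]
  let F : CycleFamily I ε :=
    { len := n
      var := fun i => (C i).mate
      odd := fun i => (C i).odd
      five_le := fun i => (C i).five_le h hM hT hθ
      two_slots := by
        intro a b c hab hbc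
        rcases h.two _ ((C a.1).vert_mem a.2) _ ((C b.1).vert_mem b.2) _ ((C c.1).vert_mem c.2)
          _ ((C a.1).mate_mem a.2) (hab ▸ (C b.1).mate_mem b.2)
          (hab.trans hbc ▸ (C c.1).mate_mem c.2) with h1 | h1 | h1
        exacts [.inl (hslot _ _ h1), .inr (.inl (hslot _ _ h1)), .inr (.inr (hslot _ _ h1))]
      cross := fun i hi j => (C i).not_crossing h hM hK hi j }
  obtain ⟨x, hx⟩ := F.sol_nonempty Finset.univ
  refine ⟨x, fun c => ?_⟩
  by_cases hc : c.toSimpleGraph.Colorable 2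
  · exact .inl hc
  refine .inr ⟨n ⟨c, hc⟩, C ⟨c, hc⟩, hC ⟨c, hc⟩, ?_⟩
  refine exists_isCycleColoring (C ⟨c, hc⟩).odd ((C ⟨c, hc⟩).five_le h hM hT hθ) ?_
  obtain ⟨k, hk⟩ := hx ⟨c, hc⟩ (Finset.mem_univ _)
  refine ⟨k, ?_⟩
  simpa [Pat, CycleFamily.seq, F] using hk

/-- Each component of the 2-factor is coloured compatibly with the labels of the matching edges. -/
lemma exists_componentColoring (h : IsCubic A inc) (hM : IsMatching A inc M) {x : ε → Fin 3}
    {c : (factorGraph A inc M).ConnectedComponent}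
    (hc : c.toSimpleGraph.Colorable 2 ∨ ∃ n, ∃ C : FactorCycle A inc M n,
        (∀ e, (factorGraph A inc M).connectedComponentMk e = c ↔ ∃ k, C.edge k = e) ∧
        ∃ col, IsCycleColoring (fun k => x (C.mate k)) col) :
    ∃ col : ε → Fin 11, ∀ e, (factorGraph A inc M).connectedComponentMk e = c →
      (∀ f, (factorGraph A inc M).Adj e f → Far (col e) (col f)) ∧
      ∀ v ∈ A, e ∈ inc v → e ∉ M → ∀ m ∈ inc v, m ∈ M → Far (col e) (label (x m)) := by
  classical
  rcases hc with ⟨⟨κ⟩⟩ | ⟨n, C, hC, κ, hκ⟩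
  -- the colours `5` and `8` are far from each other and from all labels
  · let col : ε → Fin 11 := fun e => if he : e ∈ c then (if κ ⟨e, he⟩ = 0 then 5 else 8) else 0
    have hcol : ∀ e (he : e ∈ c), col e = if κ ⟨e, he⟩ = 0 then 5 else 8 := fun e he => dif_pos he
    refine ⟨col, fun e he => ⟨fun f hf => ?_, fun v _ _ _ m _ _ => ?_⟩⟩
    · have hfc : f ∈ c := (SimpleGraph.ConnectedComponent.sound hf.symm.reachable).trans he
      rw [hcol e he, hcol f hfc]
      have hne : κ ⟨e, he⟩ ≠ κ ⟨f, hfc⟩ := κ.valid (show (factorGraph A inc M).Adj e f from hf)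
      revert hne
      generalize κ ⟨e, he⟩ = s
      generalize κ ⟨f, hfc⟩ = t
      revert s t; decide
    · rw [hcol e he]
      generalize κ ⟨e, he⟩ = s
      generalize x m = t
      revert s t; decide
  · have hinv : ∀ k, Function.extend C.edge κ 0 (C.edge k) = κ k := C.inj.extend_apply κ 0
    have hprev : ∀ k, Far (κ (k - 1)) (κ k) ∧ Far (κ (k - 1)) (label (x (C.mate (k - 1)))) ∧
        Far (κ k) (label (x (C.mate (k - 1)))) := by
      intro k
      have := hκ (k - 1)
      rwa [sub_add_cancel] at this
    refine ⟨Function.extend C.edge κ 0, fun e he => ?_⟩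
    obtain ⟨k, rfl⟩ := (hC e).1 he
    refine ⟨fun f hf => ?_, fun v hv hk _ m hm hmM => ?_⟩
    · rcases C.neighbor k f hf with rfl | rfl
      · rw [hinv, hinv]
        exact (hκ k).1
      · rw [hinv, hinv]
        exact (hprev k).1.symm
    · rw [hinv]
      rcases C.eq_vert_or_eq_vert h hM hv hk with rfl | rfl
      · rw [C.mate_eq hM hm hmM]
        exact (hκ k).2.1
      · rw [C.mate_eq hM hm hmM]
        exact (hprev k).2.2

theorem exists_isColoring_of_bridgeless [Finite ε] (h : IsCubic A inc) (hb : Bridgeless A inc)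
    (hθ : SubdividedThetaFree A inc) (hK : SubdividedK4Free A inc) :
    ∃ col, IsColoring A inc col := by
  classical
  obtain ⟨M, hM, hT⟩ := exists_isMatching_hitsTriangles h hb
  obtain ⟨x, hx⟩ := exists_labels h hM hT hθ hK
  choose κ hκ using fun c => exists_componentColoring h hM (hx c)
  let col : ε → Fin 11 := fun e =>
    if e ∈ M then label (x e) else κ ((factorGraph A inc M).connectedComponentMk e) e
  have hmate : ∀ v ∈ A, ∀ e ∈ inc v, ∀ m ∈ inc v, e ∉ M → m ∈ M → Far (col e) (col m) := by
    intro v hv e he m hm heM hmM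
    simp only [col, if_neg heM, if_pos hmM]
    exact (hκ _ e rfl).2 v hv he heM m hm hmM
  refine ⟨col, fun v hv e he f hf hef => ?_⟩
  by_cases heM : e ∈ M
  · by_cases hfM : f ∈ M
    · obtain ⟨m, -, -, hu⟩ := hM v hv
      exact absurd ((hu e he heM).trans (hu f hf hfM).symm) hef
    · exact (hmate v hv f hf e he hfM heM).symm
  · by_cases hfM : f ∈ M
    · exact hmate v hv e he f hf heM hfM
    · have hadj : (factorGraph A inc M).Adj e f := ⟨hef, heM, hfM, v, hv, he, hf⟩
      have hc : (factorGraph A inc M).connectedComponentMk f =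
          (factorGraph A inc M).connectedComponentMk e :=
        SimpleGraph.ConnectedComponent.sound hadj.symm.reachable
      simp only [col, if_neg heM, if_neg hfM]
      rw [hc]
      exact (hκ _ e rfl).1 f hadj

/-- The coloring exists without any assumption on bridges: along a cut with at most one edge the
two sides are coloured separately, and one side is rotated to agree on that edge. -/
theorem exists_isColoring [Finite ε] (h : IsCubic A inc) (hθ : SubdividedThetaFree A inc)
    (hK : SubdividedK4Free A inc) : ∃ col, IsColoring A inc col := by
  classical
  induction A using Finset.strongInduction with
  | H A ih =>
  by_cases hb : Bridgeless A inc
  · exact exists_isColoring_of_bridgeless h hb hθ hK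
  simp only [Bridgeless, not_forall] at hb
  obtain ⟨X, hXA, hXne, hX, hcut⟩ := hb
  have hsub : ∀ B ⊂ A, ∃ col, IsColoring B inc col := fun B hB => ih B hB
    ⟨fun v hv => h.card v (hB.1 hv), fun u hu v hv w hw =>
      h.two u (hB.1 hu) v (hB.1 hv) w (hB.1 hw)⟩
    (fun a ha b hb c hc => hθ a (hB.1 ha) b (hB.1 hb) c (hB.1 hc))
    (fun v hv hm => hK v hv fun k => hB.1 (hm k))
  obtain ⟨col₁, h₁⟩ := hsub X (Finset.ssubset_iff_subset_ne.2 ⟨hXA, hX⟩)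
  obtain ⟨col₂, h₂⟩ := hsub (A \ X) (Finset.sdiff_ssubset hXA hXne)
  have hcut' : ∀ e e', Crossing A inc X e → Crossing A inc X e' → e = e' := fun e e' h1 h2 =>
    by_contra fun hne => hcut ⟨e, e', hne, h1, h2⟩
  obtain ⟨t, ht⟩ : ∃ t, ∀ e, Crossing A inc X e → col₁ e = col₂ e + t := by
    by_cases hex : ∃ e, Crossing A inc X e
    · obtain ⟨e, he⟩ := hex
      refine ⟨col₁ e - col₂ e, fun e' he' => ?_⟩
      rw [hcut' e' e he' he, add_sub_cancel]
    · exact ⟨0, fun e he => absurd ⟨e, he⟩ hex⟩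
  let col : ε → Fin 11 := fun e => if ∃ v ∈ X, e ∈ inc v then col₁ e else col₂ e + t
  refine ⟨col, fun v hv e he f hf hef => ?_⟩
  by_cases hvX : v ∈ X
  · simp only [col, if_pos (⟨v, hvX, he⟩ : ∃ v ∈ X, e ∈ inc v),
      if_pos (⟨v, hvX, hf⟩ : ∃ v ∈ X, f ∈ inc v)]
    exact h₁ v hvX e he f hf hef
  · have key : ∀ e ∈ inc v, col e = col₂ e + t := by
      intro e he
      by_cases hex : ∃ v ∈ X, e ∈ inc v
      · simp only [col, if_pos hex]
        exact ht e ⟨hex, v, hv, hvX, he⟩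
      · simp only [col, if_neg hex]
    rw [key e he, key f hf]
    exact (h₂ v (Finset.mem_sdiff.2 ⟨hv, hvX⟩) e he f hf hef).add_right t

end Coloring

end CubicLabel

/-! ### Graphs as cubic structures -/

namespace CubicLabel

section Translation

variable {α β : Type*} {G : Graph α β}

/-- A copy of `ofEnds ends` in `G` can be given by its vertices and edges; apart from parallel edges
the edges are distinct because the vertices are. -/
lemma containsSubgraph_ofEnds {α' β' : Type*} {ends : β' → Sym2 α'} (f : α' → V(G)) (g : β' → β)
    (hf : Function.Injective f)
    (hg : ∀ i, ∃ x y, ends i = s(x, y) ∧ G.IsLink (g i) (f x) (f y))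
    (hpar : ∀ i j, ends i = ends j → g i = g j → i = j) :
    G.ContainsSubgraph (Graph.ofEnds ends) := by
  have hlink : ∀ i x y, ends i = s(x, y) → G.IsLink (g i) (f x) (f y) := by
    intro i x y h
    obtain ⟨x', y', h', hl⟩ := hg i
    rcases Sym2.eq_iff.1 (h.symm.trans h') with ⟨rfl, rfl⟩ | ⟨rfl, rfl⟩
    exacts [hl, hl.symm]
  refine ⟨fun x => f x, g, fun x _ => (f x).2, (Subtype.val_injective.comp hf).injOn,
    fun i _ j _ hij => ?_, hlink⟩
  obtain ⟨x, y, h, hl⟩ := hg i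
  obtain ⟨z, w, h', hl'⟩ := hg j
  rw [← hij] at hl'
  refine hpar i j ?_ hij
  rw [h, h', Sym2.eq_iff]
  rcases hl.eq_and_eq_or_eq_and_eq hl' with ⟨h1, h2⟩ | ⟨h1, h2⟩
  exacts [.inl ⟨hf (Subtype.ext h1), hf (Subtype.ext h2)⟩,
    .inr ⟨hf (Subtype.ext h1), hf (Subtype.ext h2)⟩]

lemma isLink_of_inc {e : β} {u v : α} (hu : G.Inc e u) (hv : G.Inc e v) (h : u ≠ v) :
    G.IsLink e u v := by
  refine Graph.isLink_iff_inc.2 ⟨hu, hv, fun z hz => ?_⟩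
  rcases hu.eq_or_eq_or_eq hv hz with h1 | h1 | h1
  exacts [absurd h1 h, .inl h1.symm, .inr h1.symm]

variable [Fintype V(G)] [Fintype E(G)]

open Classical in
/-- The edges of `G` at `v`, together with as many half-edges as are needed to have degree three. -/
noncomputable def paddedInc (G : Graph α β) [Fintype V(G)] [Fintype E(G)] (v : V(G)) :
    Finset (E(G) ⊕ V(G) × Fin 3) :=
  (Finset.univ.filter fun e : E(G) => G.Inc e v).disjSum
    ({v} ×ˢ Finset.univ.filter fun i : Fin 3 =>
      i.val < 3 - (Finset.univ.filter fun e : E(G) => G.Inc e v).card)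

lemma inl_mem_paddedInc {v : V(G)} {e : E(G)} : Sum.inl e ∈ paddedInc G v ↔ G.Inc e v := by
  simp [paddedInc]

lemma eq_of_inr_mem_paddedInc {v : V(G)} {p : V(G) × Fin 3} (h : Sum.inr p ∈ paddedInc G v) :
    p.1 = v := by
  simp only [paddedInc, Finset.inr_mem_disjSum, Finset.mem_product, Finset.mem_singleton] at h
  exact h.1

lemma exists_isLink {u v : V(G)} (h : u ≠ v) {x : E(G) ⊕ V(G) × Fin 3} (hu : x ∈ paddedInc G u)
    (hv : x ∈ paddedInc G v) : ∃ e, x = Sum.inl e ∧ G.IsLink e u v := by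
  rcases x with e | p
  · exact ⟨e, rfl, isLink_of_inc (inl_mem_paddedInc.1 hu) (inl_mem_paddedInc.1 hv)
      fun hn => h (Subtype.ext hn)⟩
  · exact absurd ((eq_of_inr_mem_paddedInc hu).symm.trans (eq_of_inr_mem_paddedInc hv)) h

lemma isCubic_paddedInc (hdeg : G.maxDegree = 3) : IsCubic Finset.univ (paddedInc G) := by
  classical
  refine ⟨fun v _ => ?_, fun u _ v _ w _ x hu hv hw => ?_⟩
  · have hle : (Finset.univ.filter fun e : E(G) => G.Inc e v).card ≤ 3 := by
      have h1 : G.degree v ≤ 3 := hdeg ▸ le_iSup₂ (f := fun v (_ : v ∈ V(G)) => G.degree v) v.1 v.2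
      have h2 : {e : β | G.Inc e v} = ((Finset.univ.filter fun e : E(G) => G.Inc e v).map
          (Function.Embedding.subtype _) : Finset β) := by
        ext e
        simp only [Set.mem_ofPred_eq, Finset.coe_map, Function.Embedding.subtype_apply,
          Set.mem_image, Finset.mem_coe, Finset.mem_filter, Finset.mem_univ, true_and]
        exact ⟨fun h => ⟨⟨e, h.edge_mem⟩, h, rfl⟩, fun ⟨e', h, he⟩ => he ▸ h⟩
      rw [Graph.degree, h2, Set.encard_coe_eq_coe_finsetCard, Finset.card_map] at h1
      exact_mod_cast h1
    rw [paddedInc, Finset.card_disjSum, Finset.card_product, Finset.card_singleton, one_mul,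
      Fin.card_filter_val_lt]
    omega
  · by_cases huv : u = v
    · exact .inl huv
    by_cases hvw : v = w
    · exact .inr (.inl hvw)
    obtain ⟨e, rfl, h1⟩ := exists_isLink huv hu hv
    refine .inr (.inr ?_)
    rcases h1.inc_left.eq_or_eq_or_eq h1.inc_right (inl_mem_paddedInc.1 hw) with h2 | h2 | h2
    exacts [absurd (Subtype.ext h2) huv, Subtype.ext h2, absurd (Subtype.ext h2) hvw]

lemma subdividedThetaFree_paddedInc (h₁ : ¬ G.ContainsSubgraph Graph.H₁) :
    SubdividedThetaFree Finset.univ (paddedInc G) := by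
  intro a _ b _ c _ hab hbc hca e f g k hef ea eb fa fb ga gc kc kb
  obtain ⟨e, rfl, hl₀⟩ := exists_isLink hab ea eb
  obtain ⟨f, rfl, hl₁⟩ := exists_isLink hab fa fb
  obtain ⟨g, rfl, hl₂⟩ := exists_isLink hca.symm ga gc
  obtain ⟨k, rfl, hl₃⟩ := exists_isLink hbc.symm kc kb
  have hef' : e.1 ≠ f.1 := fun hn => hef (congrArg Sum.inl (Subtype.ext hn))
  refine h₁ (containsSubgraph_ofEnds ![a, b, c] ![e.1, f.1, g.1, k.1] ?_ ?_ ?_)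
  · intro i j hij
    fin_cases i <;> fin_cases j <;> simp_all [Subtype.ext_iff]
  · intro i
    fin_cases i
    exacts [⟨0, 1, rfl, hl₀⟩, ⟨0, 1, rfl, hl₁⟩, ⟨0, 2, rfl, hl₂⟩, ⟨2, 1, rfl, hl₃⟩]
  · have hends : ∀ i j : Fin 4, ![s((0 : Fin 3), 1), s(0, 1), s(0, 2), s(2, 1)] i =
        ![s((0 : Fin 3), 1), s(0, 1), s(0, 2), s(2, 1)] j →
        i = j ∨ i = 0 ∧ j = 1 ∨ i = 1 ∧ j = 0 := by decide
    intro i j hij hg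
    rcases hends i j hij with h | ⟨rfl, rfl⟩ | ⟨rfl, rfl⟩
    exacts [h, absurd hg hef', absurd hg.symm hef']

lemma subdividedK4Free_paddedInc (h₂ : ¬ G.ContainsSubgraph Graph.H₂) :
    SubdividedK4Free Finset.univ (paddedInc G) := by
  intro v hv _ hp
  have hlink : ∀ i : Fin 7, ∃ e : β, ∃ x y,
      ![s((0 : Fin 5), 2), s(0, 3), s(1, 2), s(1, 3), s(2, 3), s(0, 4), s(4, 1)] i = s(x, y) ∧
        G.IsLink e (v x) (v y) := by
    have key : ∀ i : Fin 7, ∃ p ∈ [(0, 2), (0, 3), (1, 2), (1, 3), (2, 3), (0, 4),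
        ((4, 1) : Fin 5 × Fin 5)], p.1 ≠ p.2 ∧
        ![s((0 : Fin 5), 2), s(0, 3), s(1, 2), s(1, 3), s(2, 3), s(0, 4), s(4, 1)] i =
          s(p.1, p.2) := by decide
    intro i
    obtain ⟨p, hpm, hne, hpi⟩ := key i
    obtain ⟨x, hx1, hx2⟩ := hp p hpm
    obtain ⟨e, -, he⟩ := exists_isLink (hv.ne hne) hx1 hx2
    exact ⟨e, _, _, hpi, he⟩
  choose g hg using hlink
  refine h₂ (containsSubgraph_ofEnds v g hv hg fun i j hij _ => ?_)
  revert hij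
  clear * -
  revert i j; decide

lemma circularChromaticIndex_le (hdeg : G.maxDegree = 3) (h₁ : ¬ G.ContainsSubgraph Graph.H₁)
    (h₂ : ¬ G.ContainsSubgraph Graph.H₂) : G.circularChromaticIndex ≤ 11 / 3 := by
  obtain ⟨col, hcol⟩ := exists_isColoring (isCubic_paddedInc hdeg)
    (subdividedThetaFree_paddedInc h₁) (subdividedK4Free_paddedInc h₂)
  refine csInf_le (SimpleGraph.circularRatios_bddBelow _)
    ⟨11, 3, by norm_num, by norm_num, ⟨fun e => col (Sum.inl e), ?_⟩, by norm_num⟩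
  rintro e f ⟨hef, v, he, hf⟩
  have hfar := hcol ⟨v, he.vertex_mem⟩ (Finset.mem_univ _) (Sum.inl e) (inl_mem_paddedInc.2 he)
    (Sum.inl f) (inl_mem_paddedInc.2 hf) fun hn => hef (Sum.inl_injective hn)
  revert hfar
  beta_reduce
  generalize col (Sum.inl e) = a
  generalize col (Sum.inl f) = b
  revert a b; decide

end Translation

end CubicLabel

/-- `G` ranges over the finite loopless graphs, with parallel edges allowed. -/
theorem theorem1p5 {α β : Type*} (G : Graph α β) [G.Loopless]
    (hV : V(G).Finite) (hE : E(G).Finite)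
    (hdeg : G.maxDegree = 3)
    (h₁ : ¬ G.ContainsSubgraph Graph.H₁) (h₂ : ¬ G.ContainsSubgraph Graph.H₂) :
    G.circularChromaticIndex ≤ 11 / 3 := by
  have := hV.fintype
  have := hE.fintype
  exact CubicLabel.circularChromaticIndex_le hdeg h₁ h₂
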